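/- Let $n\ge 1$, let $P\subset\mathbb R^n$ be a convex body (compact, convex) of Lebesgue volume $1$, let $\lambda_P=1_P\,dp$, and let $\phi_P(x)=\sup_{p\in P}\langle x,p\rangle$. Let $\mu_0\neq 0$ be a Borel measure on $\mathbb R^n$ with support $X$, and let $\phi_0$ be a continuous function on $X$ such that $\phi_0-\phi_P\to\infty$ as $|x|\to\infty$ in $X$ and $\int e^{t(\phi_P-\phi_0)}\,d\mu_0<\infty$ for every $t>0$. For $k\ge1$ let $p_1,\dots,p_N$ ($N=N_k$) be the points of $kP\cap\mathbb Z^n$, let $\mathrm{Per}(x_1,\dots,x_N)$ be the permanent of the matrix $(e^{\langle x_i,p_j\rangle})_{i,j}$, let $\beta_N=\beta_{N_k}$ be a sequence of real numbers (indexed by $k$) with $\beta_N\to\beta\in\,]0,\infty]$, and let $$\mu^{(N)}_{\beta_N}=\frac1{Z_{N,\beta_N}}\Big(\mathrm{Per}(x_1,\dots,x_N)\,e^{-k(\phi_0(x_1)+\dots+\phi_0(x_N))}\Big)^{\beta_N/k}\mu_0^{\otimes N},\qquad \delta_N=\frac1N\sum_{i=1}^N\delta_{x_i}.$$ Then $\mu^{(N)}_{\beta_N}$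 is a well-defined probability measure whenever $\beta_N>0$, and the following holds. 1. The law of $\delta_N$ under $\mu^{(N)}_{\beta_N}$ satisfies, as $k\to\infty$, a large deviation principle with speed $N\beta_N$ on the space $\mathcal M_1(X)$ of probability measures on $X$ with the weak topology, with the (lower semicontinuous, $[0,\infty]$-valued) rate function $$F_\beta(\mu)=C_{\phi_0}(\mu)+\frac1\beta D_{\mu_0}(\mu)-C_\beta .$$ Here $C_{\phi_0}(\mu)=\inf_\Gamma\int(-\langle x,p\rangle+\phi_0(x))\,d\Gamma(x,p)$, the infimum being over all couplings $\Gamma$ of $\mu$ and $\lambda_P$; $D_{\mu_0}(\mu)=\int\log\frac{d\mu}{d\mu_0}\,d\mu$ if $\mu\ll\mu_0$ and $D_{\mu_0}(\mu)=\infty$ otherwise; $F_\beta(\mu):=\infty$ if $C_{\phi_0}(\mu)=\infty$; the entropy term is absent if $\beta=\infty$; and $C_\beta\in\mathbb R$ is the constant for which $\inf_{\mathcal M_1(X)}F_\beta=0$. 2. The random measures $\delta_N$ converge in probability (for the weak topology on $\mathcal M_1(X)$) to a deterministic measure $\mu_\beta=MA(\phi_\beta)\in\mathcal M_1(X)$,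 where $MA(\phi)$ is the Monge–Ampère measure in the sense of Alexandrov, i.e. $MA(\phi)(A)$ is the Lebesgue measure of the image of the Borel set $A$ under the subgradient map of $\phi$, and where * if $\beta<\infty$, $\phi_\beta$ is the unique convex function $\phi$ on $\mathbb R^n$ all of whose subgradients lie in $P$, whose Monge–Ampère measure has full mass $MA(\phi)(\mathbb R^n)=1$, and which satisfies $MA(\phi)=e^{\beta(\phi-\phi_0)}\mu_0$; in particular such a function exists; * if $\beta=\infty$, $\phi_\beta$ is the constrained convex envelope $\phi_e(x)=\sup\{\phi(x):\ \phi \text{ convex on }\mathbb R^n,\ \nabla\phi\in P,\ \phi\le\phi_0\text{ on }X\}$. -/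

import Mathlib

open MeasureTheory Filter Topology Set
open scoped ENNReal Pointwise RealInnerProductSpace

noncomputable section

namespace PermanentalLDP

/-- `ℝⁿ` with its Euclidean structure. -/
abbrev Rn (n : ℕ) : Type := EuclideanSpace ℝ (Fin n)

variable {n : ℕ}

/-! ### Large deviation principles and extended integrals -/

/-- The large deviation principle with speed `r k` and rate function `I` on a topological space
`M`, for a sequence of laws on `M`; `Γ k A` is the mass that the `k`-th law gives to `A` (only
closed and open sets `A` matter). A rate function is lower semicontinuous with values in
`[0, ∞]`. -/
structure SatisfiesLDP {M : Type*} [TopologicalSpace M]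
    (Γ : ℕ → Set M → ℝ≥0∞) (r : ℕ → ℝ) (I : M → EReal) : Prop where
  nonneg : ∀ ν, 0 ≤ I ν
  lsc : LowerSemicontinuous I
  upper : ∀ A : Set M, IsClosed A →
    limsup (fun k => ENNReal.log (Γ k A) / (r k : EReal)) atTop ≤ -(⨅ ν ∈ A, I ν)
  lower : ∀ A : Set M, IsOpen A →
    -(⨅ ν ∈ A, I ν) ≤ liminf (fun k => ENNReal.log (Γ k A) / (r k : EReal)) atTop

/-- The integral of a real function with values in `[-∞, ∞]`: integral of the positive part minus
integral of the negative part (meaningful when one of the two is finite). -/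
def eintegral {α : Type*} [MeasurableSpace α] (μ : Measure α) (f : α → ℝ) : EReal :=
  ((∫⁻ a, ENNReal.ofReal (f a) ∂μ : ℝ≥0∞) : EReal) -
    ((∫⁻ a, ENNReal.ofReal (-f a) ∂μ : ℝ≥0∞) : EReal)

/-- The relative entropy `D_{μ₀}(μ) = ∫ log (dμ/dμ₀) dμ` if `μ ≪ μ₀`, and `∞` otherwise. -/
def relEntropy {α : Type*} [MeasurableSpace α] (μ₀ μ : Measure α) : EReal :=
  open Classical in if μ ≪ μ₀ then eintegral μ (llr μ μ₀) else ⊤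

/-! ### Convex functions and the Monge–Ampère measure -/

/-- The support function `φ_P(x) = sup_{p ∈ P} ⟨x, p⟩` of a convex body. -/
def supportFun (P : ConvexBody (Rn n)) (x : Rn n) : ℝ :=
  sSup ((fun p => ⟪x, p⟫) '' (P : Set (Rn n)))

/-- The set of subgradients of `φ` at `x`. -/
def subgrad (φ : Rn n → ℝ) (x : Rn n) : Set (Rn n) :=
  {p | ∀ y, φ x + ⟪p, y - x⟫ ≤ φ y}

/-- The image of a set under the multivalued subgradient map. -/
def subgradImage (φ : Rn n → ℝ) (A : Set (Rn n)) : Set (Rn n) :=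
  ⋃ x ∈ A, subgrad φ x

/-- `μ` is the Monge–Ampère measure `MA(φ)` in the sense of Alexandrov: the mass of every Borel
set is the Lebesgue measure of its subgradient image. -/
def IsMongeAmpere (φ : Rn n → ℝ) (μ : Measure (Rn n)) : Prop :=
  ∀ A, MeasurableSet A → μ A = volume (subgradImage φ A)

/-- `φ` is a convex function on `ℝⁿ` with `∇φ ∈ P` in the sense of subgradients. -/
def IsPotential (P : ConvexBody (Rn n)) (φ : Rn n → ℝ) : Prop :=
  ConvexOn ℝ univ φ ∧ ∀ x, subgrad φ x ⊆ P

/-- `(μ₀, φ₀)` is a weighted measure (relative to `P`), with `X` the support of `μ₀`. -/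
structure IsWeightedMeasure (P : ConvexBody (Rn n)) (μ₀ : Measure (Rn n)) (φ₀ : Rn n → ℝ) :
    Prop where
  continuousOn : ContinuousOn φ₀ μ₀.support
  growth : Tendsto (fun x => φ₀ x - supportFun P x) (cocompact (Rn n) ⊓ 𝓟 μ₀.support) atTop
  finite_mass : ∀ t : ℝ, 0 < t →
    ∫⁻ x, ENNReal.ofReal (Real.exp (t * (supportFun P x - φ₀ x))) ∂μ₀ < ∞

/-- The convex envelope
`φ_e(x) = sup {φ(x) : φ convex on ℝⁿ, ∇φ ∈ P, φ ≤ φ₀ on X}`. -/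
def convexEnvelope (P : ConvexBody (Rn n)) (X : Set (Rn n)) (φ₀ : Rn n → ℝ) (x : Rn n) : ℝ :=
  sSup {t | ∃ φ, IsPotential P φ ∧ (∀ y ∈ X, φ y ≤ φ₀ y) ∧ t = φ x}

/-- `φ` solves the second boundary value problem for `MA(φ) = e^{β(φ - φ₀)} μ₀` with target `P`:
`φ` is convex, `∇φ ∈ P`, the Monge–Ampère measure has full mass `1` (which is the volume of `P`),
and the equation holds. -/
def IsMASolution (P : ConvexBody (Rn n)) (μ₀ : Measure (Rn n)) (φ₀ : Rn n → ℝ) (β : ℝ)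
    (φ : Rn n → ℝ) : Prop :=
  IsPotential P φ ∧ volume (subgradImage φ univ) = 1 ∧
    IsMongeAmpere φ (μ₀.withDensity fun x => ENNReal.ofReal (Real.exp (β * (φ x - φ₀ x))))

/-! ### The permanental point processes -/

lemma finite_lattice (P : ConvexBody (Rn n)) (k : ℕ) :
    {p : Rn n | p ∈ (k : ℝ) • (P : Set (Rn n)) ∧ ∀ i, ∃ m : ℤ, p i = m}.Finite := by
  obtain ⟨R, hR⟩ := ((P.isCompact.smul (k : ℝ)).isBounded).exists_norm_le
  have hfin : (Set.pi univ fun _ : Fin n => Set.Icc (-⌈R⌉) ⌈R⌉).Finite :=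
    Set.Finite.pi fun _ => Set.finite_Icc _ _
  refine (hfin.image fun m : Fin n → ℤ => WithLp.toLp 2 fun i => (m i : ℝ)).subset ?_
  rintro p ⟨hp, hint⟩
  choose m hm using hint
  refine ⟨m, fun i _ => ?_, ?_⟩
  · have h1 : |(m i : ℝ)| ≤ R := by
      rw [← hm i, ← Real.norm_eq_abs]
      exact (PiLp.norm_apply_le p i).trans (hR p hp)
    have h2 := abs_le.1 (h1.trans (Int.le_ceil R))
    exact ⟨by exact_mod_cast h2.1, by exact_mod_cast h2.2⟩
  · ext i
    simp [hm i]

/-- The lattice points (points of `ℤⁿ`) in the scaled body `kP`. -/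
def latticePoints (P : ConvexBody (Rn n)) (k : ℕ) : Finset (Rn n) :=
  (finite_lattice P k).toFinset

/-- The number `N = N_k` of lattice points in `kP`. -/
def numPoints (P : ConvexBody (Rn n)) (k : ℕ) : ℕ := (latticePoints P k).card

/-- An auxiliary ordering `p₁, …, p_N` of the lattice points in `kP`. -/
def latticePt (P : ConvexBody (Rn n)) (k : ℕ) (j : Fin (numPoints P k)) : Rn n :=
  ((latticePoints P k).equivFin.symm j : Rn n)

/-- `Per(x₁, …, x_N)`, the permanent of the matrix `(e^{⟨x_i, p_j⟩})`. -/
def per (P : ConvexBody (Rn n)) (k : ℕ) (x : Fin (numPoints P k) → Rn n) : ℝ :=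
  Matrix.permanent (Matrix.of fun i j => Real.exp ⟪x i, latticePt P k j⟫)

/-- The unnormalized measure `(Per(x) e^{-k ∑ φ₀(x_i)})^{b/k} μ₀^{⊗N}` at inverse temperature
`b`. -/
def gibbsWeight (P : ConvexBody (Rn n)) (μ₀ : Measure (Rn n)) (φ₀ : Rn n → ℝ) (k : ℕ) (b : ℝ) :
    Measure (Fin (numPoints P k) → Rn n) :=
  (Measure.pi fun _ => μ₀).withDensity fun x =>
    ENNReal.ofReal ((per P k x * Real.exp (-(k * ∑ i, φ₀ (x i)))) ^ (b / k))

/-- The `b`-deformed permanental point process `μ_b^{(N)}`, where `N = N_k`. -/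
def gibbs (P : ConvexBody (Rn n)) (μ₀ : Measure (Rn n)) (φ₀ : Rn n → ℝ) (k : ℕ) (b : ℝ) :
    Measure (Fin (numPoints P k) → Rn n) :=
  (gibbsWeight P μ₀ φ₀ k b univ)⁻¹ • gibbsWeight P μ₀ φ₀ k b

/-- The empirical measure `(1/N) ∑ δ_{x_i}` of a configuration. -/
def empirical {N : ℕ} (x : Fin N → Rn n) : Measure (Rn n) :=
  (N : ℝ≥0∞)⁻¹ • ∑ i, Measure.dirac (x i)

/-- The space `M₁(X)` of Borel probability measures on `ℝⁿ` carried by `X`, with the topology of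
weak convergence. -/
abbrev ProbOn (X : Set (Rn n)) : Type :=
  {ν : ProbabilityMeasure (Rn n) // (ν : Measure (Rn n)) Xᶜ = 0}

/-- The underlying measure on `ℝⁿ` of an element of `M₁(X)`. -/
abbrev ProbOn.meas {X : Set (Rn n)} (ν : ProbOn X) : Measure (Rn n) :=
  ((ν : ProbabilityMeasure (Rn n)) : Measure (Rn n))

/-- The law of the empirical measure, as a probability on `M₁(X)`: the mass of `A` is the
probability, under `μ_b^{(N)}`, that the empirical measure belongs to `A`. -/
def empiricalLaw (P : ConvexBody (Rn n)) (μ₀ : Measure (Rn n)) (φ₀ : Rn n → ℝ) (k : ℕ) (b : ℝ)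
    (A : Set (ProbOn μ₀.support)) : ℝ≥0∞ :=
  gibbs P μ₀ φ₀ k b {x | ∃ ν ∈ A, ν.meas = empirical x}

/-! ### The rate functional -/

/-- The Monge–Kantorovich optimal cost `C_{φ₀}(μ)` to transport `μ` to the uniform measure
`λ_P = 1_P dp` on `P`, for the cost function `c(x, p) = -⟨x, p⟩ + φ₀(x)`. -/
def transportCost (P : ConvexBody (Rn n)) (φ₀ : Rn n → ℝ) (μ : Measure (Rn n)) : EReal :=
  ⨅ (G : Measure (Rn n × Rn n))
    (_ : G.map Prod.fst = μ ∧ G.map Prod.snd = volume.restrict (P : Set (Rn n))),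
    eintegral G fun z => -⟪z.1, z.2⟫ + φ₀ z.1

/-- The free energy `C_{φ₀} + β⁻¹ D_{μ₀}` on `M₁(X)`, for `β ∈ (0, ∞]`, which is `∞` where the
optimal cost is infinite. (Where the cost is finite, the entropy is well defined in `(-∞, ∞]`.
For `β = ∞` the entropy term vanishes, since `D / ⊤ = 0` in `EReal` for all values of `D`.) -/
def freeEnergy (P : ConvexBody (Rn n)) (μ₀ : Measure (Rn n)) (φ₀ : Rn n → ℝ) (β : EReal)
    (ν : ProbOn μ₀.support) : EReal :=
  open Classical in
  if transportCost P φ₀ ν.meas = ⊤ then ⊤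
  else transportCost P φ₀ ν.meas + relEntropy μ₀ ν.meas / β

/-- The empirical measures converge in probability to `μ ∈ M₁(X)`: every neighbourhood of `μ` in
the weak topology has probability tending to `1`. -/
def EmpiricalConvergesTo (P : ConvexBody (Rn n)) (μ₀ : Measure (Rn n)) (φ₀ : Rn n → ℝ)
    (b : ℕ → ℝ) (μ : ProbOn μ₀.support) : Prop :=
  ∀ U : Set (ProbOn μ₀.support), IsOpen U → μ ∈ U →
    Tendsto (fun k => empiricalLaw P μ₀ φ₀ k (b k) U) atTop (𝓝 1)

end PermanentalLDP

end

/-!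
The idea is to treat the interaction as an optimal transport problem. The energy of a configuration
is `-k⁻¹ log Per` plus the external potential, and the permanent lies between its largest term and
`N!` times that term. Since `log N! = o(kN)`, the energy per particle is, up to a vanishing error,
the cheapest matching of the particles with the lattice points of `kP` scaled back to `P`. As these
points equidistribute in `P`, this is close to the optimal transport cost from the empirical measure
to the uniform measure of `P` (`eventually_lt_energy`, `energy_le`). The weight `φ₀`, given on the
support only, is first replaced by one that is continuous and coercive on the whole space, which
changes none of the objects involved (`IsWeightedMeasure.exists_isCoerciveWeight`).

*Upper bound.* A part `t` of the inverse temperature is spent on making `μ₀` finite: the energy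
dominates the sum of `φ₀ - φ_P`, and `exp (-t (φ₀ - φ_P))` is integrable. What is left of the energy
is bounded below by the transport cost, and the product measure contributes the relative entropy
through the Donsker–Varadhan formula (`gibbsWeight_le`, `exists_continuous_lt_integral_sub_log`).
This yields local upper bounds, and `exists_isCompact_empiricalWeight_compl_le` gives exponential
tightness.

*Lower bound.* Particles sampled independently from the first marginal of a coupling come with
partners in `P`, and the partners can be matched with the lattice points at small total distance by
counting them in small cells (`eventually_exists_perm_sum_norm_le`). Hence the product of the first
marginals charges configurations of almost optimal energy, and passing to `μ₀` costs the entropy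
(`eventually_le_empiricalWeight`). This requires compact support and a bounded density. A general
measure is approximated by resampling the first coordinate of a coupling with suitable kernels
(`IsApproxKernel.exists_approx`): truncations if `β < ∞`, and local averages of `μ₀`, which create
a density, if `β = ∞`.

*Conclusion.* Such exponential bounds (`HasExpBounds`) imply the large deviation principle and, if
the rate function has a unique zero, convergence in probability to it. The zero is found by duality.
For `β < ∞`, minimizing `∫ φ^* + β⁻¹ log ∫ exp (β (φ - φ₀)) dμ₀` over the convex functions with
subgradients in `P` produces a solution of the Monge–Ampère equation (`exists_minimizing_potential`,
`exists_isMASolution`). By weak Kantorovich duality and Gibbs' inequality the Monge–Ampère measure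
of any solution is the unique minimizer of the free energy, whence also the uniqueness of the
solution (`IsMASolution.exists_minimizer`, `IsMASolution.unique`). For `β = ∞`, the Monge–Ampère
measure of the convex envelope is carried by the set where it equals `φ₀`, and duality makes it the
unique minimizer of the transport cost (`exists_minimizer_transportCost`).
-/

namespace PermanentalLDP

/-! ### Closed and compact sets of probability measures -/

section ProbabilityMeasures

variable {X : Type*} [MeasurableSpace X] [MetricSpace X] [BorelSpace X]

/-- A nonnegative continuous function is the supremum of its truncations, whose integrals are
weakly continuous. -/
lemma lowerSemicontinuous_lintegral_ofReal {w : X → ℝ} (hw : Continuous w) :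
    LowerSemicontinuous
      fun μ : ProbabilityMeasure X => ∫⁻ x, ENNReal.ofReal (w x) ∂(μ : Measure X) := by
  let g : ℕ → BoundedContinuousFunction X NNReal := fun R =>
    BoundedContinuousFunction.mkOfBound ⟨fun x => min (w x).toNNReal R, by fun_prop⟩ R (by
      intro x y
      rw [NNReal.dist_eq, abs_le]
      have h1 : ((min (w x).toNNReal (R : NNReal) : NNReal) : ℝ) ≤ R := by
        exact_mod_cast min_le_right _ _
      have h2 : ((min (w y).toNNReal (R : NNReal) : NNReal) : ℝ) ≤ R := by
        exact_mod_cast min_le_right _ _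
      have h3 := NNReal.coe_nonneg (min (w x).toNNReal (R : NNReal))
      have h4 := NNReal.coe_nonneg (min (w y).toNNReal (R : NNReal))
      simp only [ContinuousMap.coe_mk]
      constructor <;> linarith)
  have hg : ∀ μ : ProbabilityMeasure X, ∫⁻ x, ENNReal.ofReal (w x) ∂(μ : Measure X)
      = ⨆ R, ∫⁻ x, g R x ∂(μ : Measure X) := by
    intro μ
    rw [← lintegral_iSup]
    · refine lintegral_congr fun x => le_antisymm ?_ ?_
      · obtain ⟨R, hR⟩ := exists_nat_ge (w x)
        refine le_iSup_of_le R ?_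
        have : g R x = (w x).toNNReal := by
          refine min_eq_left ?_
          rw [Real.toNNReal_le_iff_le_coe]
          simpa using hR
        rw [this]; rfl
      · refine iSup_le fun R => ?_
        have : g R x ≤ (w x).toNNReal := min_le_left _ _
        exact ENNReal.coe_le_coe.2 this
    · intro R
      exact (ENNReal.continuous_coe.comp (g R).continuous).measurable
    · intro R S hRS x
      refine ENNReal.coe_le_coe.2 (min_le_min le_rfl ?_)
      exact_mod_cast hRS
  simp_rw [hg]
  exact lowerSemicontinuous_iSup fun R =>
    (ProbabilityMeasure.continuous_lintegral_boundedContinuousFunction (g R)).lowerSemicontinuous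

lemma isClosed_setOf_lintegral_ofReal_le {w : X → ℝ} (hw : Continuous w) (c : ℝ≥0∞) :
    IsClosed {μ : ProbabilityMeasure X | ∫⁻ x, ENNReal.ofReal (w x) ∂(μ : Measure X) ≤ c} :=
  (lowerSemicontinuous_lintegral_ofReal hw).isClosed_preimage c

lemma isClosed_setOf_measure_compl_eq_zero {F : Set X} (hF : IsClosed F) :
    IsClosed {μ : ProbabilityMeasure X | (μ : Measure X) Fᶜ = 0} := by
  rcases F.eq_empty_or_nonempty with rfl | hne
  · simp
  convert isClosed_setOf_lintegral_ofReal_le (Metric.continuous_infDist_pt F) 0 using 1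
  ext μ
  simp only [mem_ofPred_eq, nonpos_iff_eq_zero]
  rw [lintegral_eq_zero_iff (Metric.continuous_infDist_pt F).measurable.ennreal_ofReal]
  change _ ↔ (μ : Measure X) _ = 0
  have hs : Fᶜ = {x | (fun x => ENNReal.ofReal (Metric.infDist x F)) x = (0 : X → ℝ≥0∞) x}ᶜ := by
    ext x
    simp only [mem_compl_iff, Pi.zero_apply, ENNReal.ofReal_eq_zero, mem_ofPred_eq]
    rw [hF.mem_iff_infDist_zero hne]
    exact not_congr ⟨fun h => h.le, fun h => le_antisymm h Metric.infDist_nonneg⟩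
  rw [hs]

/-- Prokhorov's theorem for measures that integrate a function with compact sublevel sets. -/
lemma isCompact_setOf_lintegral_ofReal_le {w : X → ℝ} (hw : Continuous w) {F : Set X}
    (hF : IsClosed F) (hK : ∀ R : ℝ, IsCompact {x | x ∈ F ∧ w x ≤ R}) {c : ℝ≥0∞} (hc : c ≠ ∞) :
    IsCompact {μ : ProbabilityMeasure X | (μ : Measure X) Fᶜ = 0 ∧
      ∫⁻ x, ENNReal.ofReal (w x) ∂(μ : Measure X) ≤ c} := by
  set S := {μ : ProbabilityMeasure X | (μ : Measure X) Fᶜ = 0 ∧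
      ∫⁻ x, ENNReal.ofReal (w x) ∂(μ : Measure X) ≤ c} with hS
  have hcl : IsClosed S :=
    (isClosed_setOf_measure_compl_eq_zero hF).inter (isClosed_setOf_lintegral_ofReal_le hw c)
  rw [← hcl.closure_eq]
  apply isCompact_closure_of_isTightMeasureSet
  rw [isTightMeasureSet_iff_exists_isCompact_measure_compl_le]
  intro ε hε
  -- Markov's inequality at a level `R` with `c / R ≤ ε`
  obtain ⟨R, hR0, hR⟩ : ∃ R : ℝ, 0 < R ∧ c / ENNReal.ofReal R ≤ ε := by
    rcases eq_or_ne ε ∞ with rfl | hε'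
    · exact ⟨1, one_pos, le_top⟩
    refine ⟨(c / ε).toReal + 1, by positivity, ?_⟩
    have hfin : c / ε ≠ ∞ := ENNReal.div_ne_top hc hε.ne'
    refine ENNReal.div_le_of_le_mul' ?_
    calc c = (c / ε) * ε := (ENNReal.div_mul_cancel hε.ne' hε').symm
      _ ≤ _ := by
        gcongr
        rw [ENNReal.le_ofReal_iff_toReal_le hfin (by positivity)]
        linarith
  refine ⟨_, hK R, ?_⟩
  rintro _ ⟨μ, hμ, rfl⟩
  have hsub : {x | x ∈ F ∧ w x ≤ R}ᶜ ⊆ Fᶜ ∪ {x | ENNReal.ofReal R ≤ ENNReal.ofReal (w x)} := by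
    intro x hx
    by_cases hxF : x ∈ F
    · right
      have : ¬ w x ≤ R := fun h => hx ⟨hxF, h⟩
      exact ENNReal.ofReal_le_ofReal (not_le.1 this).le
    · exact Or.inl hxF
  calc (μ : Measure X) {x | x ∈ F ∧ w x ≤ R}ᶜ
      ≤ (μ : Measure X) Fᶜ + (μ : Measure X) {x | ENNReal.ofReal R ≤ ENNReal.ofReal (w x)} :=
        (measure_mono hsub).trans (measure_union_le _ _)
    _ ≤ 0 + (∫⁻ x, ENNReal.ofReal (w x) ∂(μ : Measure X)) / ENNReal.ofReal R := by
        gcongr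
        · exact hμ.1.le
        · exact meas_ge_le_lintegral_div hw.measurable.ennreal_ofReal.aemeasurable
            (by simpa using hR0) ENNReal.ofReal_ne_top
    _ ≤ ε := by
        rw [zero_add]
        exact (ENNReal.div_le_div_right hμ.2 _).trans hR

end ProbabilityMeasures

/-! ### From local exponential bounds to the large deviation principle -/

section LargeDeviations

lemma coe_lt_sub_coe_iff {a : EReal} {M C : ℝ} :
    (M : EReal) < a - (C : EReal) ↔ ((M + C : ℝ) : EReal) < a := by
  induction a with
  | bot => simp
  | top => simpa using EReal.coe_lt_top (M + C)
  | coe a => norm_cast; constructor <;> intro h <;> linarith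

lemma sub_coe_lt_coe_iff {a : EReal} {M C : ℝ} :
    a - (C : EReal) < (M : EReal) ↔ a < ((M + C : ℝ) : EReal) := by
  induction a with
  | bot => simp [EReal.bot_lt_coe]
  | top => simp
  | coe a => norm_cast; constructor <;> intro h <;> linarith

lemma log_div_le_of_le_exp {a : ℝ≥0∞} {r M : ℝ} (hr : 0 < r)
    (h : a ≤ ENNReal.ofReal (Real.exp (-r * M))) :
    ENNReal.log a / (r : EReal) ≤ ((-M : ℝ) : EReal) := by
  rw [EReal.div_le_iff_le_mul (by exact_mod_cast hr) (EReal.coe_ne_top r)]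
  calc ENNReal.log a ≤ ENNReal.log (ENNReal.ofReal (Real.exp (-r * M))) := ENNReal.log_monotone h
    _ = ((-M : ℝ) : EReal) * (r : EReal) := by
      rw [ENNReal.log_ofReal_of_pos (Real.exp_pos _), Real.log_exp]
      norm_cast; ring
    _ ≤ _ := le_of_eq (mul_comm _ _)

lemma le_log_div_of_exp_le {a : ℝ≥0∞} {r M : ℝ} (hr : 0 < r)
    (h : ENNReal.ofReal (Real.exp (-r * M)) ≤ a) :
    ((-M : ℝ) : EReal) ≤ ENNReal.log a / (r : EReal) := by
  rw [EReal.le_div_iff_mul_le (by exact_mod_cast hr) (EReal.coe_ne_top r)]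
  calc ((-M : ℝ) : EReal) * (r : EReal) = ENNReal.log (ENNReal.ofReal (Real.exp (-r * M))) := by
        rw [ENNReal.log_ofReal_of_pos (Real.exp_pos _), Real.log_exp]
        norm_cast; ring
    _ ≤ _ := ENNReal.log_monotone h

lemma inv_mul_le_exp {W Z : ℝ≥0∞} {a b c : ℝ} (hW : W ≤ ENNReal.ofReal (Real.exp a))
    (hZ : ENNReal.ofReal (Real.exp b) ≤ Z) (h : a - b = c) :
    Z⁻¹ * W ≤ ENNReal.ofReal (Real.exp c) := by
  calc Z⁻¹ * W ≤ (ENNReal.ofReal (Real.exp b))⁻¹ * ENNReal.ofReal (Real.exp a) := by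
        gcongr
    _ = ENNReal.ofReal (Real.exp c) := by
        rw [← ENNReal.ofReal_inv_of_pos (Real.exp_pos _), ← ENNReal.ofReal_mul (by positivity),
          ← Real.exp_neg, ← Real.exp_add]
        congr 2; linarith

lemma exp_le_inv_mul {W Z : ℝ≥0∞} {a b c : ℝ} (hW : ENNReal.ofReal (Real.exp a) ≤ W)
    (hZ : Z ≤ ENNReal.ofReal (Real.exp b)) (h : a - b = c) :
    ENNReal.ofReal (Real.exp c) ≤ Z⁻¹ * W := by
  calc ENNReal.ofReal (Real.exp c)
      = (ENNReal.ofReal (Real.exp b))⁻¹ * ENNReal.ofReal (Real.exp a) := by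
        rw [← ENNReal.ofReal_inv_of_pos (Real.exp_pos _), ← ENNReal.ofReal_mul (by positivity),
          ← Real.exp_neg, ← Real.exp_add]
        congr 2; linarith
    _ ≤ _ := by gcongr

/-- Local exponential bounds for unnormalized masses `W k A` at speed `r k`, with respect to a
functional `F`: a local upper bound, exponential tightness, and a lower bound on open sets. -/
structure HasExpBounds {M : Type*} [TopologicalSpace M] (W : ℕ → Set M → ℝ≥0∞) (r : ℕ → ℝ)
    (F : M → EReal) : Prop where
  tendsto : Tendsto r atTop atTop
  empty : ∀ k, W k ∅ = 0
  mono : ∀ k A B, A ⊆ B → W k A ≤ W k B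
  union : ∀ k A B, W k (A ∪ B) ≤ W k A + W k B
  upper : ∀ ν, ∀ a : ℝ, (a : EReal) < F ν → ∃ U, IsOpen U ∧ ν ∈ U ∧ ∃ a' > a,
    ∀ᶠ k in atTop, W k U ≤ ENNReal.ofReal (Real.exp (-r k * a'))
  tight : ∀ a : ℝ, ∃ K, IsCompact K ∧
    ∀ᶠ k in atTop, W k Kᶜ ≤ ENNReal.ofReal (Real.exp (-r k * a))
  lower : ∀ A, IsOpen A → ∀ ν ∈ A, ∀ a : ℝ, F ν < a →
    ∀ᶠ k in atTop, ENNReal.ofReal (Real.exp (-r k * a)) ≤ W k A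

variable {M : Type*} [TopologicalSpace M] {W : ℕ → Set M → ℝ≥0∞} {r : ℕ → ℝ} {F : M → EReal}

lemma HasExpBounds.upper_union (h : HasExpBounds W r F) {A B : Set M} {a a₁ a₂ : ℝ}
    (h₁ : a < a₁) (h₂ : a < a₂)
    (hA : ∀ᶠ k in atTop, W k A ≤ ENNReal.ofReal (Real.exp (-r k * a₁)))
    (hB : ∀ᶠ k in atTop, W k B ≤ ENNReal.ofReal (Real.exp (-r k * a₂))) :
    ∃ a' > a, ∀ᶠ k in atTop, W k (A ∪ B) ≤ ENNReal.ofReal (Real.exp (-r k * a')) := by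
  have hm : a < min a₁ a₂ := lt_min h₁ h₂
  refine ⟨(a + min a₁ a₂) / 2, by linarith, ?_⟩
  -- the factor `2` is absorbed by the gap between the two exponents, as `r k → ∞`
  filter_upwards [hA, hB, h.tendsto.eventually_ge_atTop (2 * Real.log 2 / (min a₁ a₂ - a)),
    h.tendsto.eventually_ge_atTop 0] with k h1 h2 h3 h4
  have h5 : W k (A ∪ B) ≤ ENNReal.ofReal (Real.exp (-r k * min a₁ a₂)) +
      ENNReal.ofReal (Real.exp (-r k * min a₁ a₂)) := by
    refine (h.union k A B).trans (add_le_add (h1.trans ?_) (h2.trans ?_)) <;>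
      refine ENNReal.ofReal_le_ofReal (Real.exp_le_exp.2 ?_)
    · nlinarith [min_le_left a₁ a₂]
    · nlinarith [min_le_right a₁ a₂]
  refine h5.trans ?_
  rw [← ENNReal.ofReal_add (by positivity) (by positivity)]
  refine ENNReal.ofReal_le_ofReal ?_
  rw [div_le_iff₀ (by linarith)] at h3
  calc _ = Real.exp (Real.log 2 + -r k * min a₁ a₂) := by
        rw [Real.exp_add, Real.exp_log two_pos]; ring
    _ ≤ _ := Real.exp_le_exp.2 (by nlinarith)

lemma HasExpBounds.upper_isClosed (h : HasExpBounds W r F) {A : Set M} (hA : IsClosed A) {a : ℝ}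
    (ha : ∀ ν ∈ A, (a : EReal) < F ν) :
    ∃ a' > a, ∀ᶠ k in atTop, W k A ≤ ENNReal.ofReal (Real.exp (-r k * a')) := by
  obtain ⟨K, hK, hKW⟩ := h.tight (a + 1)
  have hc : IsCompact (K ∩ A) := hK.inter_right hA
  have hp : ∃ a' > a, ∀ᶠ k in atTop, W k (K ∩ A) ≤ ENNReal.ofReal (Real.exp (-r k * a')) := by
    refine hc.induction_on (p := fun S => ∃ a' > a, ∀ᶠ k in atTop,
      W k S ≤ ENNReal.ofReal (Real.exp (-r k * a'))) ?_ ?_ ?_ ?_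
    · exact ⟨a + 1, by linarith, Eventually.of_forall fun k => by simp [h.empty]⟩
    · rintro S T hST ⟨a', ha', hT⟩
      exact ⟨a', ha', hT.mono fun k hk => (h.mono k _ _ hST).trans hk⟩
    · rintro S T ⟨a₁, ha₁, hS⟩ ⟨a₂, ha₂, hT⟩
      exact h.upper_union ha₁ ha₂ hS hT
    · intro ν hν
      obtain ⟨U, hU, hνU, a', ha', hW⟩ := h.upper ν a (ha ν hν.2)
      exact ⟨U, mem_nhdsWithin_of_mem_nhds (hU.mem_nhds hνU), a', ha', hW⟩
  obtain ⟨a₁, ha₁, h₁⟩ := hp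
  obtain ⟨a', ha', h'⟩ := h.upper_union ha₁ (by linarith : a < a + 1) h₁ hKW
  refine ⟨a', ha', h'.mono fun k hk => (h.mono k _ _ fun x hx => ?_).trans hk⟩
  by_cases hxK : x ∈ K
  · exact Or.inl ⟨hxK, hx⟩
  · exact Or.inr hxK

/-- The upper and the lower bound on a neighbourhood are only compatible if `F` is lower
semicontinuous. -/
lemma HasExpBounds.lowerSemicontinuous (h : HasExpBounds W r F) : LowerSemicontinuous F := by
  intro ν y hy
  obtain ⟨a, hya, haF⟩ := EReal.lt_iff_exists_real_btwn.1 hy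
  obtain ⟨U, hU, hνU, a', ha', hW⟩ := h.upper ν a haF
  filter_upwards [hU.mem_nhds hνU] with ν' hν'
  refine hya.trans ?_
  by_contra! hlt
  have h1 := h.lower U hU ν' hν' ((a + a') / 2)
    (hlt.trans_lt (by exact_mod_cast (by linarith : a < (a + a') / 2)))
  obtain ⟨k, h2, h3, h4⟩ := (h1.and (hW.and (h.tendsto.eventually_gt_atTop 0))).exists
  have h5 := (ENNReal.ofReal_le_ofReal_iff (Real.exp_pos _).le).1 (h2.trans h3)
  rw [Real.exp_le_exp] at h5
  nlinarith

variable {μ : M} {C : ℝ}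

lemma HasExpBounds.upper_univ (h : HasExpBounds W r F) (hC : ∀ ν, (C : EReal) ≤ F ν) {a : ℝ}
    (ha : a < C) : ∀ᶠ k in atTop, W k univ ≤ ENNReal.ofReal (Real.exp (-r k * a)) := by
  obtain ⟨a', ha', h'⟩ := h.upper_isClosed isClosed_univ (a := a)
    fun ν _ => lt_of_lt_of_le (by exact_mod_cast ha) (hC ν)
  filter_upwards [h', h.tendsto.eventually_ge_atTop 0] with k h1 h2
  exact h1.trans (ENNReal.ofReal_le_ofReal (Real.exp_le_exp.2 (by nlinarith)))

/-- Local exponential bounds imply the large deviation principle for the normalized masses, once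
the infimum of `F` is attained. -/
theorem HasExpBounds.satisfiesLDP (h : HasExpBounds W r F) (hμ : F μ = C)
    (hC : ∀ ν, (C : EReal) ≤ F ν) :
    SatisfiesLDP (fun k A => (W k univ)⁻¹ * W k A) r (fun ν => F ν - (C : EReal)) where
  nonneg ν := by
    have := hC ν
    by_contra! h0
    have h1 := sub_coe_lt_coe_iff (M := 0) (C := C) (a := F ν) |>.1 (by simpa using h0)
    rw [zero_add] at h1
    exact absurd this (not_le.2 h1)
  lsc := by
    intro ν y hy
    obtain ⟨a, hya, haF⟩ := EReal.lt_iff_exists_real_btwn.1 hy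
    filter_upwards [h.lowerSemicontinuous ν _ (coe_lt_sub_coe_iff.1 haF)] with ν' hν'
    exact hya.trans (coe_lt_sub_coe_iff.2 hν')
  upper A hA := by
    refine le_of_forall_gt_imp_ge_of_dense fun y hy => ?_
    obtain ⟨a, hya, haF⟩ := EReal.lt_iff_exists_real_btwn.1 (EReal.neg_lt_comm.1 hy)
    obtain ⟨a', ha', hW⟩ := h.upper_isClosed hA (a := a + C) fun ν hν =>
      coe_lt_sub_coe_iff.1 (haF.trans_le (iInf₂_le ν hν))
    have hZ := h.lower univ isOpen_univ μ (mem_univ _) (a' - a)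
      (by rw [hμ]; exact_mod_cast (by linarith : C < a' - a))
    refine (limsup_le_of_le (a := ((-a : ℝ) : EReal)) (by isBoundedDefault) ?_).trans ?_
    · filter_upwards [hW, hZ, h.tendsto.eventually_gt_atTop 0] with k h1 h2 h3
      exact log_div_le_of_le_exp h3 (inv_mul_le_exp h1 h2 (by ring))
    · rw [EReal.coe_neg]
      exact (EReal.neg_le.1 hya.le)
  lower A hA := by
    refine le_of_forall_lt_imp_le_of_dense fun y hy => ?_
    have hy' : (⨅ ν ∈ A, (F ν - (C : EReal))) < -y := EReal.lt_neg_comm.1 hy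
    simp only [iInf_lt_iff] at hy'
    obtain ⟨ν, hν, hlt⟩ := hy'
    obtain ⟨a, haF, hya⟩ := EReal.lt_iff_exists_real_btwn.1 hlt
    obtain ⟨a₂, ha₂, hya₂⟩ := EReal.lt_iff_exists_real_btwn.1 hya
    have ha₂' : a < a₂ := by exact_mod_cast ha₂
    have hW := h.lower A hA ν hν (a + C) (sub_coe_lt_coe_iff.1 haF)
    have hZ := h.upper_univ hC (by linarith : C - (a₂ - a) < C)
    refine le_trans ?_ (le_liminf_of_le (a := ((-a₂ : ℝ) : EReal)) (by isBoundedDefault) ?_)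
    · rw [EReal.coe_neg]
      exact (EReal.le_neg_of_le_neg hya₂.le)
    · filter_upwards [hW, hZ, h.tendsto.eventually_gt_atTop 0] with k h1 h2 h3
      exact le_log_div_of_exp_le h3 (exp_le_inv_mul h1 h2 (by ring))

/-- Away from the unique minimizer of `F`, the normalized masses are exponentially small. -/
theorem HasExpBounds.tendsto_zero (h : HasExpBounds W r F) (hμ : F μ = C)
    (hC : ∀ ν, ν ≠ μ → (C : EReal) < F ν) {A : Set M} (hA : IsClosed A) (hμA : μ ∉ A) :
    Tendsto (fun k => (W k univ)⁻¹ * W k A) atTop (𝓝 0) := by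
  obtain ⟨a', ha', hW⟩ := h.upper_isClosed hA (a := C) fun ν hν =>
    hC ν fun he => hμA (he ▸ hν)
  have hZ := h.lower univ isOpen_univ μ (mem_univ _) ((C + a') / 2)
    (by rw [hμ]; exact_mod_cast (by linarith : C < (C + a') / 2))
  have hlim : Tendsto (fun k => ENNReal.ofReal (Real.exp (-r k * ((a' - C) / 2)))) atTop (𝓝 0) := by
    rw [← ENNReal.ofReal_zero]
    refine ENNReal.tendsto_ofReal (Real.tendsto_exp_atBot.comp ?_)
    exact (tendsto_neg_atTop_atBot.comp h.tendsto).atBot_mul_const (by linarith)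
  refine tendsto_of_tendsto_of_tendsto_of_le_of_le' tendsto_const_nhds hlim
    (Eventually.of_forall fun _ => zero_le) ?_
  filter_upwards [hW, hZ] with k h1 h2
  exact inv_mul_le_exp h1 h2 (by ring)

end LargeDeviations

variable {n : ℕ}

/-! ### Support functions and potentials -/

section Potentials

variable (P : ConvexBody (Rn n))

lemma exists_norm_le_of_mem : ∃ R > 0, ∀ p ∈ P, ‖p‖ ≤ R := by
  obtain ⟨R, hR⟩ := P.isCompact.isBounded.exists_norm_le
  exact ⟨max R 1, by positivity, fun p hp => (hR p hp).trans (le_max_left _ _)⟩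

lemma isCompact_inner_image (x : Rn n) : IsCompact ((fun p => ⟪x, p⟫) '' (P : Set (Rn n))) :=
  P.isCompact.image (by fun_prop)

variable {P}

lemma inner_le_supportFun {p : Rn n} (hp : p ∈ P) (x : Rn n) : ⟪x, p⟫ ≤ supportFun P x :=
  le_csSup (isCompact_inner_image P x).bddAbove ⟨p, hp, rfl⟩

lemma supportFun_le {x : Rn n} {a : ℝ} (h : ∀ p ∈ P, ⟪x, p⟫ ≤ a) : supportFun P x ≤ a := by
  refine csSup_le (P.nonempty.image _) ?_
  rintro _ ⟨p, hp, rfl⟩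
  exact h p hp

lemma supportFun_zero : supportFun P 0 = 0 := by
  refine le_antisymm (supportFun_le fun p _ => by simp) ?_
  obtain ⟨p, hp⟩ := P.nonempty
  simpa using inner_le_supportFun hp (0 : Rn n)

lemma supportFun_add_le (x y : Rn n) :
    supportFun P (x + y) ≤ supportFun P x + supportFun P y := by
  refine supportFun_le fun p hp => ?_
  rw [inner_add_left]
  exact add_le_add (inner_le_supportFun hp x) (inner_le_supportFun hp y)

lemma supportFun_le_norm {R : ℝ} (hR : ∀ p ∈ P, ‖p‖ ≤ R) (x : Rn n) :
    supportFun P x ≤ R * ‖x‖ :=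
  supportFun_le fun p hp => by
    have := real_inner_le_norm x p
    nlinarith [hR p hp, norm_nonneg x]

/-- The slopes of a function of this kind are bounded by those of the support function. -/
lemma abs_sub_le_of_sub_le_supportFun {φ : Rn n → ℝ} {R : ℝ} (hR : ∀ p ∈ P, ‖p‖ ≤ R)
    (h : ∀ x y, φ y - φ x ≤ supportFun P (y - x)) (x y : Rn n) :
    |φ x - φ y| ≤ R * ‖x - y‖ := by
  rw [abs_le]
  have h1 := (h x y).trans (supportFun_le_norm hR _)
  have h2 := (h y x).trans (supportFun_le_norm hR _)
  rw [norm_sub_rev] at h1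
  constructor <;> linarith

lemma continuous_of_sub_le_supportFun {φ : Rn n → ℝ}
    (h : ∀ x y, φ y - φ x ≤ supportFun P (y - x)) : Continuous φ := by
  obtain ⟨R, -, hR⟩ := exists_norm_le_of_mem P
  exact (LipschitzWith.of_dist_le' (K := R) fun x y => by
    rw [Real.dist_eq, dist_eq_norm]
    exact abs_sub_le_of_sub_le_supportFun hR h x y).continuous

lemma supportFun_sub_le (x y : Rn n) :
    supportFun P y - supportFun P x ≤ supportFun P (y - x) := by
  have := supportFun_add_le (P := P) (y - x) x
  rw [sub_add_cancel] at this
  linarith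

lemma continuous_supportFun : Continuous (supportFun P) :=
  continuous_of_sub_le_supportFun supportFun_sub_le

/-- A real convex function on `ℝⁿ` has a subgradient at every point: a supporting hyperplane of
its strict epigraph. -/
lemma exists_mem_subgrad {φ : Rn n → ℝ} (hφ : ConvexOn ℝ univ φ) (x : Rn n) :
    ∃ p, p ∈ subgrad φ x := by
  have hcont : Continuous φ := by
    rw [← continuousOn_univ]; exact hφ.continuousOn isOpen_univ
  have hconv : Convex ℝ {q : Rn n × ℝ | q.1 ∈ univ ∧ φ q.1 < q.2} := hφ.convex_strict_epigraph
  have hopen : IsOpen {q : Rn n × ℝ | q.1 ∈ univ ∧ φ q.1 < q.2} := by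
    simp only [mem_univ, true_and]
    exact isOpen_lt (hcont.comp continuous_fst) continuous_snd
  obtain ⟨f, hf⟩ := geometric_hahn_banach_open_point hconv hopen (x := (x, φ x)) (by simp)
  have hdec : ∀ y t, f (y, t) = f (y, 0) + t * f (0, 1) := by
    intro y t
    rw [← smul_eq_mul, ← map_smul, ← map_add]; simp
  set c := f (0, 1) with hc
  have hc0 : c < 0 := by
    have := hf (x, φ x + 1) (by simp)
    rw [hdec, hdec x (φ x)] at this
    linarith
  obtain ⟨v, hv⟩ : ∃ v : Rn n, ∀ y, f (y, 0) = ⟪v, y⟫ := by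
    refine ⟨(InnerProductSpace.toDual ℝ (Rn n)).symm (f.comp (ContinuousLinearMap.inl ℝ _ _)),
      fun y => ?_⟩
    rw [InnerProductSpace.toDual_symm_apply]; simp
  refine ⟨(-c)⁻¹ • v, fun y => ?_⟩
  rw [real_inner_smul_left, inner_sub_right, ← hv, ← hv]
  refine le_of_forall_pos_lt_add fun ε hε => ?_
  have h1 := hf (y, φ y + ε) (by simp [hε])
  rw [hdec, hdec x (φ x)] at h1
  have h2 : (-c)⁻¹ * (f (y, 0) - f (x, 0)) < φ y + ε - φ x := by
    rw [inv_mul_lt_iff₀ (by linarith)]; nlinarith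
  linarith

lemma IsPotential.exists_mem_subgrad {φ : Rn n → ℝ} (hφ : IsPotential P φ) (x : Rn n) :
    ∃ p ∈ P, p ∈ subgrad φ x := by
  obtain ⟨p, hp⟩ := PermanentalLDP.exists_mem_subgrad hφ.1 x
  exact ⟨p, hφ.2 x hp, hp⟩

lemma IsPotential.sub_le {φ : Rn n → ℝ} (hφ : IsPotential P φ) (x y : Rn n) :
    φ y - φ x ≤ supportFun P (y - x) := by
  obtain ⟨p, hpP, hp⟩ := hφ.exists_mem_subgrad y
  have h1 := hp x
  have h2 := inner_le_supportFun hpP (y - x)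
  rw [← neg_sub, inner_neg_right, real_inner_comm] at h1
  linarith

lemma IsPotential.continuous {φ : Rn n → ℝ} (hφ : IsPotential P φ) : Continuous φ :=
  continuous_of_sub_le_supportFun hφ.sub_le

/-- Points outside a convex body are separated from it, so the support function determines the
body. -/
lemma isPotential_of_sub_le {φ : Rn n → ℝ} (hφ : ConvexOn ℝ univ φ)
    (h : ∀ x y, φ y - φ x ≤ supportFun P (y - x)) : IsPotential P φ := by
  refine ⟨hφ, fun x p hp => ?_⟩
  by_contra hpP
  obtain ⟨f, u, hfu, huf⟩ := geometric_hahn_banach_closed_point P.convex P.isCompact.isClosed hpP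
  set v := (InnerProductSpace.toDual ℝ (Rn n)).symm f with hv
  have hf : ∀ q, f q = ⟪v, q⟫ := fun q => by
    rw [hv, InnerProductSpace.toDual_symm_apply]
  have h1 := hp (x + v)
  have h2 := h x (x + v)
  have h3 : supportFun P v ≤ u := supportFun_le fun q hq => by
    rw [← hf]; exact (hfu q hq).le
  rw [add_sub_cancel_left] at h1 h2
  rw [hf, real_inner_comm] at huf
  linarith

lemma IsPotential.add_const {φ : Rn n → ℝ} (hφ : IsPotential P φ) (c : ℝ) :
    IsPotential P (fun x => φ x + c) :=
  isPotential_of_sub_le (hφ.1.add_const c) fun x y => by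
    have := hφ.sub_le x y
    linarith

/-- A finite supremum of affine functions with slopes in `P` is a potential. -/
lemma isPotential_sSup {S : Set (Rn n)} (hS : S ⊆ P) (hne : S.Nonempty) {k : Rn n → ℝ}
    (hb : ∀ x, BddAbove ((fun p => ⟪x, p⟫ - k p) '' S)) :
    IsPotential P (fun x => sSup ((fun p => ⟪x, p⟫ - k p) '' S)) := by
  have hle : ∀ x, ∀ p ∈ S, ⟪x, p⟫ - k p ≤ sSup ((fun p => ⟪x, p⟫ - k p) '' S) :=
    fun x p hp => le_csSup (hb x) ⟨p, hp, rfl⟩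
  refine isPotential_of_sub_le ⟨convex_univ, ?_⟩ ?_
  · intro x _ y _ a b ha hb' hab
    refine csSup_le (hne.image _) ?_
    rintro _ ⟨p, hp, rfl⟩
    have h1 := mul_le_mul_of_nonneg_left (hle x p hp) ha
    have h2 := mul_le_mul_of_nonneg_left (hle y p hp) hb'
    simp only [smul_eq_mul, inner_add_left, real_inner_smul_left]
    have h3 : k p = a * k p + b * k p := by rw [← add_mul, hab, one_mul]
    linarith
  · intro x y
    rw [sub_le_iff_le_add]
    refine csSup_le (hne.image _) ?_
    rintro _ ⟨p, hp, rfl⟩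
    have h1 := hle x p hp
    have h2 := inner_le_supportFun (hS hp) (y - x)
    rw [inner_sub_left] at h2
    linarith

end Potentials

/-! ### Legendre transforms -/

section Legendre

/-- The domain of the Legendre transform of `f`. -/
def conjDomain (f : Rn n → ℝ) : Set (Rn n) := {p | BddAbove (range fun x => ⟪x, p⟫ - f x)}

/-- The Legendre transform `f*(p) = sup_x (⟨x, p⟩ - f x)`, with value `0` outside of its domain.
It is defined through the extended reals to make its measurability evident. -/
noncomputable def conj (f : Rn n → ℝ) (p : Rn n) : ℝ :=
  (⨆ x, ((⟪x, p⟫ - f x : ℝ) : EReal)).toReal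

/-- The gradient of the Legendre transform. -/
noncomputable def conjGrad (f : Rn n → ℝ) (p : Rn n) : Rn n := gradient (conj f) p

variable {f : Rn n → ℝ} {p : Rn n}

lemma coe_conj (hp : p ∈ conjDomain f) :
    ((conj f p : ℝ) : EReal) = ⨆ x, ((⟪x, p⟫ - f x : ℝ) : EReal) := by
  refine EReal.coe_toReal ?_ ?_
  · obtain ⟨a, ha⟩ := hp
    refine ne_top_of_le_ne_top (EReal.coe_ne_top a) (iSup_le fun x => ?_)
    exact_mod_cast ha ⟨x, rfl⟩
  · exact ne_bot_of_le_ne_bot (EReal.coe_ne_bot _)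
      (le_iSup (fun x => ((⟪x, p⟫ - f x : ℝ) : EReal)) 0)

lemma le_conj (hp : p ∈ conjDomain f) (x : Rn n) : ⟪x, p⟫ - f x ≤ conj f p := by
  rw [← EReal.coe_le_coe_iff, coe_conj hp]
  exact le_iSup (fun x => ((⟪x, p⟫ - f x : ℝ) : EReal)) x

lemma mem_conjDomain {a : ℝ} (h : ∀ x, ⟪x, p⟫ - f x ≤ a) : p ∈ conjDomain f := by
  refine ⟨a, ?_⟩
  rintro _ ⟨x, rfl⟩
  exact h x

lemma conj_le {a : ℝ} (h : ∀ x, ⟪x, p⟫ - f x ≤ a) : conj f p ≤ a := by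
  rw [← EReal.coe_le_coe_iff, coe_conj (mem_conjDomain h)]
  exact iSup_le fun x => by exact_mod_cast h x

lemma measurable_conj (f : Rn n → ℝ) : Measurable (conj f) := by
  refine Measurable.ereal_toReal ?_
  refine (lowerSemicontinuous_iSup fun x => ?_).measurable
  refine Continuous.lowerSemicontinuous ?_
  exact continuous_coe_real_ereal.comp (by fun_prop)

lemma measurable_conjGrad (f : Rn n → ℝ) : Measurable (conjGrad f) :=
  (InnerProductSpace.toDual ℝ (Rn n)).symm.continuous.measurable.comp
    (measurable_fderiv ℝ (conj f))

lemma convexOn_conj (f : Rn n → ℝ) : ConvexOn ℝ (conjDomain f) (conj f) := by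
  have key : ∀ p ∈ conjDomain f, ∀ q ∈ conjDomain f, ∀ a b : ℝ, 0 ≤ a → 0 ≤ b → a + b = 1 →
      ∀ x, ⟪x, a • p + b • q⟫ - f x ≤ a * conj f p + b * conj f q := by
    intro p hp q hq a b ha hb hab x
    have h1 := mul_le_mul_of_nonneg_left (le_conj hp x) ha
    have h2 := mul_le_mul_of_nonneg_left (le_conj hq x) hb
    rw [inner_add_right, real_inner_smul_right, real_inner_smul_right]
    have h3 : f x = a * f x + b * f x := by rw [← add_mul, hab, one_mul]
    linarith
  exact ⟨fun p hp q hq a b ha hb hab => mem_conjDomain (key p hp q hq a b ha hb hab),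
    fun p hp q hq a b ha hb hab => conj_le (key p hp q hq a b ha hb hab)⟩

lemma mem_subgrad_iff {x : Rn n} : p ∈ subgrad f x ↔ ∀ y, ⟪y, p⟫ - f y ≤ ⟪x, p⟫ - f x := by
  refine forall_congr' fun y => ?_
  rw [inner_sub_right, real_inner_comm y, real_inner_comm x]
  constructor <;> intro h <;> linarith

lemma conj_eq_of_mem_subgrad {x : Rn n} (h : p ∈ subgrad f x) : conj f p = ⟪x, p⟫ - f x :=
  le_antisymm (conj_le (mem_subgrad_iff.1 h)) (le_conj (mem_conjDomain (mem_subgrad_iff.1 h)) x)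

/-- In the interior of the domain of `f*`, the function `f - ⟨·, p⟩` grows linearly. -/
lemma exists_linear_growth (hp : p ∈ interior (conjDomain f)) :
    ∃ r > 0, ∃ H, ∀ x, r * ‖x‖ - H ≤ f x - ⟪x, p⟫ := by
  have hcont := (convexOn_conj f).continuousOn_interior
  obtain ⟨r, hr, hball⟩ := Metric.isOpen_iff.1 isOpen_interior p hp
  have hsub : Metric.closedBall p (r / 2) ⊆ interior (conjDomain f) :=
    (Metric.closedBall_subset_ball (by linarith)).trans hball
  obtain ⟨H, hH⟩ := (isCompact_closedBall p (r / 2)).bddAbove_image (hcont.mono hsub)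
  refine ⟨r / 2, by linarith, H, fun x => ?_⟩
  set q := p + (r / 2 * ‖x‖⁻¹) • x with hq
  have hqb : q ∈ Metric.closedBall p (r / 2) := by
    rw [mem_closedBall_iff_norm, hq, add_sub_cancel_left, norm_smul, Real.norm_eq_abs, abs_mul,
      abs_of_pos (by linarith : (0 : ℝ) < r / 2), abs_of_nonneg (by positivity)]
    rcases eq_or_ne x 0 with rfl | hx
    · simp; linarith
    · rw [mul_assoc, inv_mul_cancel₀ (norm_ne_zero_iff.2 hx), mul_one]
  have h1 := (le_conj (interior_subset (hsub hqb)) x).trans (hH ⟨q, hqb, rfl⟩)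
  have h2 : ⟪x, q⟫ = ⟪x, p⟫ + r / 2 * ‖x‖ := by
    rw [hq, inner_add_right, real_inner_smul_right, real_inner_self_eq_norm_sq]
    rcases eq_or_ne x 0 with rfl | hx
    · simp
    · field_simp
  linarith

lemma tendsto_sub_inner_cocompact (hp : p ∈ interior (conjDomain f)) :
    Tendsto (fun x => f x - ⟪x, p⟫) (cocompact (Rn n)) atTop := by
  obtain ⟨r, hr, H, h⟩ := exists_linear_growth hp
  refine tendsto_atTop_mono h ?_
  exact tendsto_atTop_add_const_right _ _ ((tendsto_norm_cocompact_atTop).const_mul_atTop hr)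

lemma exists_mem_subgrad_of_mem_interior (hf : Continuous f)
    (hp : p ∈ interior (conjDomain f)) : ∃ x, p ∈ subgrad f x := by
  have hc : Continuous fun x => f x - ⟪x, p⟫ := by fun_prop
  obtain ⟨x, hx⟩ := hc.exists_forall_le (tendsto_sub_inner_cocompact hp)
  exact ⟨x, mem_subgrad_iff.2 fun y => by linarith [hx y]⟩

lemma eq_conjGrad_of_mem_subgrad {x : Rn n} (hp : p ∈ interior (conjDomain f))
    (hd : DifferentiableAt ℝ (conj f) p) (hx : p ∈ subgrad f x) : x = conjGrad f p := by
  have hmin : IsLocalMin (fun q => conj f q - ⟪x, q⟫) p := by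
    filter_upwards [isOpen_interior.mem_nhds hp] with q hq
    have h1 := le_conj (interior_subset hq) x
    have h2 := conj_eq_of_mem_subgrad hx
    linarith
  have h1 : HasGradientAt (conj f) (conjGrad f p) p := hd.hasGradientAt
  have h2 : HasFDerivAt (fun q => conj f q - ⟪x, q⟫)
      (InnerProductSpace.toDual ℝ (Rn n) (conjGrad f p) - innerSL ℝ x) p :=
    h1.hasFDerivAt.sub (innerSL ℝ x).hasFDerivAt
  have h3 := hmin.hasFDerivAt_eq_zero h2
  have h4 : ∀ v, ⟪conjGrad f p, v⟫ = ⟪x, v⟫ := fun v => by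
    have := DFunLike.congr_fun h3 v
    simpa [sub_eq_zero] using this
  exact (ext_inner_right ℝ h4).symm

/-- Rademacher's theorem for the Legendre transform. -/
lemma ae_differentiableAt_conj (f : Rn n → ℝ) :
    ∀ᵐ p, p ∈ interior (conjDomain f) → DifferentiableAt ℝ (conj f) p := by
  have hlip := (convexOn_conj f).locallyLipschitzOn_interior
  have hloc : ∀ p : interior (conjDomain f), ∃ r > 0, Metric.ball (p : Rn n) r ⊆
      interior (conjDomain f) ∧ ∃ K, LipschitzOnWith K (conj f) (Metric.ball (p : Rn n) r) := by
    rintro ⟨p, hp⟩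
    obtain ⟨K, t, ht, hK⟩ := hlip hp
    rw [isOpen_interior.nhdsWithin_eq hp] at ht
    obtain ⟨r, hr, hrt⟩ := Metric.mem_nhds_iff.1 (inter_mem ht (isOpen_interior.mem_nhds hp))
    exact ⟨r, hr, fun q hq => (hrt hq).2, K, hK.mono fun q hq => (hrt hq).1⟩
  choose r hr hsub K hK using hloc
  obtain ⟨T, hT, hcov⟩ := TopologicalSpace.isOpen_iUnion_countable
    (fun p : interior (conjDomain f) => Metric.ball (p : Rn n) (r p)) fun p => Metric.isOpen_ball
  have hae : ∀ᵐ q, ∀ p ∈ T, q ∈ Metric.ball (p : Rn n) (r p) →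
      DifferentiableWithinAt ℝ (conj f) (Metric.ball (p : Rn n) (r p)) q :=
    (ae_ball_iff hT).2 fun p _ => (hK p).ae_differentiableWithinAt_of_mem
  filter_upwards [hae] with q hq hqD
  have : q ∈ ⋃ p ∈ T, Metric.ball (p : Rn n) (r p) := by
    rw [hcov]
    exact mem_iUnion.2 ⟨⟨q, hqD⟩, Metric.mem_ball_self (hr _)⟩
  obtain ⟨p, hpT, hqp⟩ := mem_iUnion₂.1 this
  exact (hq p hpT hqp).differentiableAt (Metric.isOpen_ball.mem_nhds hqp)

/-- A convex set that contains almost every point of an open set contains all of it: every point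
is the midpoint of two points of the convex set. -/
lemma subset_of_ae_mem_of_convex {D O : Set (Rn n)} (hD : Convex ℝ D) (hO : IsOpen O)
    (h : ∀ᵐ p, p ∈ O → p ∈ D) : O ⊆ D := by
  intro p hp
  obtain ⟨r, hr, hball⟩ := Metric.isOpen_iff.1 hO p hp
  have hrefl : ∀ᵐ q : Rn n, (p + p - q ∈ O → p + p - q ∈ D) :=
    (Measure.measurePreserving_sub_left volume (p + p)).quasiMeasurePreserving.ae h
  have hpos : volume (Metric.ball p r) ≠ 0 := (Metric.measure_ball_pos volume p hr).ne'
  obtain ⟨q, hqb, hq1, hq2⟩ : ∃ q ∈ Metric.ball p r, (q ∈ O → q ∈ D) ∧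
      (p + p - q ∈ O → p + p - q ∈ D) := by
    by_contra! hcon
    refine hpos (measure_mono_null (fun q hq => ?_) (ae_iff.1 (h.and hrefl)))
    simp only [mem_ofPred_eq, not_and]
    intro h1 h2
    obtain ⟨h3, h4⟩ := hcon q hq h1
    exact h4 (h2 h3)
  have hq' : p + p - q ∈ Metric.ball p r := by
    rw [mem_ball_iff_norm] at hqb ⊢
    rwa [show p + p - q - p = -(q - p) by abel, norm_neg]
  have hm := hD (hq1 (hball hqb)) (hq2 (hball hq')) (by norm_num : (0 : ℝ) ≤ 1 / 2)
    (by norm_num : (0 : ℝ) ≤ 1 / 2) (by norm_num)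
  convert hm using 1
  rw [← smul_add, add_sub_cancel, ← two_smul ℝ p, smul_smul]
  norm_num

variable {P : ConvexBody (Rn n)}

lemma interior_subset_interior_conjDomain
    (hD : ∀ᵐ p ∂volume.restrict (P : Set (Rn n)), p ∈ conjDomain f) :
    interior (P : Set (Rn n)) ⊆ interior (conjDomain f) := by
  refine interior_maximal (subset_of_ae_mem_of_convex (convexOn_conj f).1 isOpen_interior ?_)
    isOpen_interior
  filter_upwards [(ae_restrict_iff' P.isCompact.measurableSet).1 hD] with p hp hpi
  exact hp (interior_subset hpi)

lemma ae_mem_interior (P : ConvexBody (Rn n)) :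
    ∀ᵐ p ∂volume.restrict (P : Set (Rn n)), p ∈ interior (P : Set (Rn n)) := by
  rw [ae_restrict_iff' P.isCompact.measurableSet, ae_iff]
  refine measure_mono_null (fun p hp => ?_) (P.convex.addHaar_frontier volume)
  simp only [mem_ofPred_eq, not_forall] at hp
  obtain ⟨h1, h2⟩ := hp
  exact ⟨subset_closure h1, h2⟩

/-- Almost every `p ∈ P` is a subgradient of `f` at exactly one point, the gradient of `f*`. -/
theorem ae_mem_subgrad_iff (hf : Continuous f)
    (hD : ∀ᵐ p ∂volume.restrict (P : Set (Rn n)), p ∈ conjDomain f) :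
    ∀ᵐ p ∂volume.restrict (P : Set (Rn n)), ∀ x, p ∈ subgrad f x ↔ x = conjGrad f p := by
  filter_upwards [ae_mem_interior P, ae_restrict_of_ae (ae_differentiableAt_conj f)] with p hp hd
  have hp' := interior_subset_interior_conjDomain hD hp
  intro x
  refine ⟨eq_conjGrad_of_mem_subgrad hp' (hd hp'), ?_⟩
  rintro rfl
  obtain ⟨y, hy⟩ := exists_mem_subgrad_of_mem_interior hf hp'
  rwa [← eq_conjGrad_of_mem_subgrad hp' (hd hp') hy]

/-- The Monge–Ampère measure is the image of Lebesgue measure on `P` under the gradient of the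
Legendre transform. -/
theorem isMongeAmpere_map_conjGrad (hf : Continuous f) (hP : ∀ x, subgrad f x ⊆ P)
    (hD : ∀ᵐ p ∂volume.restrict (P : Set (Rn n)), p ∈ conjDomain f) :
    IsMongeAmpere f ((volume.restrict (P : Set (Rn n))).map (conjGrad f)) := by
  intro A hA
  have hsub : subgradImage f A ⊆ P := iUnion₂_subset fun x _ => hP x
  rw [Measure.map_apply (measurable_conjGrad f) hA]
  conv_rhs => rw [← inter_eq_left.2 hsub, ← Measure.restrict_apply' P.isCompact.measurableSet]
  refine measure_congr ?_
  filter_upwards [ae_mem_subgrad_iff hf hD] with p hp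
  refine propext ?_
  change conjGrad f p ∈ A ↔ p ∈ subgradImage f A
  simp only [subgradImage, mem_iUnion, exists_prop]
  constructor
  · intro h
    exact ⟨_, h, (hp _).2 rfl⟩
  · rintro ⟨x, hx, hpx⟩
    rwa [← (hp x).1 hpx]

end Legendre

/-! ### Extended integrals, couplings and relative entropy -/

section ExtendedIntegral

variable {α : Type*} [MeasurableSpace α] {μ : Measure α} {f : α → ℝ}

lemma eintegral_eq_integral (hf : Integrable f μ) :
    eintegral μ f = ((∫ a, f a ∂μ : ℝ) : EReal) := by
  rw [eintegral, integral_eq_lintegral_pos_part_sub_lintegral_neg_part hf, EReal.coe_sub,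
    EReal.coe_ennreal_toReal, EReal.coe_ennreal_toReal]
  · exact hf.neg.lintegral_lt_top.ne
  · exact hf.lintegral_lt_top.ne

lemma integrable_of_eintegral_ne_top (hf : AEStronglyMeasurable f μ)
    (hneg : ∫⁻ a, ENNReal.ofReal (-f a) ∂μ ≠ ∞) (h : eintegral μ f ≠ ⊤) : Integrable f μ := by
  have hpos : ∫⁻ a, ENNReal.ofReal (f a) ∂μ ≠ ∞ := by
    intro htop
    apply h
    rw [eintegral, htop]
    lift ∫⁻ a, ENNReal.ofReal (-f a) ∂μ to NNReal using hneg with b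
    rfl
  refine ⟨hf, ?_⟩
  have habs : ∀ a, ‖f a‖ₑ ≤ ENNReal.ofReal (f a) + ENNReal.ofReal (-f a) := by
    intro a
    rw [Real.enorm_eq_ofReal_abs]
    rcases le_total 0 (f a) with h0 | h0
    · rw [abs_of_nonneg h0]; exact le_self_add
    · rw [abs_of_nonpos h0]; exact le_add_self
  refine (lintegral_mono habs).trans_lt ?_
  rw [lintegral_add_left' hf.aemeasurable.ennreal_ofReal]
  exact ENNReal.add_lt_top.2 ⟨hpos.lt_top, hneg.lt_top⟩

lemma lintegral_ofReal_neg_ne_top_of_le [IsFiniteMeasure μ] {m : ℝ} (h : ∀ᵐ a ∂μ, m ≤ f a) :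
    ∫⁻ a, ENNReal.ofReal (-f a) ∂μ ≠ ∞ := by
  refine ((lintegral_mono_ae ?_).trans_lt (?_ : ∫⁻ _, ENNReal.ofReal (-m) ∂μ < ∞)).ne
  · filter_upwards [h] with a ha
    exact ENNReal.ofReal_le_ofReal (by linarith)
  · rw [lintegral_const]
    exact ENNReal.mul_lt_top ENNReal.ofReal_lt_top (measure_lt_top _ _)

end ExtendedIntegral

/-- A weighted measure whose potential is continuous on the whole space and grows faster than the
support function in all directions. -/
structure IsCoerciveWeight (P : ConvexBody (Rn n)) (μ₀ : Measure (Rn n)) (φ₀ : Rn n → ℝ) :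
    Prop where
  continuous : Continuous φ₀
  coercive : Tendsto (fun x => φ₀ x - supportFun P x) (cocompact (Rn n)) atTop
  finite_mass : ∀ t : ℝ, 0 < t →
    ∫⁻ x, ENNReal.ofReal (Real.exp (t * (supportFun P x - φ₀ x))) ∂μ₀ < ∞

variable {P : ConvexBody (Rn n)} {μ₀ : Measure (Rn n)} {φ₀ : Rn n → ℝ}

namespace IsCoerciveWeight

lemma continuous_sub (hw : IsCoerciveWeight P μ₀ φ₀) :
    Continuous fun x => φ₀ x - supportFun P x :=
  hw.continuous.sub continuous_supportFun

lemma exists_le (hw : IsCoerciveWeight P μ₀ φ₀) : ∃ m, ∀ x, m ≤ φ₀ x - supportFun P x := by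
  obtain ⟨x, hx⟩ := hw.continuous_sub.exists_forall_le hw.coercive
  exact ⟨_, hx⟩

lemma integrable_exp (hw : IsCoerciveWeight P μ₀ φ₀) {t : ℝ} (ht : 0 < t) :
    Integrable (fun x => Real.exp (t * (supportFun P x - φ₀ x))) μ₀ := by
  have hm : Measurable fun x => Real.exp (t * (supportFun P x - φ₀ x)) :=
    Real.continuous_exp.measurable.comp
      ((continuous_supportFun.sub hw.continuous).const_mul t).measurable
  refine ⟨hm.aestronglyMeasurable, ?_⟩
  rw [hasFiniteIntegral_iff_ofReal (Eventually.of_forall fun x => (Real.exp_pos _).le)]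
  exact hw.finite_mass t ht

lemma isFiniteMeasureOnCompacts (hw : IsCoerciveWeight P μ₀ φ₀) :
    IsFiniteMeasureOnCompacts μ₀ := by
  refine ⟨fun K hK => ?_⟩
  have hc : Continuous fun x => Real.exp (1 * (supportFun P x - φ₀ x)) :=
    Real.continuous_exp.comp ((continuous_supportFun.sub hw.continuous).const_mul 1)
  rcases K.eq_empty_or_nonempty with rfl | hne
  · simp
  obtain ⟨x₀, -, hx₀⟩ := hK.exists_isMinOn hne hc.continuousOn
  have h1 : ENNReal.ofReal (Real.exp (1 * (supportFun P x₀ - φ₀ x₀))) * μ₀ K ≤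
      ∫⁻ x, ENNReal.ofReal (Real.exp (1 * (supportFun P x - φ₀ x))) ∂μ₀ := by
    rw [← setLIntegral_const]
    refine (setLIntegral_mono hc.measurable.ennreal_ofReal fun x hx => ?_).trans
      (setLIntegral_le_lintegral _ _)
    exact ENNReal.ofReal_le_ofReal (hx₀ hx)
  by_contra! htop
  rw [top_le_iff.1 htop, ENNReal.mul_top (by simpa using Real.exp_pos _)] at h1
  exact absurd (hw.finite_mass 1 one_pos) (not_lt.2 h1)

lemma sigmaFinite (hw : IsCoerciveWeight P μ₀ φ₀) : SigmaFinite μ₀ := by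
  have := hw.isFiniteMeasureOnCompacts
  infer_instance

end IsCoerciveWeight

/-! ### Optimal transport to the uniform measure on `P` -/

section Transport

/-- The uniform measure `λ_P` on the convex body. -/
noncomputable abbrev unif (P : ConvexBody (Rn n)) : Measure (Rn n) :=
  volume.restrict (P : Set (Rn n))

/-- The cost function `c(x, p) = -⟨x, p⟩ + φ₀(x)`. -/
noncomputable abbrev cost (φ₀ : Rn n → ℝ) (z : Rn n × Rn n) : ℝ := -⟪z.1, z.2⟫ + φ₀ z.1

/-- `G` is a coupling of `ν` and `λ_P`. -/
def IsCoupling (P : ConvexBody (Rn n)) (ν : Measure (Rn n)) (G : Measure (Rn n × Rn n)) : Prop :=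
  G.map Prod.fst = ν ∧ G.map Prod.snd = unif P

lemma isProbabilityMeasure_unif (hP : volume (P : Set (Rn n)) = 1) :
    IsProbabilityMeasure (unif P) := ⟨by rw [Measure.restrict_apply_univ, hP]⟩

lemma ae_unif_mem (P : ConvexBody (Rn n)) : ∀ᵐ p ∂unif P, p ∈ P :=
  ae_restrict_mem P.isCompact.measurableSet

lemma continuous_cost (h : Continuous φ₀) : Continuous (cost φ₀) := by
  unfold cost; fun_prop

variable {ν : Measure (Rn n)} {G : Measure (Rn n × Rn n)}

lemma IsCoupling.isProbabilityMeasure [IsProbabilityMeasure ν] (hG : IsCoupling P ν G) :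
    IsProbabilityMeasure G := by
  refine ⟨?_⟩
  have h : (G.map Prod.fst) univ = 1 := by rw [hG.1]; exact measure_univ
  rwa [Measure.map_apply measurable_fst MeasurableSet.univ, preimage_univ] at h

lemma IsCoupling.ae_snd (hG : IsCoupling P ν G) {p : Rn n → Prop} (h : ∀ᵐ q ∂unif P, p q) :
    ∀ᵐ z ∂G, p z.2 :=
  ae_of_ae_map measurable_snd.aemeasurable (by rw [hG.2]; exact h)

lemma IsCoupling.ae_fst (hG : IsCoupling P ν G) {p : Rn n → Prop} (h : ∀ᵐ q ∂ν, p q) :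
    ∀ᵐ z ∂G, p z.1 :=
  ae_of_ae_map measurable_fst.aemeasurable (by rw [hG.1]; exact h)

lemma sub_supportFun_le_cost {z : Rn n × Rn n} (hz : z.2 ∈ P) :
    φ₀ z.1 - supportFun P z.1 ≤ cost φ₀ z := by
  have := inner_le_supportFun hz z.1
  simp only [cost]; linarith

lemma IsCoupling.integrable_cost [IsProbabilityMeasure ν] (hw : IsCoerciveWeight P μ₀ φ₀)
    (hG : IsCoupling P ν G) (h : eintegral G (cost φ₀) ≠ ⊤) : Integrable (cost φ₀) G := by
  have := hG.isProbabilityMeasure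
  obtain ⟨m, hm⟩ := hw.exists_le
  refine integrable_of_eintegral_ne_top (continuous_cost hw.continuous).aestronglyMeasurable
    (lintegral_ofReal_neg_ne_top_of_le (m := m) ?_) h
  filter_upwards [hG.ae_snd (ae_unif_mem P)] with z hz
  exact (hm z.1).trans (sub_supportFun_le_cost hz)

lemma exists_coupling_of_transportCost_lt [IsProbabilityMeasure ν]
    (hw : IsCoerciveWeight P μ₀ φ₀) {a : EReal} (h : transportCost P φ₀ ν < a) :
    ∃ G, IsCoupling P ν G ∧ Integrable (cost φ₀) G ∧ ((∫ z, cost φ₀ z ∂G : ℝ) : EReal) < a := by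
  simp only [transportCost, iInf_lt_iff] at h
  obtain ⟨G, hG, hlt⟩ := h
  have hi := IsCoupling.integrable_cost hw hG (ne_top_of_lt hlt)
  exact ⟨G, hG, hi, by rwa [← eintegral_eq_integral hi]⟩

lemma IsCoupling.transportCost_le (hG : IsCoupling P ν G) (hi : Integrable (cost φ₀) G) :
    transportCost P φ₀ ν ≤ ((∫ z, cost φ₀ z ∂G : ℝ) : EReal) := by
  rw [← eintegral_eq_integral hi]
  exact iInf₂_le G hG

lemma le_transportCost [IsProbabilityMeasure ν] (hw : IsCoerciveWeight P μ₀ φ₀) {a : ℝ}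
    (h : ∀ G, IsCoupling P ν G → Integrable (cost φ₀) G → a ≤ ∫ z, cost φ₀ z ∂G) :
    (a : EReal) ≤ transportCost P φ₀ ν := by
  by_contra! hlt
  obtain ⟨G, hG, hi, hlt'⟩ := exists_coupling_of_transportCost_lt hw hlt
  exact absurd (h G hG hi) (not_le.2 (by exact_mod_cast hlt'))

lemma le_transportCost_of_le [IsProbabilityMeasure ν] (hw : IsCoerciveWeight P μ₀ φ₀) {m : ℝ}
    (hm : ∀ x, m ≤ φ₀ x - supportFun P x) : (m : EReal) ≤ transportCost P φ₀ ν := by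
  refine le_transportCost hw fun G hG hi => ?_
  have := hG.isProbabilityMeasure
  have : ∫ _, m ∂G ≤ ∫ z, cost φ₀ z ∂G := by
    refine integral_mono_ae (integrable_const _) hi ?_
    filter_upwards [hG.ae_snd (ae_unif_mem P)] with z hz
    exact (hm z.1).trans (sub_supportFun_le_cost hz)
  simpa using this

lemma IsCoupling.integrable_sub_supportFun [IsProbabilityMeasure ν]
    (hw : IsCoerciveWeight P μ₀ φ₀) (hG : IsCoupling P ν G) (hi : Integrable (cost φ₀) G) :
    Integrable (fun x => φ₀ x - supportFun P x) ν := by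
  have := hG.isProbabilityMeasure
  obtain ⟨m, hm⟩ := hw.exists_le
  rw [← hG.1, integrable_map_measure hw.continuous_sub.aestronglyMeasurable
    measurable_fst.aemeasurable]
  refine (hi.norm.add (integrable_const |m|)).mono'
    (hw.continuous_sub.comp continuous_fst).aestronglyMeasurable ?_
  filter_upwards [hG.ae_snd (ae_unif_mem P)] with z hz
  have h1 := sub_supportFun_le_cost (φ₀ := φ₀) hz
  have h2 := hm z.1
  simp only [Function.comp, Pi.add_apply, Real.norm_eq_abs]
  rw [abs_le]
  constructor <;> linarith [neg_abs_le m, le_abs_self (cost φ₀ z), abs_nonneg m,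
    abs_nonneg (cost φ₀ z)]

/-- Weak Kantorovich duality. -/
lemma IsCoupling.weak_duality [IsProbabilityMeasure ν] {f : Rn n → ℝ} {a : ℝ}
    (hφ₀ : Continuous φ₀) (hf : Continuous f) (hD : ∀ᵐ p ∂unif P, p ∈ conjDomain f)
    (hk : Integrable (conj f) (unif P)) (ha : ∀ᵐ x ∂ν, a ≤ φ₀ x - f x)
    (hG : IsCoupling P ν G) (hi : Integrable (cost φ₀) G) :
    Integrable (fun x => φ₀ x - f x) ν ∧ Integrable (fun z : Rn n × Rn n => conj f z.2) G ∧
    ∫ z, cost φ₀ z ∂G = ∫ x, (φ₀ x - f x) ∂ν - ∫ p, conj f p ∂unif P +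
      ∫ z, (f z.1 + conj f z.2 - ⟪z.1, z.2⟫) ∂G ∧
    0 ≤ᵐ[G] fun z => f z.1 + conj f z.2 - ⟪z.1, z.2⟫ := by
  have := hG.isProbabilityMeasure
  have hsub : Continuous fun x => φ₀ x - f x := hφ₀.sub hf
  have hk' : Integrable (fun z : Rn n × Rn n => conj f z.2) G := by
    have := hk
    rw [← hG.2, integrable_map_measure (measurable_conj f).aestronglyMeasurable
      measurable_snd.aemeasurable] at this
    exact this
  have hint : ∫ z, conj f z.2 ∂G = ∫ p, conj f p ∂unif P := by
    rw [← hG.2, integral_map measurable_snd.aemeasurable (measurable_conj f).aestronglyMeasurable]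
  have hpos : 0 ≤ᵐ[G] fun z => f z.1 + conj f z.2 - ⟪z.1, z.2⟫ := by
    filter_upwards [hG.ae_snd hD] with z hz
    have := le_conj hz z.1
    simp only [Pi.zero_apply]; linarith
  have hf1 : Integrable (fun z : Rn n × Rn n => φ₀ z.1 - f z.1) G := by
    refine ((hi.add hk').norm.add (integrable_const |a|)).mono'
      (hsub.comp continuous_fst).aestronglyMeasurable ?_
    filter_upwards [hpos, hG.ae_fst ha] with z h1 h2
    simp only [Pi.zero_apply, Pi.add_apply, Real.norm_eq_abs, cost] at h1 ⊢
    rw [abs_le]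
    constructor <;>
      linarith [neg_abs_le a, le_abs_self (-⟪z.1, z.2⟫ + φ₀ z.1 + conj f z.2), abs_nonneg a,
        abs_nonneg (-⟪z.1, z.2⟫ + φ₀ z.1 + conj f z.2)]
  have hf2 : Integrable (fun x => φ₀ x - f x) ν := by
    rw [← hG.1, integrable_map_measure hsub.aestronglyMeasurable
      measurable_fst.aemeasurable]
    exact hf1
  have hint1 : ∫ z, (φ₀ z.1 - f z.1) ∂G = ∫ x, (φ₀ x - f x) ∂ν := by
    rw [← hG.1, integral_map measurable_fst.aemeasurable hsub.aestronglyMeasurable]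
  refine ⟨hf2, hk', ?_, hpos⟩
  have h3 : ∀ z : Rn n × Rn n, f z.1 + conj f z.2 - ⟪z.1, z.2⟫ =
      cost φ₀ z + conj f z.2 - (φ₀ z.1 - f z.1) := fun z => by simp only [cost]; ring
  simp_rw [h3]
  have h4 : ∫ z, (cost φ₀ z + conj f z.2 - (φ₀ z.1 - f z.1)) ∂G =
      ∫ z, (cost φ₀ z + conj f z.2) ∂G - ∫ z, (φ₀ z.1 - f z.1) ∂G := integral_sub (hi.add hk') hf1
  rw [h4, integral_add hi hk', hint, hint1]
  ring

/-- The gradient of the Legendre transform is an optimal transport map. -/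
lemma transportCost_map_conjGrad_le {f : Rn n → ℝ} (hφ₀ : Continuous φ₀) (hf : Continuous f)
    (hD : ∀ᵐ p ∂unif P, p ∈ conjDomain f) (hk : Integrable (conj f) (unif P))
    (hν : (unif P).map (conjGrad f) = ν) (hi : Integrable (fun x => φ₀ x - f x) ν) :
    transportCost P φ₀ ν ≤
      ((∫ x, (φ₀ x - f x) ∂ν - ∫ p, conj f p ∂unif P : ℝ) : EReal) := by
  have hsub : Continuous fun x => φ₀ x - f x := hφ₀.sub hf
  have hT := measurable_conjGrad f
  have hm : Measurable fun p => (conjGrad f p, p) := hT.prodMk measurable_id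
  have hG : IsCoupling P ν ((unif P).map fun p => (conjGrad f p, p)) := by
    constructor
    · rw [Measure.map_map measurable_fst hm, ← hν]; rfl
    · rw [Measure.map_map measurable_snd hm]
      exact Measure.map_id
  have hae : ∀ᵐ p ∂unif P, cost φ₀ (conjGrad f p, p) =
      (φ₀ (conjGrad f p) - f (conjGrad f p)) - conj f p := by
    filter_upwards [ae_mem_subgrad_iff hf hD] with p hp
    rw [conj_eq_of_mem_subgrad ((hp _).2 rfl)]
    simp only [cost]; ring
  have hi' : Integrable (fun p => φ₀ (conjGrad f p) - f (conjGrad f p)) (unif P) := by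
    rw [← hν, integrable_map_measure hsub.aestronglyMeasurable hT.aemeasurable] at hi
    exact hi
  have hic : Integrable (cost φ₀) ((unif P).map fun p => (conjGrad f p, p)) := by
    rw [integrable_map_measure (continuous_cost hφ₀).aestronglyMeasurable hm.aemeasurable]
    exact (integrable_congr hae).2 (hi'.sub hk)
  refine (hG.transportCost_le hic).trans (le_of_eq ?_)
  rw [integral_map hm.aemeasurable (continuous_cost hφ₀).aestronglyMeasurable,
    integral_congr_ae hae, integral_sub hi' hk, ← hν,
    integral_map hT.aemeasurable hsub.aestronglyMeasurable]

end Transport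

/-! ### Relative entropy with respect to a measure of possibly infinite mass -/

section Entropy

variable {ν : Measure (Rn n)}

lemma mul_neg_log_le {s w : ℝ} (hs : 0 ≤ s) : s * -Real.log s ≤ s * w + Real.exp (-w) := by
  rcases hs.eq_or_lt with rfl | hs
  · simpa using (Real.exp_pos _).le
  have h := Real.log_le_sub_one_of_pos (div_pos (Real.exp_pos (-w)) hs)
  rw [Real.log_div (Real.exp_pos _).ne' hs.ne', Real.log_exp] at h
  have h2 := mul_le_mul_of_nonneg_left h hs.le
  rw [mul_sub, mul_sub, mul_div_cancel₀ _ hs.ne'] at h2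
  nlinarith

/-- The negative part of `log (dν/dμ₀)` is `ν`-integrable as soon as some `w` is `ν`-integrable
for which `e^{-w}` is `μ₀`-integrable. -/
lemma lintegral_neg_llr_ne_top [IsProbabilityMeasure ν] [SigmaFinite μ₀] (hν : ν ≪ μ₀)
    {w : Rn n → ℝ} (hwm : Measurable w) (hwi : Integrable w ν)
    (hwe : Integrable (fun x => Real.exp (-w x)) μ₀) :
    ∫⁻ x, ENNReal.ofReal (-llr ν μ₀ x) ∂ν ≠ ∞ := by
  have h1 : ∫⁻ x, ENNReal.ofReal (-llr ν μ₀ x) ∂ν =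
      ∫⁻ x, ν.rnDeriv μ₀ x * ENNReal.ofReal (-llr ν μ₀ x) ∂μ₀ :=
    (lintegral_rnDeriv_mul hν ((measurable_llr ν μ₀).neg.ennreal_ofReal.aemeasurable)).symm
  have h2 : ∫⁻ x, ν.rnDeriv μ₀ x * ‖w x‖ₑ ∂μ₀ = ∫⁻ x, ‖w x‖ₑ ∂ν :=
    lintegral_rnDeriv_mul hν hwm.enorm.aemeasurable
  rw [h1]
  refine ((lintegral_mono_ae ?_).trans_lt (?_ :
    ∫⁻ x, (ν.rnDeriv μ₀ x * ‖w x‖ₑ + ‖Real.exp (-w x)‖ₑ) ∂μ₀ < ∞)).ne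
  · filter_upwards [Measure.rnDeriv_lt_top ν μ₀] with x hx
    rw [Real.enorm_eq_ofReal_abs, Real.enorm_eq_ofReal_abs, abs_of_pos (Real.exp_pos _)]
    conv_lhs => rw [← ENNReal.ofReal_toReal hx.ne]
    conv_rhs => rw [← ENNReal.ofReal_toReal hx.ne]
    rw [← ENNReal.ofReal_mul ENNReal.toReal_nonneg, ← ENNReal.ofReal_mul ENNReal.toReal_nonneg,
      ← ENNReal.ofReal_add (by positivity) (by positivity)]
    refine ENNReal.ofReal_le_ofReal ?_
    refine (mul_neg_log_le ENNReal.toReal_nonneg (w := w x)).trans ?_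
    gcongr
    exact le_abs_self _
  · rw [lintegral_add_right' _ hwe.1.enorm, h2]
    exact ENNReal.add_lt_top.2 ⟨hwi.2, hwe.2⟩

lemma relEntropy_ne_top [IsProbabilityMeasure ν] [SigmaFinite μ₀] {w : Rn n → ℝ}
    (hwm : Measurable w) (hwi : Integrable w ν) (hwe : Integrable (fun x => Real.exp (-w x)) μ₀)
    (h : relEntropy μ₀ ν ≠ ⊤) :
    ν ≪ μ₀ ∧ Integrable (llr ν μ₀) ν ∧
      relEntropy μ₀ ν = ((∫ x, llr ν μ₀ x ∂ν : ℝ) : EReal) := by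
  have hac : ν ≪ μ₀ := by
    by_contra hac
    exact h (by rw [relEntropy, if_neg hac])
  rw [relEntropy, if_pos hac] at h ⊢
  have hi := integrable_of_eintegral_ne_top (measurable_llr ν μ₀).aestronglyMeasurable
    (lintegral_neg_llr_ne_top hac hwm hwi hwe) h
  exact ⟨hac, hi, eintegral_eq_integral hi⟩

lemma integral_llr_tilted_right_pos [IsProbabilityMeasure ν] [SigmaFinite μ₀] (hμ₀ : μ₀ ≠ 0)
    (hν : ν ≪ μ₀) (hi : Integrable (llr ν μ₀) ν) {g : Rn n → ℝ} (hg : Integrable g ν)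
    (hge : Integrable (fun x => Real.exp (g x)) μ₀) (hne : ν ≠ μ₀.tilted g) :
    ∫ x, g x ∂ν - Real.log (∫ x, Real.exp (g x) ∂μ₀) < ∫ x, llr ν μ₀ x ∂ν := by
  have : NeZero μ₀ := ⟨hμ₀⟩
  have := isProbabilityMeasure_tilted hge
  have hac : ν ≪ μ₀.tilted g := hν.trans (absolutelyContinuous_tilted hge)
  have hi' := integrable_llr_tilted_right hν hg hi hge
  have h1 := integral_llr_tilted_right hν hg hge hi
  have h2 := InformationTheory.toReal_klDiv_of_measure_eq hac (by simp)
  have h3 : 0 < (InformationTheory.klDiv ν (μ₀.tilted g)).toReal :=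
    ENNReal.toReal_pos (fun h => hne (InformationTheory.klDiv_eq_zero_iff.1 h))
      (InformationTheory.klDiv_ne_top hac hi')
  linarith

end Entropy

/-! ### The free energy -/

section FreeEnergy

variable {β : EReal} {ν : ProbOn μ₀.support}

lemma exists_transportCost_eq (hw : IsCoerciveWeight P μ₀ φ₀) {ν : Measure (Rn n)}
    [IsProbabilityMeasure ν] (h : transportCost P φ₀ ν ≠ ⊤) :
    ∃ c : ℝ, transportCost P φ₀ ν = c ∧ Integrable (fun x => φ₀ x - supportFun P x) ν := by
  obtain ⟨G, hG, hi, -⟩ := exists_coupling_of_transportCost_lt hw h.lt_top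
  obtain ⟨m, hm⟩ := hw.exists_le
  have hbot : transportCost P φ₀ ν ≠ ⊥ :=
    ne_bot_of_le_ne_bot (EReal.coe_ne_bot m) (le_transportCost_of_le hw hm)
  exact ⟨(transportCost P φ₀ ν).toReal, (EReal.coe_toReal h hbot).symm,
    hG.integrable_sub_supportFun hw hi⟩

lemma transportCost_ne_top (h : freeEnergy P μ₀ φ₀ β ν ≠ ⊤) : transportCost P φ₀ ν.meas ≠ ⊤ :=
  fun htop => h (by rw [freeEnergy, if_pos htop])

lemma freeEnergy_top (ν : ProbOn μ₀.support) :
    freeEnergy P μ₀ φ₀ ⊤ ν = transportCost P φ₀ ν.meas := by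
  rw [freeEnergy]
  split_ifs with h
  · exact h.symm
  · rw [EReal.div_top, add_zero]

/-- Where the free energy is finite, all its terms are real numbers. -/
lemma freeEnergy_coe_of_ne_top (hw : IsCoerciveWeight P μ₀ φ₀) {β : ℝ} (hβ : 0 < β)
    (h : freeEnergy P μ₀ φ₀ β ν ≠ ⊤) :
    ∃ c : ℝ, transportCost P φ₀ ν.meas = c ∧
      Integrable (fun x => φ₀ x - supportFun P x) ν.meas ∧ ν.meas ≪ μ₀ ∧
      Integrable (llr ν.meas μ₀) ν.meas ∧
      freeEnergy P μ₀ φ₀ β ν = ((c + (∫ x, llr ν.meas μ₀ x ∂ν.meas) / β : ℝ) : EReal) := by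
  have := hw.sigmaFinite
  have hC := transportCost_ne_top h
  obtain ⟨c, hc, hV⟩ := exists_transportCost_eq hw hC
  rw [freeEnergy, if_neg hC, hc] at h ⊢
  have hD : relEntropy μ₀ ν.meas ≠ ⊤ := by
    intro htop
    rw [htop, EReal.top_div_of_pos_ne_top (by exact_mod_cast hβ) (EReal.coe_ne_top β)] at h
    exact h (EReal.coe_add_top c)
  have he : Integrable (fun x => Real.exp (-(φ₀ x - supportFun P x))) μ₀ := by
    simpa using hw.integrable_exp one_pos
  obtain ⟨hac, hi, heq⟩ := relEntropy_ne_top hw.continuous_sub.measurable hV he hD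
  refine ⟨c, rfl, hV, hac, hi, ?_⟩
  rw [heq]
  norm_cast

end FreeEnergy

/-! ### Solutions of the Monge–Ampère equation minimize the free energy -/

section Solutions

/-- The measure `e^{β(φ - φ₀)} μ₀`. -/
noncomputable abbrev expMeasure (μ₀ : Measure (Rn n)) (φ₀ : Rn n → ℝ) (β : ℝ) (φ : Rn n → ℝ) :
    Measure (Rn n) :=
  μ₀.withDensity fun x => ENNReal.ofReal (Real.exp (β * (φ x - φ₀ x)))

variable {φ : Rn n → ℝ} {β : ℝ}

lemma IsPotential.sub_le_of_le (hφ : IsPotential P φ) {m : ℝ}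
    (hm : ∀ x, m ≤ φ₀ x - supportFun P x) (x : Rn n) : φ x - φ₀ x ≤ φ 0 - m := by
  have h1 := hφ.sub_le 0 x
  rw [sub_zero] at h1
  linarith [hm x]

lemma IsPotential.integrable_exp (hw : IsCoerciveWeight P μ₀ φ₀) (hφ : IsPotential P φ) {s : ℝ}
    (hs : 0 < s) : Integrable (fun x => Real.exp (s * (φ x - φ₀ x))) μ₀ := by
  refine ((hw.integrable_exp hs).const_mul (Real.exp (s * φ 0))).mono'
    (Real.continuous_exp.comp
      ((hφ.continuous.sub hw.continuous).const_mul s)).aestronglyMeasurable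
    (Eventually.of_forall fun x => ?_)
  rw [Real.norm_eq_abs, abs_of_pos (Real.exp_pos _), ← Real.exp_add, Real.exp_le_exp]
  have h1 := hφ.sub_le 0 x
  rw [sub_zero] at h1
  nlinarith

/-- The function `|u| e^{βu}` is bounded by a combination of `e^{βu}` and `e^{βu/2}` where `u` is
bounded above. -/
lemma IsPotential.integrable_sub (hw : IsCoerciveWeight P μ₀ φ₀) (hφ : IsPotential P φ)
    (hβ : 0 < β) : Integrable (fun x => φ x - φ₀ x) (expMeasure μ₀ φ₀ β φ) := by
  have hu : Continuous fun x => φ x - φ₀ x := hφ.continuous.sub hw.continuous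
  have hme : Measurable fun x => Real.exp (β * (φ x - φ₀ x)) :=
    (Real.continuous_exp.comp (hu.const_mul β)).measurable
  rw [integrable_withDensity_iff hme.ennreal_ofReal
    (Eventually.of_forall fun x => ENNReal.ofReal_lt_top)]
  simp_rw [ENNReal.toReal_ofReal (Real.exp_pos _).le]
  obtain ⟨m, hm⟩ := hw.exists_le
  refine (((hφ.integrable_exp hw hβ).const_mul |φ 0 - m|).add
    ((hφ.integrable_exp hw (half_pos hβ)).const_mul (2 / β))).mono'
    (hu.measurable.mul hme).aestronglyMeasurable (Eventually.of_forall fun x => ?_)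
  have h1 := hφ.sub_le_of_le hm x
  set u := φ x - φ₀ x
  simp only [Pi.add_apply, norm_mul, Real.norm_eq_abs, abs_of_pos (Real.exp_pos _)]
  rcases le_total 0 u with h0 | h0
  · have h2 : |u| ≤ |φ 0 - m| := by
      rw [abs_of_nonneg h0]; exact h1.trans (le_abs_self _)
    have h3 : 0 ≤ 2 / β * Real.exp (β / 2 * u) := by positivity
    nlinarith [Real.exp_pos (β * u)]
  · have h2 : |u| ≤ 2 / β * Real.exp (-(β / 2 * u)) := by
      rw [abs_of_nonpos h0, div_mul_eq_mul_div, le_div_iff₀ hβ]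
      nlinarith [Real.add_one_le_exp (-(β / 2 * u))]
    calc |u| * Real.exp (β * u) ≤ 2 / β * Real.exp (-(β / 2 * u)) * Real.exp (β * u) := by gcongr
      _ = 2 / β * Real.exp (β / 2 * u) := by rw [mul_assoc, ← Real.exp_add]; congr 2; ring
      _ ≤ _ := le_add_of_nonneg_left (by positivity)

lemma ae_mem_conjDomain_of_volume_eq (hP : volume (P : Set (Rn n)) = 1)
    (hφ : ∀ x, subgrad φ x ⊆ P) (h : volume (subgradImage φ univ) = 1) :
    ∀ᵐ p ∂unif P, p ∈ conjDomain φ := by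
  have := isProbabilityMeasure_unif hP
  have hnull : NullMeasurableSet (conjDomain φ) (unif P) :=
    ((convexOn_conj φ).1.nullMeasurableSet volume).mono_ac
      Measure.restrict_le_self.absolutelyContinuous
  have hsub : subgradImage φ univ ⊆ conjDomain φ ∩ P := by
    refine iUnion₂_subset fun x _ p hp => ⟨mem_conjDomain (mem_subgrad_iff.1 hp), hφ x hp⟩
  have h1 : unif P (conjDomain φ) = 1 := by
    refine le_antisymm prob_le_one ?_
    rw [Measure.restrict_apply' P.isCompact.measurableSet, ← h]
    exact measure_mono hsub
  exact (prob_compl_eq_zero_iff₀ hnull).2 h1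

namespace IsMASolution

lemma ae_mem_conjDomain (hP : volume (P : Set (Rn n)) = 1) (h : IsMASolution P μ₀ φ₀ β φ) :
    ∀ᵐ p ∂unif P, p ∈ conjDomain φ :=
  ae_mem_conjDomain_of_volume_eq hP h.1.2 h.2.1

lemma map_conjGrad (hP : volume (P : Set (Rn n)) = 1) (h : IsMASolution P μ₀ φ₀ β φ) :
    (unif P).map (conjGrad φ) = expMeasure μ₀ φ₀ β φ := by
  ext A hA
  rw [h.2.2 A hA, isMongeAmpere_map_conjGrad h.1.continuous h.1.2 (h.ae_mem_conjDomain hP) A hA]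

lemma isProbabilityMeasure (h : IsMASolution P μ₀ φ₀ β φ) :
    IsProbabilityMeasure (expMeasure μ₀ φ₀ β φ) :=
  ⟨by rw [h.2.2 univ MeasurableSet.univ, h.2.1]⟩

lemma integrable_conj (hP : volume (P : Set (Rn n)) = 1) (hw : IsCoerciveWeight P μ₀ φ₀)
    (hβ : 0 < β) (h : IsMASolution P μ₀ φ₀ β φ) : Integrable (conj φ) (unif P) := by
  have := isProbabilityMeasure_unif hP
  obtain ⟨m, hm⟩ := hw.exists_le
  have hu : Continuous fun x => φ x - φ₀ x := h.1.continuous.sub hw.continuous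
  have hi := h.1.integrable_sub hw hβ
  rw [← h.map_conjGrad hP, integrable_map_measure hu.aestronglyMeasurable
    (measurable_conjGrad φ).aemeasurable] at hi
  refine (hi.norm.add (integrable_const (|m| + |φ 0|))).mono'
    (measurable_conj φ).aestronglyMeasurable ?_
  filter_upwards [h.ae_mem_conjDomain hP, ae_unif_mem P,
    ae_mem_subgrad_iff h.1.continuous (h.ae_mem_conjDomain hP)] with p h1 h2 h3
  have h4 := le_conj h1 0
  have h5 := conj_eq_of_mem_subgrad ((h3 _).2 rfl)
  have h6 := inner_le_supportFun h2 (conjGrad φ p)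
  have h7 := hm (conjGrad φ p)
  simp only [inner_zero_left, zero_sub, Pi.add_apply, Function.comp, Real.norm_eq_abs] at h4 ⊢
  rw [abs_le]
  constructor
  · linarith [le_abs_self (φ 0), abs_nonneg m, abs_nonneg (φ (conjGrad φ p) - φ₀ (conjGrad φ p))]
  · linarith [abs_nonneg (φ 0), neg_abs_le m, neg_abs_le (φ (conjGrad φ p) - φ₀ (conjGrad φ p))]

lemma expMeasure_eq_tilted (hw : IsCoerciveWeight P μ₀ φ₀) (hβ : 0 < β)
    (h : IsMASolution P μ₀ φ₀ β φ) :
    ∫ x, Real.exp (β * (φ x - φ₀ x)) ∂μ₀ = 1 ∧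
      expMeasure μ₀ φ₀ β φ = μ₀.tilted fun x => β * (φ x - φ₀ x) := by
  have h1 : ∫ x, Real.exp (β * (φ x - φ₀ x)) ∂μ₀ = 1 := by
    have h2 : ∫⁻ x, ENNReal.ofReal (Real.exp (β * (φ x - φ₀ x))) ∂μ₀ = 1 := by
      rw [← setLIntegral_univ, ← withDensity_apply _ MeasurableSet.univ]
      exact h.isProbabilityMeasure.measure_univ
    rw [integral_eq_lintegral_of_nonneg_ae (Eventually.of_forall fun x => (Real.exp_pos _).le)
      (h.1.integrable_exp hw hβ).1, h2, ENNReal.toReal_one]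
  refine ⟨h1, ?_⟩
  rw [Measure.tilted]
  simp_rw [h1, div_one]

/-- A solution of the Monge–Ampère equation defines the unique minimizer of the free energy: by
weak duality, the free energy of `ν` exceeds that of the solution by at least `β⁻¹` times the
entropy of `ν` relative to the solution. -/
theorem exists_minimizer (hP : volume (P : Set (Rn n)) = 1) (hw : IsCoerciveWeight P μ₀ φ₀)
    (hμ₀ : μ₀ ≠ 0) (hβ : 0 < β) (h : IsMASolution P μ₀ φ₀ β φ) :
    ∃ μ : ProbOn μ₀.support, μ.meas = expMeasure μ₀ φ₀ β φ ∧
      freeEnergy P μ₀ φ₀ β μ = ((-∫ p, conj φ p ∂unif P : ℝ) : EReal) ∧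
      ∀ ν, ν ≠ μ → ((-∫ p, conj φ p ∂unif P : ℝ) : EReal) < freeEnergy P μ₀ φ₀ β ν := by
  have := hw.sigmaFinite
  have := h.isProbabilityMeasure
  have := isProbabilityMeasure_unif hP
  obtain ⟨m, hm⟩ := hw.exists_le
  have hD := h.ae_mem_conjDomain hP
  have hk := h.integrable_conj hP hw hβ
  have hu := h.1.integrable_sub hw hβ
  have hexp := h.1.integrable_exp hw hβ
  obtain ⟨h1, htilt⟩ := h.expMeasure_eq_tilted hw hβ
  have hac : expMeasure μ₀ φ₀ β φ ≪ μ₀ := withDensity_absolutelyContinuous _ _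
  obtain ⟨μ, hμ⟩ : ∃ μ : ProbOn μ₀.support, μ.meas = expMeasure μ₀ φ₀ β φ :=
    ⟨⟨⟨expMeasure μ₀ φ₀ β φ, inferInstance⟩, hac Measure.measure_compl_support⟩, rfl⟩
  have hmap := h.map_conjGrad hP
  rw [← hμ] at hu htilt hac hmap
  have hllr : llr μ.meas μ₀ =ᵐ[μ.meas] fun x => β * (φ x - φ₀ x) := by
    have h2 := log_rnDeriv_tilted_left_self hexp
    simp only [h1, Real.log_one, ← htilt, sub_zero] at h2
    exact hac.ae_le h2
  have hlow : ∀ ν : ProbOn μ₀.support, ν ≠ μ →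
      ((-∫ p, conj φ p ∂unif P : ℝ) : EReal) < freeEnergy P μ₀ φ₀ β ν := by
    intro ν hν
    rcases eq_or_ne (freeEnergy P μ₀ φ₀ β ν) ⊤ with htop | htop
    · rw [htop]; exact EReal.coe_lt_top _
    obtain ⟨c, hc, hV, hνac, hllr, heq⟩ := freeEnergy_coe_of_ne_top hw hβ htop
    have hνa : ∀ᵐ x ∂ν.meas, m - φ 0 ≤ φ₀ x - φ x :=
      Eventually.of_forall fun x => by linarith [h.1.sub_le_of_le hm x]
    obtain ⟨G, hG, hi, -⟩ := exists_coupling_of_transportCost_lt hw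
      (lt_top_iff_ne_top.2 (transportCost_ne_top htop))
    have hint := (hG.weak_duality hw.continuous h.1.continuous hD hk hνa hi).1
    have hcle : ∫ x, (φ₀ x - φ x) ∂ν.meas - ∫ p, conj φ p ∂unif P ≤ c := by
      rw [← EReal.coe_le_coe_iff, ← hc]
      refine le_transportCost hw fun G hG hi => ?_
      obtain ⟨-, -, h3, h4⟩ := hG.weak_duality hw.continuous h.1.continuous hD hk hνa hi
      rw [h3]
      exact le_add_of_nonneg_right (integral_nonneg_of_ae h4)
    have hint' : Integrable (fun x => β * (φ x - φ₀ x)) ν.meas := by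
      refine (hint.const_mul (-β)).congr (Eventually.of_forall fun x => ?_)
      ring
    have hpos := integral_llr_tilted_right_pos hμ₀ hνac hllr hint' hexp (by
      rw [← htilt]
      intro he
      exact hν (Subtype.ext (Subtype.ext he)))
    rw [h1, Real.log_one, sub_zero] at hpos
    have h5 : ∫ x, β * (φ x - φ₀ x) ∂ν.meas = -β * ∫ x, (φ₀ x - φ x) ∂ν.meas := by
      rw [← integral_const_mul]
      congr 1; ext x; ring
    rw [h5] at hpos
    rw [heq, EReal.coe_lt_coe_iff]
    have h6 : -∫ x, (φ₀ x - φ x) ∂ν.meas < (∫ x, llr ν.meas μ₀ x ∂ν.meas) / β := by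
      rw [lt_div_iff₀ hβ]; linarith
    linarith
  have hint : Integrable (fun x => φ₀ x - φ x) μ.meas :=
    hu.neg.congr (Eventually.of_forall fun x => by simp)
  have hup : freeEnergy P μ₀ φ₀ β μ ≤ ((-∫ p, conj φ p ∂unif P : ℝ) : EReal) := by
    have hC := transportCost_map_conjGrad_le hw.continuous h.1.continuous hD hk
      hmap hint
    have hE : relEntropy μ₀ μ.meas = ((β * ∫ x, (φ x - φ₀ x) ∂μ.meas : ℝ) : EReal) := by
      rw [relEntropy, if_pos hac, eintegral_eq_integral
        ((integrable_congr hllr).2 (hu.const_mul β)), integral_congr_ae hllr, integral_const_mul]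
    rw [freeEnergy, if_neg (ne_top_of_le_ne_top (EReal.coe_ne_top _) hC), hE]
    refine (add_le_add_left hC _).trans (le_of_eq ?_)
    rw [← EReal.coe_div, ← EReal.coe_add, EReal.coe_eq_coe_iff, mul_div_cancel_left₀ _ hβ.ne']
    have h6 : ∫ x, (φ x - φ₀ x) ∂μ.meas = -∫ x, (φ₀ x - φ x) ∂μ.meas := by
      rw [← integral_neg]; congr 1; ext x; ring
    rw [h6]; ring
  refine ⟨μ, hμ, le_antisymm hup ?_, hlow⟩
  -- the lower bound at `μ` is weak duality with a vanishing relative entropy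
  obtain ⟨c, hc, -, -, -, heq⟩ := freeEnergy_coe_of_ne_top hw hβ
    (ne_top_of_le_ne_top (EReal.coe_ne_top _) hup)
  have hcle : ∫ x, (φ₀ x - φ x) ∂μ.meas - ∫ p, conj φ p ∂unif P ≤ c := by
    rw [← EReal.coe_le_coe_iff, ← hc]
    refine le_transportCost hw fun G hG hi => ?_
    obtain ⟨-, -, h3, h4⟩ := hG.weak_duality (a := m - φ 0) hw.continuous h.1.continuous hD hk
      (Eventually.of_forall fun x => by linarith [h.1.sub_le_of_le hm x]) hi
    rw [h3]
    exact le_add_of_nonneg_right (integral_nonneg_of_ae h4)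
  have hllr2 : ∫ x, llr μ.meas μ₀ x ∂μ.meas = β * ∫ x, (φ x - φ₀ x) ∂μ.meas := by
    rw [← integral_const_mul]
    exact integral_congr_ae hllr
  rw [heq, EReal.coe_le_coe_iff, hllr2, mul_div_cancel_left₀ _ hβ.ne']
  have h6 : ∫ x, (φ x - φ₀ x) ∂μ.meas = -∫ x, (φ₀ x - φ x) ∂μ.meas := by
    rw [← integral_neg]; congr 1; ext x; ring
  rw [h6]; linarith

end IsMASolution

/-- Domination principle: a potential is determined by the values of its Legendre transform at
almost every point of `P`. -/
lemma IsPotential.le_of_conj_le {ψ : Rn n → ℝ} (hPi : (interior (P : Set (Rn n))).Nonempty)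
    (hφ : IsPotential P φ) (hDφ : ∀ᵐ p ∂unif P, p ∈ conjDomain φ)
    (hDψ : ∀ᵐ p ∂unif P, p ∈ conjDomain ψ)
    (h : ∀ᵐ p ∂unif P, conj φ p = conj ψ p) (x : Rn n) : φ x ≤ ψ x := by
  have hiφ := interior_subset_interior_conjDomain hDφ
  have hiψ := interior_subset_interior_conjDomain hDψ
  have heq : EqOn (conj φ) (conj ψ) (interior (P : Set (Rn n))) := by
    refine Measure.eqOn_open_of_ae_eq (μ := volume)
      (ae_restrict_of_ae_restrict_of_subset interior_subset h) isOpen_interior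
      ((convexOn_conj φ).continuousOn_interior.mono hiφ)
      ((convexOn_conj ψ).continuousOn_interior.mono hiψ)
  obtain ⟨p, hpP, hp⟩ := hφ.exists_mem_subgrad x
  obtain ⟨q, hq⟩ := hPi
  have hpD := mem_conjDomain (mem_subgrad_iff.1 hp)
  have hpe := conj_eq_of_mem_subgrad hp
  -- approach `p` by interior points on the segment from `p` to `q`
  have key : ∀ s ∈ Ioo (0 : ℝ) 1,
      (1 - s) * φ x + s * (⟪x, q⟫ - conj φ q) ≤ ψ x := by
    intro s hs
    have hps : (1 - s) • p + s • q ∈ interior (P : Set (Rn n)) :=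
      P.convex.combo_self_interior_mem_interior hpP hq (by linarith [hs.2]) hs.1 (by ring)
    have h1 := le_conj (interior_subset (hiψ hps)) x
    rw [← heq hps] at h1
    have h2 := (convexOn_conj φ).2 hpD (interior_subset (hiφ hq)) (by linarith [hs.2] : 0 ≤ 1 - s)
      hs.1.le (by ring)
    rw [inner_add_right, real_inner_smul_right, real_inner_smul_right] at h1
    simp only [smul_eq_mul] at h2
    rw [hpe] at h2
    linarith
  have hlim : Tendsto (fun s : ℝ => (1 - s) * φ x + s * (⟪x, q⟫ - conj φ q)) (𝓝[>] 0)
      (𝓝 ((1 - 0) * φ x + 0 * (⟪x, q⟫ - conj φ q))) :=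
    (Continuous.tendsto (by fun_prop) 0).mono_left nhdsWithin_le_nhds
  have := le_of_tendsto hlim (mem_of_superset (Ioo_mem_nhdsGT one_pos) key)
  simpa using this

lemma interior_nonempty (hP : volume (P : Set (Rn n)) = 1) :
    (interior (P : Set (Rn n))).Nonempty := by
  have := isProbabilityMeasure_unif hP
  exact (ae_mem_interior P).exists

/-- Uniqueness for the Monge–Ampère equation: two solutions have the same Monge–Ampère measure,
the minimizer of the free energy, hence agree on its support, hence have the same Legendre
transform. -/
theorem IsMASolution.unique {ψ : Rn n → ℝ} (hP : volume (P : Set (Rn n)) = 1)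
    (hw : IsCoerciveWeight P μ₀ φ₀) (hμ₀ : μ₀ ≠ 0) (hβ : 0 < β) (hφ : IsMASolution P μ₀ φ₀ β φ)
    (hψ : IsMASolution P μ₀ φ₀ β ψ) : φ = ψ := by
  have := hw.sigmaFinite
  obtain ⟨μ, hμ, hμF, hμmin⟩ := hφ.exists_minimizer hP hw hμ₀ hβ
  obtain ⟨μ', hμ', hμF', hμmin'⟩ := hψ.exists_minimizer hP hw hμ₀ hβ
  have hμμ : μ = μ' := by
    by_contra hne
    have h1 := hμmin μ' (Ne.symm hne)
    have h2 := hμmin' μ hne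
    rw [hμF'] at h1
    rw [hμF] at h2
    exact lt_asymm h1 h2
  have hcont : ∀ f : Rn n → ℝ, Continuous f →
      Measurable fun x => ENNReal.ofReal (Real.exp (β * (f x - φ₀ x))) := fun f hf =>
    (Real.continuous_exp.comp ((hf.sub hw.continuous).const_mul β)).measurable.ennreal_ofReal
  have hmeas : expMeasure μ₀ φ₀ β φ = expMeasure μ₀ φ₀ β ψ := by rw [← hμ, ← hμ', hμμ]
  have hae : ∀ᵐ x ∂μ₀, φ x = ψ x := by
    have h1 := (withDensity_eq_iff_of_sigmaFinite (hcont φ hφ.1.continuous).aemeasurable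
      (hcont ψ hψ.1.continuous).aemeasurable).1 hmeas
    filter_upwards [h1] with x hx
    rw [ENNReal.ofReal_eq_ofReal_iff (Real.exp_pos _).le (Real.exp_pos _).le,
      Real.exp_eq_exp] at hx
    have := mul_left_cancel₀ hβ.ne' hx
    linarith
  have hDφ := hφ.ae_mem_conjDomain hP
  have hDψ := hψ.ae_mem_conjDomain hP
  -- the Legendre transforms are compared at the subgradients of points where `f = g`
  have hle : ∀ f g : Rn n → ℝ, IsMASolution P μ₀ φ₀ β f → IsMASolution P μ₀ φ₀ β g →
      (∀ᵐ x ∂μ₀, f x = g x) → ∀ᵐ p ∂unif P, conj f p ≤ conj g p := by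
    intro f g hf hg hfg
    have h1 : ∀ᵐ x ∂(unif P).map (conjGrad f), f x = g x := by
      rw [hf.map_conjGrad hP]
      exact (withDensity_absolutelyContinuous _ _).ae_le hfg
    filter_upwards [ae_of_ae_map (measurable_conjGrad f).aemeasurable h1,
      ae_mem_subgrad_iff hf.1.continuous (hf.ae_mem_conjDomain hP),
      hg.ae_mem_conjDomain hP] with p h2 h3 h4
    rw [conj_eq_of_mem_subgrad ((h3 _).2 rfl), h2]
    exact le_conj h4 _
  have heq : ∀ᵐ p ∂unif P, conj φ p = conj ψ p := by
    filter_upwards [hle φ ψ hφ hψ hae, hle ψ φ hψ hφ (hae.mono fun x hx => hx.symm)] with p h1 h2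
    exact le_antisymm h1 h2
  ext x
  exact le_antisymm (hφ.1.le_of_conj_le (interior_nonempty hP) hDφ hDψ heq x)
    (hψ.1.le_of_conj_le (interior_nonempty hP) hDψ hDφ (heq.mono fun p hp => hp.symm) x)

end Solutions

/-! ### Compactness of sets of couplings with bounded cost -/

section Compactness

/-- Probability measures on `ℝⁿ × P` whose cost is at most `a`; here `m` is a lower bound of the
cost on `ℝⁿ × P`. -/
def costSublevel (P : ConvexBody (Rn n)) (φ₀ : Rn n → ℝ) (m a : ℝ) :
    Set (ProbabilityMeasure (Rn n × Rn n)) :=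
  {G | (G : Measure (Rn n × Rn n)) (univ ×ˢ (P : Set (Rn n)))ᶜ = 0 ∧
    ∫⁻ z, ENNReal.ofReal (cost φ₀ z - m) ∂(G : Measure (Rn n × Rn n)) ≤ ENNReal.ofReal (a - m)}

/-- The pair of marginals of a measure on a product. -/
noncomputable def marginals (G : ProbabilityMeasure (Rn n × Rn n)) :
    ProbabilityMeasure (Rn n) × ProbabilityMeasure (Rn n) :=
  (G.map measurable_fst.aemeasurable, G.map measurable_snd.aemeasurable)

lemma continuous_marginals : Continuous (marginals (n := n)) :=
  (ProbabilityMeasure.continuous_map continuous_fst).prodMk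
    (ProbabilityMeasure.continuous_map continuous_snd)

lemma isCompact_costSublevel (hw : IsCoerciveWeight P μ₀ φ₀) (m a : ℝ) :
    IsCompact (costSublevel P φ₀ m a) := by
  have hcost : Continuous fun z => cost φ₀ z - m :=
    (continuous_cost hw.continuous).sub continuous_const
  have hF : IsClosed ((univ : Set (Rn n)) ×ˢ (P : Set (Rn n))) :=
    isClosed_univ.prod P.isCompact.isClosed
  refine isCompact_setOf_lintegral_ofReal_le hcost hF (fun R => ?_) ENNReal.ofReal_ne_top
  have hcoer : IsCompact {x | φ₀ x - supportFun P x ≤ R + m} := by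
    have h1 : ∀ᶠ x in cocompact (Rn n), R + m < φ₀ x - supportFun P x :=
      hw.coercive.eventually_gt_atTop (R + m)
    obtain ⟨K, hK, hsub⟩ := mem_cocompact.1 h1
    refine hK.of_isClosed_subset (isClosed_le hw.continuous_sub continuous_const) fun x hx => ?_
    by_contra hxK
    have h2 : R + m < φ₀ x - supportFun P x := hsub hxK
    exact absurd h2 (not_lt.2 hx)
  refine (hcoer.prod P.isCompact).of_isClosed_subset
    (hF.inter (isClosed_le hcost continuous_const)) ?_
  rintro z ⟨hz, hzR⟩
  refine ⟨?_, hz.2⟩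
  have := sub_supportFun_le_cost (φ₀ := φ₀) hz.2
  simp only [mem_ofPred_eq]
  linarith

lemma costSublevel_mono (m : ℝ) {a a' : ℝ} (h : a ≤ a') :
    costSublevel P φ₀ m a ⊆ costSublevel P φ₀ m a' :=
  fun _ hG => ⟨hG.1, hG.2.trans (ENNReal.ofReal_le_ofReal (by linarith))⟩

lemma ae_le_cost {m : ℝ} (hm : ∀ x, m ≤ φ₀ x - supportFun P x) {G : Measure (Rn n × Rn n)}
    (hG : G (univ ×ˢ (P : Set (Rn n)))ᶜ = 0) : ∀ᵐ z ∂G, m ≤ cost φ₀ z := by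
  filter_upwards [compl_mem_ae_iff.2 hG] with z hz
  rw [compl_compl] at hz
  exact (hm z.1).trans (sub_supportFun_le_cost hz.2)

/-- Membership in the sublevel set in terms of the Bochner integral. -/
lemma mem_costSublevel_iff (hw : IsCoerciveWeight P μ₀ φ₀) {m : ℝ}
    (hm : ∀ x, m ≤ φ₀ x - supportFun P x) {a : ℝ} (hma : m ≤ a)
    {G : ProbabilityMeasure (Rn n × Rn n)}
    (hG : (G : Measure (Rn n × Rn n)) (univ ×ˢ (P : Set (Rn n)))ᶜ = 0) :
    G ∈ costSublevel P φ₀ m a ↔ Integrable (cost φ₀) (G : Measure (Rn n × Rn n)) ∧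
      ∫ z, cost φ₀ z ∂(G : Measure (Rn n × Rn n)) ≤ a := by
  have hae : 0 ≤ᵐ[(G : Measure (Rn n × Rn n))] fun z => cost φ₀ z - m := by
    filter_upwards [ae_le_cost hm hG] with z hz
    simpa using hz
  have hcm : AEStronglyMeasurable (fun z => cost φ₀ z - m) (G : Measure (Rn n × Rn n)) :=
    ((continuous_cost hw.continuous).sub continuous_const).aestronglyMeasurable
  have hcalc : Integrable (cost φ₀) (G : Measure (Rn n × Rn n)) →
      ∫ z, (cost φ₀ z - m) ∂(G : Measure (Rn n × Rn n)) =
        ∫ z, cost φ₀ z ∂(G : Measure (Rn n × Rn n)) - m := fun hi => by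
    rw [integral_sub hi (integrable_const _)]; simp
  constructor
  · rintro ⟨-, hle⟩
    have hi : Integrable (fun z => cost φ₀ z - m) (G : Measure (Rn n × Rn n)) :=
      ⟨hcm, by
        rw [hasFiniteIntegral_iff_ofReal hae]
        exact hle.trans_lt ENNReal.ofReal_lt_top⟩
    have hi' : Integrable (cost φ₀) (G : Measure (Rn n × Rn n)) :=
      (hi.add (integrable_const m)).congr (Eventually.of_forall fun z => by simp)
    refine ⟨hi', ?_⟩
    rw [← ofReal_integral_eq_lintegral_ofReal hi hae, hcalc hi',
      ENNReal.ofReal_le_ofReal_iff (by linarith)] at hle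
    linarith
  · rintro ⟨hi, hle⟩
    refine ⟨hG, ?_⟩
    have hi' : Integrable (fun z => cost φ₀ z - m) (G : Measure (Rn n × Rn n)) :=
      hi.sub (integrable_const m)
    rw [← ofReal_integral_eq_lintegral_ofReal hi' hae, hcalc hi]
    exact ENNReal.ofReal_le_ofReal (by linarith)

lemma IsCoupling.measure_compl {ν : Measure (Rn n)} {G : Measure (Rn n × Rn n)}
    (hG : IsCoupling P ν G) : G (univ ×ˢ (P : Set (Rn n)))ᶜ = 0 := by
  have h := hG.ae_snd (ae_unif_mem P)
  rw [ae_iff] at h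
  refine measure_mono_null (fun z hz => ?_) h
  simpa [mem_prod] using hz

/-- `λ_P` as a probability measure. -/
noncomputable def unifProb (hP : volume (P : Set (Rn n)) = 1) : ProbabilityMeasure (Rn n) :=
  ⟨unif P, isProbabilityMeasure_unif hP⟩

lemma isCoupling_of_marginals (hP : volume (P : Set (Rn n)) = 1) {ν : ProbabilityMeasure (Rn n)}
    {G : ProbabilityMeasure (Rn n × Rn n)} (h : marginals G = (ν, unifProb hP)) :
    IsCoupling P (ν : Measure (Rn n)) (G : Measure (Rn n × Rn n)) := by
  simp only [marginals, Prod.mk.injEq] at h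
  constructor
  · rw [← h.1]; rfl
  · have := congrArg (fun κ : ProbabilityMeasure (Rn n) => (κ : Measure (Rn n))) h.2
    exact this

lemma marginals_of_isCoupling (hP : volume (P : Set (Rn n)) = 1) {ν : ProbabilityMeasure (Rn n)}
    {G : ProbabilityMeasure (Rn n × Rn n)}
    (h : IsCoupling P (ν : Measure (Rn n)) (G : Measure (Rn n × Rn n))) :
    marginals G = (ν, unifProb hP) := by
  simp only [marginals, Prod.mk.injEq]
  exact ⟨Subtype.ext h.1, Subtype.ext h.2⟩

/-- Optimal couplings exist. -/
lemma exists_optimal_coupling (hP : volume (P : Set (Rn n)) = 1)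
    (hw : IsCoerciveWeight P μ₀ φ₀) {ν : ProbabilityMeasure (Rn n)} {a : ℝ}
    (h : transportCost P φ₀ (ν : Measure (Rn n)) ≤ a) :
    ∃ G, IsCoupling P (ν : Measure (Rn n)) G ∧ Integrable (cost φ₀) G ∧ ∫ z, cost φ₀ z ∂G ≤ a := by
  obtain ⟨m, hm⟩ := hw.exists_le
  have hma : m ≤ a := by
    exact_mod_cast (le_transportCost_of_le hw hm (ν := (ν : Measure (Rn n)))).trans h
  let K : ℕ → Set (ProbabilityMeasure (Rn n × Rn n)) := fun j =>
    costSublevel P φ₀ m (a + 1 / (j + 1)) ∩ marginals ⁻¹' {(ν, unifProb hP)}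
  have hclosed : IsClosed (marginals (n := n) ⁻¹' {(ν, unifProb hP)}) :=
    isClosed_singleton.preimage continuous_marginals
  have hK : ∀ j, IsCompact (K j) := fun j => (isCompact_costSublevel hw m _).inter_right hclosed
  have hne : (⋂ j, K j).Nonempty := by
    refine IsCompact.nonempty_iInter_of_sequence_nonempty_isCompact_isClosed K ?_ ?_ (hK 0)
      fun j => (hK j).isClosed
    · intro j
      refine inter_subset_inter_left _ (costSublevel_mono m ?_)
      push_cast
      gcongr
      linarith
    · intro j
      have hpos : (0 : ℝ) < 1 / ((j : ℝ) + 1) := by positivity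
      obtain ⟨G, hG, hi, hlt⟩ := exists_coupling_of_transportCost_lt hw
        (h.trans_lt (EReal.coe_lt_coe_iff.2 (by linarith : a < a + 1 / ((j : ℝ) + 1))))
      have := hG.isProbabilityMeasure
      refine ⟨⟨G, this⟩, ?_, marginals_of_isCoupling (G := ⟨G, this⟩) hP hG⟩
      exact (mem_costSublevel_iff (G := ⟨G, this⟩) hw hm (by linarith) hG.measure_compl).2
        ⟨hi, (EReal.coe_lt_coe_iff.1 hlt).le⟩
  obtain ⟨G, hG⟩ := hne
  rw [mem_iInter] at hG
  have hcoup := isCoupling_of_marginals hP (hG 0).2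
  have hall : ∀ j : ℕ, Integrable (cost φ₀) (G : Measure (Rn n × Rn n)) ∧
      ∫ z, cost φ₀ z ∂(G : Measure (Rn n × Rn n)) ≤ a + 1 / ((j : ℝ) + 1) := fun j =>
    (mem_costSublevel_iff hw hm (by linarith [show (0 : ℝ) < 1 / ((j : ℝ) + 1) by positivity])
      hcoup.measure_compl).1 (hG j).1
  refine ⟨G, hcoup, (hall 0).1, ?_⟩
  have hlim : Tendsto (fun j : ℕ => a + 1 / ((j : ℝ) + 1)) atTop (𝓝 (a + 0)) :=
    tendsto_const_nhds.add tendsto_one_div_add_atTop_nhds_zero_nat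
  rw [add_zero] at hlim
  exact ge_of_tendsto' hlim fun j => (hall j).2

/-- Joint lower semicontinuity of the optimal cost in both marginals: the set of pairs of
marginals of couplings with bounded cost is compact. -/
lemma eventually_lt_cost (hP : volume (P : Set (Rn n)) = 1) (hw : IsCoerciveWeight P μ₀ φ₀)
    {ν : ProbabilityMeasure (Rn n)} {a : ℝ}
    (h : (a : EReal) < transportCost P φ₀ (ν : Measure (Rn n)))
    {ι : Type*} {L : Filter ι} {κ : ι → ProbabilityMeasure (Rn n)}
    (hκ : Tendsto κ L (𝓝 (unifProb hP))) :
    ∃ U, IsOpen U ∧ ν ∈ U ∧ ∀ᶠ k in L, ∀ G : ProbabilityMeasure (Rn n × Rn n),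
      (G : Measure (Rn n × Rn n)) (univ ×ˢ (P : Set (Rn n)))ᶜ = 0 →
      G.map measurable_fst.aemeasurable ∈ U → G.map measurable_snd.aemeasurable = κ k →
      Integrable (cost φ₀) (G : Measure (Rn n × Rn n)) →
      a < ∫ z, cost φ₀ z ∂(G : Measure (Rn n × Rn n)) := by
  obtain ⟨m, hm⟩ := hw.exists_le
  have hcl : IsClosed (marginals '' costSublevel P φ₀ m (max a m)) :=
    ((isCompact_costSublevel hw m _).image continuous_marginals).isClosed
  rcases lt_or_ge a m with ham | ham
  · refine ⟨univ, isOpen_univ, mem_univ _, Eventually.of_forall fun k G hG _ _ hi => ?_⟩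
    refine ham.trans_le ?_
    have : ∫ _, m ∂(G : Measure (Rn n × Rn n)) ≤ ∫ z, cost φ₀ z ∂(G : Measure (Rn n × Rn n)) :=
      integral_mono_ae (integrable_const _) hi (ae_le_cost hm hG)
    simpa using this
  rw [max_eq_left ham] at hcl
  have hnot : (ν, unifProb hP) ∈ (marginals '' costSublevel P φ₀ m a)ᶜ := by
    rintro ⟨G, hG, hmarg⟩
    have hcoup := isCoupling_of_marginals hP hmarg
    obtain ⟨hi, hle⟩ := (mem_costSublevel_iff hw hm ham hcoup.measure_compl).1 hG
    exact absurd (h.trans_le (hcoup.transportCost_le hi)) (not_lt.2 (by exact_mod_cast hle))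
  obtain ⟨U, V, hU, hV, hνU, hPV, hUV⟩ := isOpen_prod_iff.1 hcl.isOpen_compl _ _ hnot
  refine ⟨U, hU, hνU, ?_⟩
  filter_upwards [hκ (hV.mem_nhds hPV)] with k hk G hG hG1 hG2 hi
  by_contra! hle
  refine hUV (show marginals G ∈ U ×ˢ V from ⟨hG1, ?_⟩)
    ⟨G, (mem_costSublevel_iff hw hm ham hG).2 ⟨hi, hle⟩, rfl⟩
  change G.map measurable_snd.aemeasurable ∈ V
  rw [hG2]; exact hk

end Compactness

/-! ### The convex envelope minimizes the transport cost -/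

section Envelope

variable {X : Set (Rn n)}

/-- The Legendre transform of `φ₀` restricted to `X`. -/
noncomputable def conjOn (X : Set (Rn n)) (φ₀ : Rn n → ℝ) (p : Rn n) : ℝ :=
  sSup ((fun x => ⟪x, p⟫ - φ₀ x) '' X)

variable {m : ℝ}

lemma inner_sub_le (hm : ∀ x, m ≤ φ₀ x - supportFun P x) {p : Rn n} (hp : p ∈ P) (x : Rn n) :
    ⟪x, p⟫ - φ₀ x ≤ -m := by
  have := inner_le_supportFun hp x
  linarith [hm x]

lemma inner_sub_le_conjOn (hm : ∀ x, m ≤ φ₀ x - supportFun P x) {p : Rn n} (hp : p ∈ P)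
    {x : Rn n} (hx : x ∈ X) : ⟪x, p⟫ - φ₀ x ≤ conjOn X φ₀ p := by
  refine le_csSup ⟨-m, ?_⟩ ⟨x, hx, rfl⟩
  rintro _ ⟨y, -, rfl⟩
  exact inner_sub_le hm hp y

lemma conjOn_le (hX : X.Nonempty) {p : Rn n} {a : ℝ} (h : ∀ x ∈ X, ⟪x, p⟫ - φ₀ x ≤ a) :
    conjOn X φ₀ p ≤ a := by
  refine csSup_le (hX.image _) ?_
  rintro _ ⟨x, hx, rfl⟩
  exact h x hx

lemma bddAbove_inner_sub_conjOn (hm : ∀ x, m ≤ φ₀ x - supportFun P x) (hX : X.Nonempty)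
    (x : Rn n) : BddAbove ((fun p => ⟪x, p⟫ - conjOn X φ₀ p) '' (P : Set (Rn n))) := by
  obtain ⟨R, hR0, hR⟩ := exists_norm_le_of_mem P
  obtain ⟨x₀, hx₀⟩ := hX
  refine ⟨supportFun P x + R * ‖x₀‖ + φ₀ x₀, ?_⟩
  rintro _ ⟨p, hp, rfl⟩
  have h1 := inner_sub_le_conjOn hm hp hx₀
  have h2 := inner_le_supportFun hp x
  have h3 := neg_le_of_abs_le (abs_real_inner_le_norm x₀ p)
  have h4 := mul_le_mul_of_nonneg_left (hR p hp) (norm_nonneg x₀)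
  change ⟪x, p⟫ - conjOn X φ₀ p ≤ _
  linarith

/-- The convex envelope is the biconjugate. -/
lemma convexEnvelope_eq (hm : ∀ x, m ≤ φ₀ x - supportFun P x) (hX : X.Nonempty) :
    convexEnvelope P X φ₀ =
      fun x => sSup ((fun p => ⟪x, p⟫ - conjOn X φ₀ p) '' (P : Set (Rn n))) := by
  have hb := bddAbove_inner_sub_conjOn hm hX (P := P)
  ext x
  refine IsGreatest.csSup_eq ⟨⟨_, isPotential_sSup subset_rfl P.nonempty hb, ?_, rfl⟩, ?_⟩
  · intro y hy
    refine csSup_le (P.nonempty.image _) ?_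
    rintro _ ⟨p, hp, rfl⟩
    have := inner_sub_le_conjOn hm hp hy
    change ⟪y, p⟫ - conjOn X φ₀ p ≤ _
    linarith
  · rintro _ ⟨φ, hφ, hle, rfl⟩
    obtain ⟨p, hpP, hp⟩ := hφ.exists_mem_subgrad x
    refine le_trans ?_ (le_csSup (hb x) ⟨p, hpP, rfl⟩)
    have h1 : conjOn X φ₀ p ≤ ⟪x, p⟫ - φ x := conjOn_le hX fun y hy => by
      have := mem_subgrad_iff.1 hp y
      linarith [hle y hy]
    change φ x ≤ ⟪x, p⟫ - conjOn X φ₀ p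
    linarith

lemma isPotential_convexEnvelope (hm : ∀ x, m ≤ φ₀ x - supportFun P x) (hX : X.Nonempty) :
    IsPotential P (convexEnvelope P X φ₀) := by
  rw [convexEnvelope_eq hm hX]
  exact isPotential_sSup subset_rfl P.nonempty (bddAbove_inner_sub_conjOn hm hX)

lemma convexEnvelope_le (hm : ∀ x, m ≤ φ₀ x - supportFun P x) {x : Rn n} (hx : x ∈ X) :
    convexEnvelope P X φ₀ x ≤ φ₀ x := by
  rw [convexEnvelope_eq hm ⟨x, hx⟩]
  refine csSup_le (P.nonempty.image _) ?_
  rintro _ ⟨p, hp, rfl⟩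
  have := inner_sub_le_conjOn hm hp hx
  change ⟪x, p⟫ - conjOn X φ₀ p ≤ _
  linarith

lemma inner_sub_convexEnvelope_le (hm : ∀ x, m ≤ φ₀ x - supportFun P x) (hX : X.Nonempty)
    {p : Rn n} (hp : p ∈ P) (x : Rn n) :
    ⟪x, p⟫ - convexEnvelope P X φ₀ x ≤ conjOn X φ₀ p := by
  have h := le_csSup (bddAbove_inner_sub_conjOn hm hX x) ⟨p, hp, rfl⟩
  rw [convexEnvelope_eq hm hX]
  change ⟪x, p⟫ - conjOn X φ₀ p ≤ _ at h
  linarith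

/-- Every `p ∈ P` is a subgradient of the envelope at a contact point with `φ₀` in `X`. -/
lemma exists_contact (hw : IsCoerciveWeight P μ₀ φ₀) (hm : ∀ x, m ≤ φ₀ x - supportFun P x)
    (hX : IsClosed X) (hne : X.Nonempty) {p : Rn n} (hp : p ∈ P) :
    ∃ x ∈ X, convexEnvelope P X φ₀ x = φ₀ x ∧ p ∈ subgrad (convexEnvelope P X φ₀) x := by
  obtain ⟨x₀, hx₀⟩ := hne
  have hc : ContinuousOn (fun x => φ₀ x - ⟪x, p⟫) X := by
    have := hw.continuous
    fun_prop
  obtain ⟨x, hx, hmin⟩ := hc.exists_isMinOn' hX hx₀ (by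
    refine Filter.Eventually.filter_mono inf_le_left ?_
    filter_upwards [hw.coercive.eventually_ge_atTop (φ₀ x₀ - ⟪x₀, p⟫)] with y hy
    linarith [inner_le_supportFun hp y])
  have h1 : conjOn X φ₀ p ≤ ⟪x, p⟫ - φ₀ x := conjOn_le ⟨x, hx⟩ fun y hy => by
    have : φ₀ x - ⟪x, p⟫ ≤ φ₀ y - ⟪y, p⟫ := hmin hy
    linarith
  have h2 := inner_sub_convexEnvelope_le hm ⟨x, hx⟩ hp (φ₀ := φ₀)
  have h3 := convexEnvelope_le hm hx
  refine ⟨x, hx, le_antisymm h3 (by linarith [h2 x]), mem_subgrad_iff.2 fun y => ?_⟩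
  linarith [h2 y]

/-- The Monge–Ampère measure of the convex envelope is the unique minimizer of the transport
cost. -/
theorem exists_minimizer_transportCost (hP : volume (P : Set (Rn n)) = 1)
    (hw : IsCoerciveWeight P μ₀ φ₀) (hμ₀ : μ₀ ≠ 0) :
    ∃ μ : ProbOn μ₀.support, IsMongeAmpere (convexEnvelope P μ₀.support φ₀) μ.meas ∧
      ∃ C : ℝ, freeEnergy P μ₀ φ₀ ⊤ μ = C ∧ ∀ ν, ν ≠ μ → (C : EReal) < freeEnergy P μ₀ φ₀ ⊤ ν := by
  have := isProbabilityMeasure_unif hP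
  obtain ⟨m, hm⟩ := hw.exists_le
  have hne : μ₀.support.Nonempty := Measure.nonempty_support hμ₀
  set f := convexEnvelope P μ₀.support φ₀ with hf
  have hpot : IsPotential P f := isPotential_convexEnvelope hm hne
  have hfc := hpot.continuous
  have hsub : Continuous fun x => φ₀ x - f x := hw.continuous.sub hfc
  have hbound : ∀ p ∈ P, ∀ x, ⟪x, p⟫ - f x ≤ -m := fun p hp x =>
    (inner_sub_convexEnvelope_le hm hne hp x).trans (conjOn_le hne fun y _ => inner_sub_le hm hp y)
  have hD : ∀ᵐ p ∂unif P, p ∈ conjDomain f := by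
    filter_upwards [ae_unif_mem P] with p hp
    exact mem_conjDomain (hbound p hp)
  have hk : Integrable (conj f) (unif P) := by
    refine (integrable_const (|m| + |f 0|)).mono' (measurable_conj f).aestronglyMeasurable ?_
    filter_upwards [ae_unif_mem P, hD] with p hp hpD
    have h1 := conj_le (hbound p hp)
    have h2 := le_conj hpD 0
    rw [inner_zero_left, zero_sub] at h2
    rw [Real.norm_eq_abs, abs_le]
    constructor <;> linarith [neg_abs_le m, le_abs_self (f 0), abs_nonneg m, abs_nonneg (f 0)]
  have hT := measurable_conjGrad f
  -- almost every gradient of the Legendre transform is a contact point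
  have hcontact : ∀ᵐ p ∂unif P,
      conjGrad f p ∈ μ₀.support ∧ f (conjGrad f p) = φ₀ (conjGrad f p) := by
    filter_upwards [ae_unif_mem P, ae_mem_subgrad_iff hfc hD] with p hp hiff
    obtain ⟨x, hx, hfx, hpx⟩ := exists_contact hw hm Measure.isClosed_support hne hp
    rw [← (hiff x).1 hpx]
    exact ⟨hx, hfx⟩
  obtain ⟨μ, hμ⟩ : ∃ μ : ProbOn μ₀.support, (unif P).map (conjGrad f) = μ.meas := by
    refine ⟨⟨⟨(unif P).map (conjGrad f),
      Measure.isProbabilityMeasure_map hT.aemeasurable⟩, ?_⟩, rfl⟩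
    change (unif P).map (conjGrad f) _ = 0
    rw [Measure.map_apply hT Measure.isClosed_support.measurableSet.compl]
    exact measure_mono_null (fun p hp => fun h => hp h.1) hcontact
  have hzero : ∀ᵐ x ∂μ.meas, φ₀ x - f x = 0 := by
    rw [← hμ, ae_map_iff hT.aemeasurable (measurableSet_eq_fun hsub.measurable measurable_const)]
    filter_upwards [hcontact] with p hp
    rw [hp.2, sub_self]
  have hi0 : Integrable (fun x => φ₀ x - f x) μ.meas :=
    (integrable_congr hzero).2 (integrable_zero _ _ _)
  have hup : transportCost P φ₀ μ.meas ≤ ((-∫ p, conj f p ∂unif P : ℝ) : EReal) := by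
    have h := transportCost_map_conjGrad_le hw.continuous hfc hD hk hμ hi0
    rw [integral_congr_ae hzero] at h
    simpa using h
  have hνa : ∀ ν : ProbOn μ₀.support, ∀ᵐ x ∂ν.meas, 0 ≤ φ₀ x - f x := fun ν => by
    have h0 : μ₀.support ∈ ae ν.meas := by
      rw [mem_ae_iff]; exact ν.2
    filter_upwards [h0] with x hx
    exact sub_nonneg.2 (convexEnvelope_le hm hx)
  have hlow : ∀ ν : ProbOn μ₀.support,
      ((-∫ p, conj f p ∂unif P : ℝ) : EReal) ≤ transportCost P φ₀ ν.meas := fun ν => by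
    refine le_transportCost hw fun G hG hi => ?_
    obtain ⟨-, -, h3, h4⟩ := hG.weak_duality hw.continuous hfc hD hk (hνa ν) hi
    rw [h3]
    linarith [integral_nonneg_of_ae h4, integral_nonneg_of_ae (hνa ν)]
  refine ⟨μ, hμ ▸ isMongeAmpere_map_conjGrad hfc hpot.2 hD, -∫ p, conj f p ∂unif P, ?_, ?_⟩
  · rw [freeEnergy_top]
    exact le_antisymm hup (hlow μ)
  intro ν hν
  rw [freeEnergy_top]
  refine lt_of_le_of_ne (hlow ν) fun heq => hν ?_
  -- an optimal coupling without duality gap is carried by the graph of the gradient map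
  obtain ⟨G, hG, hi, hle⟩ : ∃ G, IsCoupling P ν.meas G ∧ Integrable (cost φ₀) G ∧
      ∫ z, cost φ₀ z ∂G ≤ -∫ p, conj f p ∂unif P := exists_optimal_coupling hP hw heq.ge
  obtain ⟨h1, h2, h3, h4⟩ := hG.weak_duality hw.continuous hfc hD hk (hνa ν) hi
  have h5 : ∫ z, (f z.1 + conj f z.2 - ⟪z.1, z.2⟫) ∂G = 0 := by
    have := integral_nonneg_of_ae h4
    have := integral_nonneg_of_ae (hνa ν)
    linarith
  have hgi : Integrable (fun z : Rn n × Rn n => f z.1 + conj f z.2 - ⟪z.1, z.2⟫) G := by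
    have h6 : Integrable (fun z : Rn n × Rn n => φ₀ z.1 - f z.1) G := by
      have := h1
      rw [← hG.1, integrable_map_measure hsub.aestronglyMeasurable
        measurable_fst.aemeasurable] at this
      exact this
    refine ((hi.add h2).sub h6).congr (Eventually.of_forall fun z => ?_)
    simp only [Pi.sub_apply, Pi.add_apply, cost]
    ring
  have h6 := (integral_eq_zero_iff_of_nonneg_ae h4 hgi).1 h5
  have hgraph : (Prod.fst : Rn n × Rn n → Rn n) =ᵐ[G] conjGrad f ∘ Prod.snd := by
    filter_upwards [h6, hG.ae_snd hD, hG.ae_snd (ae_mem_subgrad_iff hfc hD)] with z hz hzD hiff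
    refine (hiff z.1).1 (mem_subgrad_iff.2 fun y => ?_)
    have := le_conj hzD y
    simp only [Pi.zero_apply] at hz
    linarith
  have hmeas : ν.meas = μ.meas := by
    rw [← hμ, ← hG.1, ← hG.2, Measure.map_map hT measurable_snd]
    exact Measure.map_congr hgraph
  exact Subtype.ext (Subtype.ext hmeas)

end Envelope

/-! ### Existence for the Monge–Ampère equation by minimization -/

section Existence

/-- Sequences of normalized potentials have pointwise convergent subsequences: a diagonal argument
on a dense sequence, since potentials are uniformly Lipschitz. -/
lemma exists_subseq_tendsto_potential {φ : ℕ → Rn n → ℝ} (hφ : ∀ j, IsPotential P (φ j))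
    (h0 : ∀ j, φ j 0 = 0) :
    ∃ (ψ : Rn n → ℝ) (s : ℕ → ℕ), StrictMono s ∧ IsPotential P ψ ∧ ψ 0 = 0 ∧
      ∀ x, Tendsto (fun j => φ (s j) x) atTop (𝓝 (ψ x)) := by
  obtain ⟨R, hR0, hR⟩ := exists_norm_le_of_mem P
  have hlip : ∀ j x y, |φ j x - φ j y| ≤ R * ‖x - y‖ := fun j =>
    abs_sub_le_of_sub_le_supportFun hR (hφ j).sub_le
  let D := TopologicalSpace.denseSeq (Rn n)
  have hcomp : IsCompact (Set.pi univ fun i : ℕ => Icc (-(R * ‖D i‖)) (R * ‖D i‖)) :=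
    isCompact_univ_pi fun i => isCompact_Icc
  obtain ⟨v, -, s, hs, hv⟩ := hcomp.tendsto_subseq (x := fun j i => φ j (D i)) (by
    intro j i _
    have := hlip j (D i) 0
    rw [h0, sub_zero, sub_zero] at this
    exact abs_le.1 this)
  rw [tendsto_pi_nhds] at hv
  have hcauchy : ∀ x, ∃ a, Tendsto (fun j => φ (s j) x) atTop (𝓝 a) := by
    intro x
    refine cauchySeq_tendsto_of_complete (Metric.cauchySeq_iff'.2 fun ε hε => ?_)
    obtain ⟨y, hi, i, rfl⟩ := Metric.dense_iff.1 (TopologicalSpace.denseRange_denseSeq (Rn n)) x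
      (ε / (4 * R)) (by positivity)
    obtain ⟨N, hN⟩ := Metric.cauchySeq_iff'.1 (hv i).cauchySeq (ε / 4) (by positivity)
    refine ⟨N, fun k hk => ?_⟩
    have h1 := hN k hk
    simp only [Function.comp, Real.dist_eq] at h1 ⊢
    have h2 := hlip (s k) x (D i)
    have h3 := hlip (s N) (D i) x
    have h4 : R * ‖x - D i‖ < ε / 4 := by
      have : ‖x - D i‖ < ε / (4 * R) := by
        rw [← dist_eq_norm, dist_comm]; exact hi
      rw [lt_div_iff₀ (by positivity)] at this
      linarith
    have h5 : ‖D i - x‖ = ‖x - D i‖ := norm_sub_rev _ _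
    rw [h5] at h3
    calc |φ (s k) x - φ (s N) x| = |(φ (s k) x - φ (s k) (D i)) + (φ (s k) (D i) - φ (s N) (D i))
          + (φ (s N) (D i) - φ (s N) x)| := by congr 1; ring
      _ ≤ _ := (abs_add_le _ _).trans (add_le_add (abs_add_le _ _) le_rfl)
      _ < ε := by linarith
  choose ψ hψ using hcauchy
  refine ⟨ψ, s, hs, isPotential_of_sub_le ⟨convex_univ, ?_⟩ ?_, ?_, hψ⟩
  · intro x _ y _ a b ha hb hab
    exact le_of_tendsto_of_tendsto' (hψ _) (((hψ x).const_smul a).add ((hψ y).const_smul b))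
      fun j => (hφ (s j)).1.2 (mem_univ x) (mem_univ y) ha hb hab
  · intro x y
    exact le_of_tendsto' ((hψ y).sub (hψ x)) fun j => (hφ (s j)).sub_le x y
  · exact tendsto_nhds_unique (hψ 0) (by simp [h0])

lemma integral_exp_add_const {φ : Rn n → ℝ} (β c : ℝ) :
    ∫ x, Real.exp (β * (φ x + c - φ₀ x)) ∂μ₀ =
      Real.exp (β * c) * ∫ x, Real.exp (β * (φ x - φ₀ x)) ∂μ₀ := by
  rw [← integral_const_mul]
  congr 1; ext x
  rw [← Real.exp_add]; congr 1; ring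

variable {β : ℝ}

/-- A function `k` that dominates the Legendre transform of `f` almost everywhere on `P`. -/
def DominatesConj (P : ConvexBody (Rn n)) (f k : Rn n → ℝ) : Prop :=
  Integrable k (unif P) ∧ ∀ᵐ p ∂unif P, ∀ x, ⟪x, p⟫ - f x ≤ k p

/-- The functional `∫_P φ* dp + β⁻¹ log ∫ e^{β(φ - φ₀)} dμ₀`, dual to the free energy, has a
minimizer among potentials. In its first term `φ*` may be replaced by any function that
dominates it. -/
theorem exists_minimizing_potential (hP : volume (P : Set (Rn n)) = 1)
    (hw : IsCoerciveWeight P μ₀ φ₀) (hμ₀ : μ₀ ≠ 0) (hβ : 0 < β) :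
    ∃ φ, IsPotential P φ ∧ (∀ᵐ p ∂unif P, p ∈ conjDomain φ) ∧ Integrable (conj φ) (unif P) ∧
      ∀ ψ k, IsPotential P ψ → DominatesConj P ψ k →
        ∫ p, conj φ p ∂unif P + 1 / β * Real.log (∫ x, Real.exp (β * (φ x - φ₀ x)) ∂μ₀) ≤
        ∫ p, k p ∂unif P + 1 / β * Real.log (∫ x, Real.exp (β * (ψ x - φ₀ x)) ∂μ₀) := by
  have := isProbabilityMeasure_unif hP
  have : NeZero μ₀ := ⟨hμ₀⟩
  set Z : (Rn n → ℝ) → ℝ := fun ψ => ∫ x, Real.exp (β * (ψ x - φ₀ x)) ∂μ₀ with hZ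
  have hZpos : ∀ ψ, IsPotential P ψ → 0 < Z ψ := fun ψ hψ =>
    integral_exp_pos (hψ.integrable_exp hw hβ)
  let A : Set ℝ := {a | ∃ ψ k, IsPotential P ψ ∧ ψ 0 = 0 ∧ DominatesConj P ψ k ∧
    a = ∫ p, k p ∂unif P + 1 / β * Real.log (Z ψ)}
  have hsupp : IsPotential P (supportFun P) := by
    refine isPotential_of_sub_le ⟨convex_univ, ?_⟩ supportFun_sub_le
    intro x _ y _ a b ha hb hab
    refine supportFun_le fun p hp => ?_
    rw [inner_add_left, real_inner_smul_left, real_inner_smul_left]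
    exact add_le_add (mul_le_mul_of_nonneg_left (inner_le_supportFun hp x) ha)
      (mul_le_mul_of_nonneg_left (inner_le_supportFun hp y) hb)
  have hAne : A.Nonempty := by
    refine ⟨_, supportFun P, fun _ => 0, hsupp, supportFun_zero, ⟨integrable_const _, ?_⟩, rfl⟩
    filter_upwards [ae_unif_mem P] with p hp x
    linarith [inner_le_supportFun hp x]
  -- potentials vanishing at the origin are bounded below by `-φ_P(-x)`
  have hknn : ∀ ψ k, ψ 0 = 0 → DominatesConj P ψ k → 0 ≤ᵐ[unif P] k := by
    intro ψ k hψ0 hk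
    filter_upwards [hk.2] with p hp
    simpa [hψ0] using hp 0
  have hAbdd : BddBelow A := by
    have hmin : Integrable (fun x => Real.exp (β * (-supportFun P (-x) - φ₀ x))) μ₀ := by
      refine (hw.integrable_exp hβ).mono' ?_ (Eventually.of_forall fun x => ?_)
      · have h1 := hw.continuous
        have h2 := continuous_supportFun (P := P)
        exact (by fun_prop : Continuous fun x =>
          Real.exp (β * (-supportFun P (-x) - φ₀ x))).aestronglyMeasurable
      · rw [Real.norm_eq_abs, abs_of_pos (Real.exp_pos _), Real.exp_le_exp]
        have := supportFun_add_le (P := P) x (-x)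
        rw [add_neg_cancel, supportFun_zero] at this
        refine mul_le_mul_of_nonneg_left ?_ hβ.le
        linarith
    refine ⟨1 / β * Real.log (∫ x, Real.exp (β * (-supportFun P (-x) - φ₀ x)) ∂μ₀), ?_⟩
    rintro _ ⟨ψ, k, hψ, hψ0, hk, rfl⟩
    have h1 : 0 ≤ ∫ p, k p ∂unif P := integral_nonneg_of_ae (hknn ψ k hψ0 hk)
    have h2 : ∫ x, Real.exp (β * (-supportFun P (-x) - φ₀ x)) ∂μ₀ ≤ Z ψ := by
      refine integral_mono hmin (hψ.integrable_exp hw hβ) fun x => ?_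
      have := hψ.sub_le x 0
      rw [hψ0, zero_sub, zero_sub] at this
      refine Real.exp_le_exp.2 (mul_le_mul_of_nonneg_left ?_ hβ.le)
      linarith
    have h3 := Real.log_le_log (integral_exp_pos hmin) h2
    have h4 : 0 ≤ 1 / β := by positivity
    nlinarith
  obtain ⟨a, -, ha, haA⟩ := exists_seq_tendsto_sInf hAne hAbdd
  choose ψ k hψ hψ0 hk hak using haA
  obtain ⟨φ, s, hs, hφ, hφ0, hlim⟩ := exists_subseq_tendsto_potential hψ hψ0
  have hZlim : Tendsto (fun j => Z (ψ (s j))) atTop (𝓝 (Z φ)) := by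
    refine tendsto_integral_of_dominated_convergence _
      (fun j => ((hψ (s j)).integrable_exp hw hβ).1) (hw.integrable_exp hβ)
      (fun j => Eventually.of_forall fun x => ?_) (Eventually.of_forall fun x => ?_)
    · rw [Real.norm_eq_abs, abs_of_pos (Real.exp_pos _), Real.exp_le_exp]
      have := (hψ (s j)).sub_le 0 x
      rw [hψ0, sub_zero, sub_zero] at this
      refine mul_le_mul_of_nonneg_left ?_ hβ.le
      linarith
    · exact (Real.continuous_exp.tendsto _).comp (((hlim x).sub_const _).const_mul β)
  set b := sInf A - 1 / β * Real.log (Z φ) with hb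
  have hklim : Tendsto (fun j => ∫ p, k (s j) p ∂unif P) atTop (𝓝 b) := by
    have h1 : Tendsto (fun j => a (s j) - 1 / β * Real.log (Z (ψ (s j)))) atTop (𝓝 b) :=
      (ha.comp hs.tendsto_atTop).sub
        (((Real.continuousAt_log (hZpos φ hφ).ne').tendsto.comp hZlim).const_mul _)
    refine h1.congr fun j => ?_
    rw [hak]; ring
  have hb0 : 0 ≤ b := ge_of_tendsto' hklim fun j =>
    integral_nonneg_of_ae (hknn _ _ (hψ0 _) (hk _))
  -- Fatou's lemma for the first term
  set g : Rn n → ℝ≥0∞ := fun p => liminf (fun j => ENNReal.ofReal (k (s j) p)) atTop with hg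
  have hgm : AEMeasurable g (unif P) := by
    have hm : ∀ j, AEMeasurable (fun p => ENNReal.ofReal (k (s j) p)) (unif P) := fun j =>
      (hk (s j)).1.1.aemeasurable.ennreal_ofReal
    refine ⟨_, Measurable.liminf fun j => (hm j).measurable_mk, ?_⟩
    filter_upwards [ae_all_iff.2 fun j => (hm j).ae_eq_mk] with p hp
    simp only [hg, hp]
  have hgint : ∫⁻ p, g p ∂unif P ≤ ENNReal.ofReal b := by
    refine (lintegral_liminf_le' fun j => (hk (s j)).1.1.aemeasurable.ennreal_ofReal).trans ?_
    have h1 : ∀ j, ∫⁻ p, ENNReal.ofReal (k (s j) p) ∂unif P =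
        ENNReal.ofReal (∫ p, k (s j) p ∂unif P) := fun j =>
      (ofReal_integral_eq_lintegral_ofReal (hk (s j)).1 (hknn _ _ (hψ0 _) (hk _))).symm
    simp_rw [h1]
    exact (ENNReal.tendsto_ofReal hklim).liminf_eq.le
  have hgfin : ∀ᵐ p ∂unif P, g p < ∞ :=
    ae_lt_top' hgm (hgint.trans_lt ENNReal.ofReal_lt_top).ne
  have hdom : ∀ᵐ p ∂unif P, ∀ x, ⟪x, p⟫ - φ x ≤ (g p).toReal := by
    filter_upwards [hgfin, ae_all_iff.2 fun j => (hk (s j)).2] with p hp hkp x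
    rw [← ENNReal.ofReal_le_iff_le_toReal hp.ne]
    have h1 : Tendsto (fun j => ENNReal.ofReal (⟪x, p⟫ - ψ (s j) x)) atTop
        (𝓝 (ENNReal.ofReal (⟪x, p⟫ - φ x))) :=
      ENNReal.tendsto_ofReal (tendsto_const_nhds.sub (hlim x))
    rw [← h1.liminf_eq]
    exact liminf_le_liminf (Eventually.of_forall fun j => ENNReal.ofReal_le_ofReal (hkp j x))
  have hD : ∀ᵐ p ∂unif P, p ∈ conjDomain φ := hdom.mono fun p hp => mem_conjDomain hp
  have hgi : Integrable (fun p => (g p).toReal) (unif P) :=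
    integrable_toReal_of_lintegral_ne_top hgm (hgint.trans_lt ENNReal.ofReal_lt_top).ne
  have hcle : ∀ᵐ p ∂unif P, conj φ p ≤ (g p).toReal := hdom.mono fun p hp => conj_le hp
  have hci : Integrable (conj φ) (unif P) := by
    refine hgi.mono' (measurable_conj φ).aestronglyMeasurable ?_
    filter_upwards [hD, hcle] with p h1 h2
    have h3 := le_conj h1 0
    rw [inner_zero_left, hφ0, sub_zero] at h3
    rwa [Real.norm_eq_abs, abs_of_nonneg h3]
  have hcint : ∫ p, conj φ p ∂unif P ≤ b := by
    refine (integral_mono_ae hci hgi hcle).trans ?_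
    rw [integral_toReal hgm hgfin]
    exact ENNReal.toReal_le_of_le_ofReal hb0 hgint
  refine ⟨φ, hφ, hD, hci, fun χ l hχ hl => ?_⟩
  have hZχ : Z (fun x => χ x + -χ 0) = Real.exp (β * -χ 0) * Z χ :=
    integral_exp_add_const β (-χ 0)
  have hmem : ∫ p, l p ∂unif P + 1 / β * Real.log (Z χ) ∈ A := by
    refine ⟨fun x => χ x + -χ 0, fun p => l p + χ 0, hχ.add_const _, by simp,
      ⟨hl.1.add (integrable_const _), ?_⟩, ?_⟩
    · filter_upwards [hl.2] with p hp x
      linarith [hp x]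
    · rw [integral_add hl.1 (integrable_const _), hZχ,
        Real.log_mul (Real.exp_pos _).ne' (hZpos χ hχ).ne', Real.log_exp]
      simp only [integral_const, probReal_univ, one_smul]
      field_simp
      ring
  have := csInf_le hAbdd hmem
  simp only [hZ] at hb this ⊢
  linarith

/-- The minimality of `φ` extends to functions that are not potentials: their biconjugate is a
smaller potential. -/
lemma minimizing_of_dominatesConj (hP : volume (P : Set (Rn n)) = 1)
    (hw : IsCoerciveWeight P μ₀ φ₀) (hμ₀ : μ₀ ≠ 0) (hβ : 0 < β) {I : ℝ}
    (hmin : ∀ ψ k, IsPotential P ψ → DominatesConj P ψ k →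
      I ≤ ∫ p, k p ∂unif P + 1 / β * Real.log (∫ x, Real.exp (β * (ψ x - φ₀ x)) ∂μ₀))
    {f k : Rn n → ℝ} (hf : Integrable (fun x => Real.exp (β * (f x - φ₀ x))) μ₀)
    (hk : DominatesConj P f k) :
    I ≤ ∫ p, k p ∂unif P + 1 / β * Real.log (∫ x, Real.exp (β * (f x - φ₀ x)) ∂μ₀) := by
  have := isProbabilityMeasure_unif hP
  have : NeZero μ₀ := ⟨hμ₀⟩
  set S : Set (Rn n) := {p | p ∈ P ∧ ∀ x, ⟪x, p⟫ - f x ≤ k p} with hS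
  have hSae : ∀ᵐ p ∂unif P, p ∈ S := by
    filter_upwards [ae_unif_mem P, hk.2] with p h1 h2 using ⟨h1, h2⟩
  have hSne : S.Nonempty := hSae.exists
  have hle : ∀ x, ∀ p ∈ S, ⟪x, p⟫ - k p ≤ f x := fun x p hp => by linarith [hp.2 x]
  have hb : ∀ x, BddAbove ((fun p => ⟪x, p⟫ - k p) '' S) := by
    intro x
    refine ⟨f x, ?_⟩
    rintro _ ⟨p, hp, rfl⟩
    exact hle x p hp
  have hψ := isPotential_sSup (P := P) (S := S) (fun p hp => hp.1) hSne hb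
  refine (hmin _ k hψ ⟨hk.1, ?_⟩).trans ?_
  · filter_upwards [hSae] with p hp x
    have : ⟪x, p⟫ - k p ≤ sSup ((fun p => ⟪x, p⟫ - k p) '' S) := le_csSup (hb x) ⟨p, hp, rfl⟩
    linarith
  · have hψf : ∀ x, sSup ((fun p => ⟪x, p⟫ - k p) '' S) ≤ f x := by
      intro x
      refine csSup_le (hSne.image _) ?_
      rintro _ ⟨p, hp, rfl⟩
      exact hle _ p hp
    refine add_le_add le_rfl (mul_le_mul_of_nonneg_left (Real.log_le_log
      (integral_exp_pos (hψ.integrable_exp hw hβ))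
      (integral_mono (hψ.integrable_exp hw hβ) hf fun x => ?_)) (by positivity))
    have := hψf x
    simp only
    gcongr

/-- The derivative of the Legendre transform of `φ + t u` in `t` is `-u` at the gradient
(the envelope theorem). -/
lemma tendsto_conj_add_smul {φ u : Rn n → ℝ} {B : ℝ} (hφ : Continuous φ) (hu : Continuous u)
    (hB : ∀ x, |u x| ≤ B) {p y : Rn n} (hp : p ∈ interior (conjDomain φ))
    (hy : ∀ x, p ∈ subgrad φ x ↔ x = y) :
    Tendsto (fun t : ℝ => (conj (fun x => φ x + t * u x) p - conj φ p) / t) (𝓝[>] 0)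
      (𝓝 (-u y)) := by
  have hB0 : 0 ≤ B := (abs_nonneg _).trans (hB 0)
  have hpy : p ∈ subgrad φ y := (hy y).2 rfl
  have hcy := conj_eq_of_mem_subgrad hpy
  have hpD := interior_subset hp
  have hdom : ∀ t : ℝ, 0 < t → p ∈ conjDomain fun x => φ x + t * u x := fun t ht =>
    mem_conjDomain (a := conj φ p + t * B) fun x => by
      have := le_conj hpD x
      nlinarith [neg_le_of_abs_le (hB x)]
  rw [Metric.tendsto_nhds]
  intro ε hε
  -- away from the level set of `u(y)` the affine function `⟨·, p⟩ - φ` stays below its maximum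
  obtain ⟨η, hη, hgap⟩ : ∃ η > 0, ∀ x, ε / 2 ≤ |u x - u y| → ⟪x, p⟫ - φ x ≤ conj φ p - η := by
    have hK : IsClosed {x | ε / 2 ≤ |u x - u y|} :=
      isClosed_le continuous_const (hu.sub continuous_const).abs
    rcases eq_empty_or_nonempty {x | ε / 2 ≤ |u x - u y|} with hemp | ⟨x₀, hx₀⟩
    · refine ⟨1, one_pos, fun x hx => ?_⟩
      have : x ∈ {x | ε / 2 ≤ |u x - u y|} := hx
      rw [hemp] at this
      exact this.elim
    · have hc : ContinuousOn (fun x => φ x - ⟪x, p⟫) {x | ε / 2 ≤ |u x - u y|} := by fun_prop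
      obtain ⟨x₁, hx₁, hmin⟩ := hc.exists_isMinOn' hK hx₀
        (Filter.Eventually.filter_mono inf_le_left
          ((tendsto_sub_inner_cocompact hp).eventually_ge_atTop _))
      have hne : ⟪x₁, p⟫ - φ x₁ < conj φ p := by
        refine lt_of_le_of_ne (le_conj hpD x₁) fun heq => ?_
        have : x₁ = y := (hy x₁).1 (mem_subgrad_iff.2 fun z => heq ▸ le_conj hpD z)
        rw [this] at hx₁
        simp only [sub_self, abs_zero, mem_ofPred_eq] at hx₁
        linarith
      refine ⟨conj φ p - (⟪x₁, p⟫ - φ x₁), by linarith, fun x hx => ?_⟩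
      have : φ x₁ - ⟪x₁, p⟫ ≤ φ x - ⟪x, p⟫ := hmin hx
      linarith
  have hsmall : ∀ᶠ t : ℝ in 𝓝[>] 0, t ∈ Ioo 0 (η / (2 * B + 1)) :=
    Ioo_mem_nhdsGT (by positivity)
  filter_upwards [hsmall] with t ⟨ht0, ht⟩
  rw [lt_div_iff₀ (by positivity)] at ht
  have hlow := le_conj (hdom t ht0) y
  have hup : conj (fun x => φ x + t * u x) p ≤ conj φ p - t * u y + t * (ε / 2) := by
    refine conj_le fun x => ?_
    by_cases hx : ε / 2 ≤ |u x - u y|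
    · have h1 := hgap x hx
      have h2 := neg_le_of_abs_le (hB x)
      have h3 := le_of_abs_le (hB y)
      nlinarith [mul_pos ht0 hε]
    · have h1 := le_conj hpD x
      have h2 := (abs_lt.1 (not_le.1 hx)).1
      nlinarith
  rw [Real.dist_eq, abs_lt]
  have h1 : conj (fun x => φ x + t * u x) p - conj φ p ≥ t * (-u y) := by linarith
  have h2 : conj (fun x => φ x + t * u x) p - conj φ p ≤ t * (-u y + ε / 2) := by linarith
  constructor
  · have : -u y ≤ (conj (fun x => φ x + t * u x) p - conj φ p) / t := by
      rw [le_div_iff₀ ht0]; linarith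
    linarith
  · have : (conj (fun x => φ x + t * u x) p - conj φ p) / t ≤ -u y + ε / 2 := by
      rw [div_le_iff₀ ht0]; linarith
    linarith

end Existence

/-! ### The Euler–Lagrange equation of the minimizer -/

section EulerLagrange

open ProbabilityTheory

lemma hasDerivAt_cgf_zero {m : Measure (Rn n)} [IsFiniteMeasure m] {u : Rn n → ℝ}
    (hm : m ≠ 0) {B : ℝ} (hu : Continuous u) (hB : ∀ x, |u x| ≤ B) :
    HasDerivAt (cgf u m) ((∫ x, u x ∂m) / m.real univ) 0 := by
  have hset : integrableExpSet u m = univ := by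
    ext t
    simp only [mem_univ, iff_true]
    exact integrable_exp_mul_of_mem_Icc (a := -B) (b := B) hu.measurable.aemeasurable
      (Eventually.of_forall fun x => abs_le.1 (hB x))
  have h0 : (0 : ℝ) ∈ interior (integrableExpSet u m) := by simp [hset]
  have h1 := (hasDerivAt_mgf h0).log (mgf_pos' hm (show Integrable _ m from by
    have h2 := interior_subset h0
    exact h2)).ne'
  simp only [zero_mul, Real.exp_zero, mul_one, mgf_zero'] at h1
  exact h1

variable {β : ℝ} {φ : Rn n → ℝ}

lemma IsPotential.measurable_exp (hw : IsCoerciveWeight P μ₀ φ₀) (hφ : IsPotential P φ) :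
    Measurable fun x => ENNReal.ofReal (Real.exp (β * (φ x - φ₀ x))) :=
  (Real.continuous_exp.comp
    ((hφ.continuous.sub hw.continuous).const_mul β)).measurable.ennreal_ofReal

lemma IsPotential.isFiniteMeasure_expMeasure (hw : IsCoerciveWeight P μ₀ φ₀) (hβ : 0 < β)
    (hφ : IsPotential P φ) : IsFiniteMeasure (expMeasure μ₀ φ₀ β φ) := by
  refine ⟨?_⟩
  rw [withDensity_apply _ MeasurableSet.univ, setLIntegral_univ]
  exact (hφ.integrable_exp hw hβ).lintegral_lt_top

lemma IsPotential.expMeasure_ne_zero (hw : IsCoerciveWeight P μ₀ φ₀) (hμ₀ : μ₀ ≠ 0)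
    (hφ : IsPotential P φ) : expMeasure μ₀ φ₀ β φ ≠ 0 := by
  intro h0
  rw [withDensity_eq_zero_iff (hφ.measurable_exp hw).aemeasurable] at h0
  have : NeZero μ₀ := ⟨hμ₀⟩
  obtain ⟨x, hx⟩ := h0.exists
  simp only [Pi.zero_apply, ENNReal.ofReal_eq_zero, not_le.2 (Real.exp_pos _)] at hx

/-- One-sided first variation of the functional at a minimizer `φ` in the direction `u`. -/
lemma integral_comp_conjGrad_le (hP : volume (P : Set (Rn n)) = 1)
    (hw : IsCoerciveWeight P μ₀ φ₀) (hμ₀ : μ₀ ≠ 0) (hβ : 0 < β) (hφ : IsPotential P φ)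
    (hD : ∀ᵐ p ∂unif P, p ∈ conjDomain φ) (hci : Integrable (conj φ) (unif P))
    (hmin : ∀ ψ k, IsPotential P ψ → DominatesConj P ψ k →
        ∫ p, conj φ p ∂unif P + 1 / β * Real.log (∫ x, Real.exp (β * (φ x - φ₀ x)) ∂μ₀) ≤
        ∫ p, k p ∂unif P + 1 / β * Real.log (∫ x, Real.exp (β * (ψ x - φ₀ x)) ∂μ₀))
    {u : Rn n → ℝ} {B : ℝ} (hu : Continuous u) (hB : ∀ x, |u x| ≤ B) :
    ∫ p, u (conjGrad φ p) ∂unif P ≤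
      (∫ x, u x ∂expMeasure μ₀ φ₀ β φ) / (expMeasure μ₀ φ₀ β φ).real univ := by
  have := isProbabilityMeasure_unif hP
  set m := expMeasure μ₀ φ₀ β φ with hm
  have hint : ∀ g : Rn n → ℝ, ∫ x, g x ∂m = ∫ x, Real.exp (β * (φ x - φ₀ x)) * g x ∂μ₀ := by
    intro g
    rw [hm, integral_withDensity_eq_integral_toReal_smul (hφ.measurable_exp hw)
      (Eventually.of_forall fun x => ENNReal.ofReal_lt_top)]
    simp [ENNReal.toReal_ofReal (Real.exp_pos _).le]
  have hmfin : IsFiniteMeasure m := hφ.isFiniteMeasure_expMeasure hw hβ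
  have hm0 : m ≠ 0 := hφ.expMeasure_ne_zero hw hμ₀
  have hZ : ∀ t : ℝ, cgf u m (β * t) =
      Real.log (∫ x, Real.exp (β * (φ x + t * u x - φ₀ x)) ∂μ₀) := by
    intro t
    rw [cgf, mgf, hint]
    congr 2; ext x
    rw [← Real.exp_add]; congr 1; ring
  have hfi : ∀ t : ℝ, Integrable (fun x => Real.exp (β * (φ x + t * u x - φ₀ x))) μ₀ := by
    intro t
    refine ((hφ.integrable_exp hw hβ).const_mul (Real.exp (β * (|t| * B)))).mono'
      ?_ (Eventually.of_forall fun x => ?_)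
    · have h1 := hφ.continuous
      have h2 := hw.continuous
      exact (by fun_prop : Continuous fun x =>
        Real.exp (β * (φ x + t * u x - φ₀ x))).aestronglyMeasurable
    · rw [Real.norm_eq_abs, abs_of_pos (Real.exp_pos _), ← Real.exp_add, Real.exp_le_exp,
        ← mul_add]
      have : t * u x ≤ |t| * B := (le_abs_self _).trans
        (abs_mul t (u x) ▸ mul_le_mul_of_nonneg_left (hB x) (abs_nonneg t))
      exact mul_le_mul_of_nonneg_left (by linarith) hβ.le
  -- the Legendre transforms of `φ + t u` and of `φ` differ by at most `t B`
  have hdiff : ∀ t : ℝ, 0 < t → ∀ p ∈ conjDomain φ, p ∈ conjDomain (fun x => φ x + t * u x) ∧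
      |conj (fun x => φ x + t * u x) p - conj φ p| ≤ t * B := by
    intro t ht p hp
    have hb : ∀ x, ⟪x, p⟫ - (φ x + t * u x) ≤ conj φ p + t * B := fun x => by
      have := le_conj hp x
      nlinarith [neg_le_of_abs_le (hB x)]
    have hd := mem_conjDomain (f := fun x => φ x + t * u x) hb
    refine ⟨hd, abs_le.2 ⟨?_, ?_⟩⟩
    · have : conj φ p ≤ conj (fun x => φ x + t * u x) p + t * B := conj_le fun x => by
        have := le_conj hd x
        nlinarith [le_of_abs_le (hB x)]
      linarith
    · have := conj_le (f := fun x => φ x + t * u x) hb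
      linarith
  have hct : ∀ t : ℝ, 0 < t → Integrable (fun p => conj (fun x => φ x + t * u x) p - conj φ p)
      (unif P) := by
    intro t ht
    refine (integrable_const (t * B)).mono'
      ((measurable_conj _).sub (measurable_conj φ)).aestronglyMeasurable ?_
    filter_upwards [hD] with p hp using (hdiff t ht p hp).2
  have hkey : ∀ t : ℝ, 0 < t →
      0 ≤ ∫ p, (conj (fun x => φ x + t * u x) p - conj φ p) / t ∂unif P +
        (cgf u m (β * t) - cgf u m 0) / (β * t) := by
    intro t ht
    have hk : Integrable (conj fun x => φ x + t * u x) (unif P) := by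
      refine ((hct t ht).add hci).congr (Eventually.of_forall fun p => ?_)
      simp
    have h1 := minimizing_of_dominatesConj hP hw hμ₀ hβ hmin (hfi t) ⟨hk, by
      filter_upwards [hD] with p hp x using le_conj (hdiff t ht p hp).1 x⟩
    have h2 := hZ 0
    simp only [mul_zero, zero_mul, add_zero] at h2
    rw [← hZ t, ← h2] at h1
    rw [integral_div, integral_sub hk hci]
    have h3 : 0 ≤ (∫ p, conj (fun x => φ x + t * u x) p ∂unif P - ∫ p, conj φ p ∂unif P +
      1 / β * (cgf u m (β * t) - cgf u m 0)) / t := div_nonneg (by linarith) ht.le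
    refine h3.trans_eq ?_
    field_simp
  have hlim1 : Tendsto (fun t : ℝ =>
      ∫ p, (conj (fun x => φ x + t * u x) p - conj φ p) / t ∂unif P) (𝓝[>] 0)
      (𝓝 (∫ p, -u (conjGrad φ p) ∂unif P)) := by
    refine tendsto_integral_filter_of_dominated_convergence (fun _ => B) ?_ ?_
      (integrable_const B) ?_
    · exact Eventually.of_forall fun t =>
        (((measurable_conj _).sub (measurable_conj φ)).div_const t).aestronglyMeasurable
    · filter_upwards [self_mem_nhdsWithin] with t ht
      filter_upwards [hD] with p hp
      rw [Real.norm_eq_abs, abs_div, abs_of_pos (mem_Ioi.1 ht), div_le_iff₀ (mem_Ioi.1 ht),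
        mul_comm]
      exact (hdiff t ht p hp).2
    · filter_upwards [ae_mem_interior P, ae_mem_subgrad_iff hφ.continuous hD] with p hp hT
      exact tendsto_conj_add_smul hφ.continuous hu hB
        (interior_subset_interior_conjDomain hD hp) hT
  have hlim2 : Tendsto (fun t : ℝ => (cgf u m (β * t) - cgf u m 0) / (β * t)) (𝓝[>] 0)
      (𝓝 ((∫ x, u x ∂m) / m.real univ)) := by
    have h1 := (hasDerivAt_cgf_zero hm0 hu hB).tendsto_slope
    have h2 : Tendsto (fun t : ℝ => β * t) (𝓝[>] 0) (𝓝[≠] 0) := by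
      refine tendsto_nhdsWithin_iff.2 ⟨?_, ?_⟩
      · have : Tendsto (fun t : ℝ => β * t) (𝓝 0) (𝓝 (β * 0)) :=
          (continuous_const_mul β).tendsto 0
        rw [mul_zero] at this
        exact this.mono_left nhdsWithin_le_nhds
      · filter_upwards [self_mem_nhdsWithin] with t ht
        exact (mul_pos hβ ht).ne'
    refine (h1.comp h2).congr fun t => ?_
    simp [slope_def_field]
  have := ge_of_tendsto (hlim1.add hlim2) (by
    filter_upwards [self_mem_nhdsWithin] with t ht using hkey t ht)
  rw [integral_neg] at this
  linarith

/-- Existence for the second boundary value problem `MA(φ) = e^{β(φ - φ₀)} μ₀`. -/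
theorem exists_isMASolution (hP : volume (P : Set (Rn n)) = 1)
    (hw : IsCoerciveWeight P μ₀ φ₀) (hμ₀ : μ₀ ≠ 0) (hβ : 0 < β) :
    ∃ φ, IsMASolution P μ₀ φ₀ β φ := by
  have := isProbabilityMeasure_unif hP
  obtain ⟨φ, hφ, hD, hci, hmin⟩ := exists_minimizing_potential hP hw hμ₀ hβ
  have hle := fun (u : Rn n → ℝ) (B : ℝ) (hu : Continuous u) (hB : ∀ x, |u x| ≤ B) =>
    integral_comp_conjGrad_le hP hw hμ₀ hβ hφ hD hci hmin hu hB
  set m := expMeasure μ₀ φ₀ β φ with hm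
  have hmfin : IsFiniteMeasure m := hφ.isFiniteMeasure_expMeasure hw hβ
  have hm0 : m ≠ 0 := hφ.expMeasure_ne_zero hw hμ₀
  have hmu : m univ ≠ 0 := by simpa using hm0
  have heq : (unif P).map (conjGrad φ) = (m univ)⁻¹ • m := by
    have hp1 : IsProbabilityMeasure ((unif P).map (conjGrad φ)) :=
      Measure.isProbabilityMeasure_map (measurable_conjGrad φ).aemeasurable
    have hp2 : IsFiniteMeasure ((m univ)⁻¹ • m) :=
      m.smul_finite (ENNReal.inv_ne_top.2 hmu)
    refine ext_of_forall_integral_eq_of_IsFiniteMeasure fun u => ?_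
    have hb : ∀ x, |u x| ≤ ‖u‖ := fun x => u.norm_coe_le_norm x
    have h1 := hle u ‖u‖ u.continuous hb
    have h2 := hle (fun x => -u x) ‖u‖ u.continuous.neg (fun x => by rw [abs_neg]; exact hb x)
    rw [integral_neg, integral_neg, neg_div] at h2
    rw [integral_map (measurable_conjGrad φ).aemeasurable u.continuous.aestronglyMeasurable,
      integral_smul_measure, ENNReal.toReal_inv, smul_eq_mul, ← div_eq_inv_mul]
    exact le_antisymm h1 (neg_le_neg_iff.1 h2)
  set c : ℝ := -(1 / β * Real.log (m.real univ)) with hc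
  have hmr : 0 < m.real univ := by
    rw [measureReal_def]; exact ENNReal.toReal_pos hmu (measure_ne_top _ _)
  have hsub : ∀ x, subgrad (fun y => φ y + c) x = subgrad φ x := fun x => by
    ext p
    refine forall_congr' fun y => ?_
    constructor <;> intro h <;> linarith
  have himg : ∀ A, subgradImage (fun y => φ y + c) A = subgradImage φ A := fun A => by
    simp only [subgradImage, hsub]
  have hMA := isMongeAmpere_map_conjGrad hφ.continuous hφ.2 hD
  have hexp : expMeasure μ₀ φ₀ β (fun y => φ y + c) = (m univ)⁻¹ • m := by
    have h1 : ∀ x, ENNReal.ofReal (Real.exp (β * (φ x + c - φ₀ x))) =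
        (m univ)⁻¹ * ENNReal.ofReal (Real.exp (β * (φ x - φ₀ x))) := by
      intro x
      rw [← ENNReal.ofReal_toReal (measure_ne_top m univ), ← measureReal_def,
        ← ENNReal.ofReal_inv_of_pos hmr,
        ← ENNReal.ofReal_mul (inv_nonneg.2 hmr.le)]
      congr 1
      rw [← Real.exp_log (inv_pos.2 hmr), ← Real.exp_add, Real.log_inv, hc]
      congr 1
      field_simp
      ring
    rw [expMeasure]
    simp_rw [h1]
    rw [hm, ← withDensity_smul _ (hφ.measurable_exp hw)]
    rfl
  refine ⟨fun y => φ y + c, hφ.add_const c, ?_, ?_⟩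
  · rw [himg, ← hMA univ MeasurableSet.univ, heq]
    simp [ENNReal.inv_mul_cancel hmu (measure_ne_top m univ)]
  · intro A hA
    rw [himg, ← hMA A hA, heq, ← hexp]

end EulerLagrange

/-! ### The Donsker–Varadhan variational formula -/

section DonskerVaradhan

lemma exists_seq_continuous_tendsto_ae {m : Measure (Rn n)} [IsFiniteMeasure m] {g : Rn n → ℝ}
    {R : ℝ} (hg : Measurable g) (hR : ∀ x, |g x| ≤ R) :
    ∃ u : ℕ → Rn n → ℝ, (∀ j, Continuous (u j)) ∧ (∀ j x, |u j x| ≤ R) ∧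
      ∀ᵐ x ∂m, Tendsto (fun j => u j x) atTop (𝓝 (g x)) := by
  have hgi : Integrable g m := (integrable_const R).mono' hg.aestronglyMeasurable
    (Eventually.of_forall hR)
  choose v hv hvi using fun j : ℕ => hgi.exists_boundedContinuous_lintegral_sub_le
    (ε := ((j : ℝ≥0∞) + 1)⁻¹) (by simp)
  have hL : Tendsto (fun j => eLpNorm ((fun x => v j x) - g) 1 m) atTop (𝓝 0) := by
    have h0 : Tendsto (fun j : ℕ => ((j : ℝ≥0∞) + 1)⁻¹) atTop (𝓝 0) := by
      have := ENNReal.tendsto_inv_nat_nhds_zero.comp (tendsto_add_atTop_nat 1)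
      refine this.congr fun j => ?_
      simp
    refine tendsto_of_tendsto_of_tendsto_of_le_of_le tendsto_const_nhds h0 (fun _ => zero_le)
      fun j => ?_
    rw [eLpNorm_one_eq_lintegral_enorm]
    refine le_of_eq_of_le (lintegral_congr fun x => ?_) (hv j)
    rw [Pi.sub_apply, ← enorm_neg, neg_sub]
  obtain ⟨s, -, hs⟩ := (tendstoInMeasure_of_tendsto_eLpNorm one_ne_zero
    (fun j => (v j).continuous.aestronglyMeasurable) hg.aestronglyMeasurable
    hL).exists_seq_tendsto_ae
  refine ⟨fun j x => max (-R) (min (v (s j) x) R), fun j => by fun_prop, fun j x => ?_, ?_⟩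
  · have hR0 : 0 ≤ R := (abs_nonneg _).trans (hR x)
    exact abs_le.2 ⟨le_max_left _ _, max_le (by linarith) (min_le_right _ _)⟩
  · filter_upwards [hs] with x hx
    have h1 := tendsto_const_nhds (x := -R) (f := atTop).max
      (hx.min (tendsto_const_nhds (x := R)))
    rwa [min_eq_left (abs_le.1 (hR x)).2, max_eq_right (abs_le.1 (hR x)).1] at h1

variable {ν : Measure (Rn n)} {w : Rn n → ℝ} {M : ℝ}

lemma integrable_exp_sub {g : Rn n → ℝ} {R : ℝ} (hw : Measurable w)
    (hwe : Integrable (fun x => Real.exp (-w x)) μ₀) (hg : Measurable g) (hR : ∀ x, g x ≤ R) :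
    Integrable (fun x => Real.exp (g x - w x)) μ₀ := by
  refine (hwe.const_mul (Real.exp R)).mono' (by fun_prop) (Eventually.of_forall fun x => ?_)
  rw [Real.norm_eq_abs, abs_of_pos (Real.exp_pos _), ← Real.exp_add, Real.exp_le_exp]
  linarith [hR x]

/-- The variational formula with bounded measurable test functions. If `ν` is not absolutely
continuous a large multiple of the indicator of a null set serves; otherwise the truncations of
`log (dν/dμ₀) + w` do. -/
lemma exists_measurable_lt_integral_sub_log [IsProbabilityMeasure ν] [SigmaFinite μ₀]
    (hμ₀ : μ₀ ≠ 0) (hw : Measurable w) (hwi : Integrable w ν)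
    (hwe : Integrable (fun x => Real.exp (-w x)) μ₀)
    (hM : (M : EReal) < relEntropy μ₀ ν + ((∫ x, w x ∂ν : ℝ) : EReal)) :
    ∃ (g : Rn n → ℝ) (R : ℝ), Measurable g ∧ (∀ x, |g x| ≤ R) ∧
      M < ∫ x, g x ∂ν - Real.log (∫ x, Real.exp (g x - w x) ∂μ₀) := by
  have : NeZero μ₀ := ⟨hμ₀⟩
  by_cases hac : ν ≪ μ₀
  swap
  · obtain ⟨A, hA, hA0, hAν⟩ : ∃ A, MeasurableSet A ∧ μ₀ A = 0 ∧ ν A ≠ 0 := by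
      by_contra! h
      exact hac (Measure.AbsolutelyContinuous.mk h)
    have hpos : 0 < ν.real A := by
      rw [measureReal_def]; exact ENNReal.toReal_pos hAν (measure_ne_top _ _)
    set L := Real.log (∫ x, Real.exp (-w x) ∂μ₀)
    obtain ⟨s, hs⟩ := exists_gt ((M + L) / ν.real A)
    refine ⟨A.indicator fun _ => s, |s|, measurable_const.indicator hA, fun x => ?_, ?_⟩
    · by_cases hx : x ∈ A <;> simp [hx]
    · have h1 : ∫ x, Real.exp (A.indicator (fun _ => s) x - w x) ∂μ₀ =
          ∫ x, Real.exp (-w x) ∂μ₀ := by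
        refine integral_congr_ae ?_
        filter_upwards [measure_eq_zero_iff_ae_notMem.1 hA0] with x hx
        simp [hx]
      rw [h1, integral_indicator_const _ hA, smul_eq_mul]
      rw [div_lt_iff₀ hpos] at hs
      linarith [mul_comm s (ν.real A)]
  set ℓ : Rn n → ℝ := fun x => llr ν μ₀ x + w x with hℓ
  have hℓm : Measurable ℓ := (measurable_llr ν μ₀).add hw
  have hneg : ∫⁻ x, ENNReal.ofReal (-llr ν μ₀ x) ∂ν ≠ ∞ :=
    lintegral_neg_llr_ne_top hac hw hwi hwe
  have hwneg : ∫⁻ x, ENNReal.ofReal (-w x) ∂ν ≠ ∞ := hwi.neg.lintegral_lt_top.ne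
  have hwpos : ∫⁻ x, ENNReal.ofReal (w x) ∂ν ≠ ∞ := hwi.lintegral_lt_top.ne
  have hℓneg : ∫⁻ x, ENNReal.ofReal (-ℓ x) ∂ν ≠ ∞ := by
    refine ne_top_of_le_ne_top (ENNReal.add_ne_top.2 ⟨hneg, hwneg⟩) ?_
    have hm : Measurable fun x => ENNReal.ofReal (-llr ν μ₀ x) :=
      (measurable_llr ν μ₀).neg.ennreal_ofReal
    rw [← lintegral_add_left hm]
    refine lintegral_mono fun x => ?_
    rw [hℓ, neg_add]
    exact ENNReal.ofReal_add_le
  set c := (∫⁻ x, ENNReal.ofReal (-ℓ x) ∂ν).toReal with hc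
  obtain ⟨M', hMM', hM'⟩ := EReal.lt_iff_exists_real_btwn.1 hM
  rw [EReal.coe_lt_coe_iff] at hMM'
  -- the positive part of `ℓ` is large
  have hℓpos : M' + c < 0 ∨
      0 ≤ M' + c ∧ ENNReal.ofReal (M' + c) < ∫⁻ x, ENNReal.ofReal (ℓ x) ∂ν := by
    by_cases h0 : M' + c < 0
    · exact Or.inl h0
    refine Or.inr ⟨not_lt.1 h0, ?_⟩
    by_cases htop : relEntropy μ₀ ν = ⊤
    · suffices ∫⁻ x, ENNReal.ofReal (ℓ x) ∂ν = ∞ by rw [this]; exact ENNReal.ofReal_lt_top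
      by_contra hfin
      have h1 : ∫⁻ x, ENNReal.ofReal (llr ν μ₀ x) ∂ν ≠ ∞ := by
        refine ne_top_of_le_ne_top (ENNReal.add_ne_top.2 ⟨hfin, hwneg⟩) ?_
        rw [← lintegral_add_left hℓm.ennreal_ofReal]
        refine lintegral_mono fun x => ?_
        refine le_trans (le_of_eq ?_) ENNReal.ofReal_add_le
        congr 1; simp [hℓ]
      rw [relEntropy, if_pos hac, eintegral] at htop
      lift ∫⁻ x, ENNReal.ofReal (llr ν μ₀ x) ∂ν to NNReal using h1 with a
      lift ∫⁻ x, ENNReal.ofReal (-llr ν μ₀ x) ∂ν to NNReal using hneg with b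
      exact EReal.coe_ne_top ((a : ℝ) - b) htop
    · obtain ⟨-, hli, hle⟩ := relEntropy_ne_top hw hwi hwe htop
      have hℓi : Integrable ℓ ν := hli.add hwi
      rw [hle, ← EReal.coe_add, EReal.coe_lt_coe_iff, ← integral_add hli hwi] at hM'
      have h1 := integral_eq_lintegral_pos_part_sub_lintegral_neg_part hℓi
      rw [ENNReal.ofReal_lt_iff_lt_toReal (not_lt.1 h0) hℓi.lintegral_lt_top.ne]
      have : M' < ∫ x, ℓ x ∂ν := hM'
      linarith
  have hmono : Monotone fun R : ℕ => ∫⁻ x, ENNReal.ofReal (min (ℓ x) R) ∂ν := by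
    intro R R' hRR'
    refine lintegral_mono fun x => ENNReal.ofReal_le_ofReal (min_le_min_left _ ?_)
    exact_mod_cast hRR'
  have hfin : ∀ R : ℕ, ∫⁻ x, ENNReal.ofReal (min (ℓ x) R) ∂ν ≠ ∞ := fun R => by
    refine ne_top_of_le_ne_top (b := ENNReal.ofReal R) ENNReal.ofReal_ne_top ?_
    refine (lintegral_mono fun x => ENNReal.ofReal_le_ofReal (min_le_right _ _)).trans ?_
    simp
  obtain ⟨R₁, hR₁⟩ : ∃ R : ℕ, M' + c < (∫⁻ x, ENNReal.ofReal (min (ℓ x) R) ∂ν).toReal ∨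
      M' + c < 0 := by
    rcases hℓpos with h | ⟨h0, h⟩
    · exact ⟨0, Or.inr h⟩
    · have hsup : ∫⁻ x, ENNReal.ofReal (ℓ x) ∂ν =
          ⨆ R : ℕ, ∫⁻ x, ENNReal.ofReal (min (ℓ x) R) ∂ν := by
        rw [← lintegral_iSup (fun R => (hℓm.min measurable_const).ennreal_ofReal)]
        · refine lintegral_congr fun x => le_antisymm ?_ ?_
          · obtain ⟨R, hR⟩ := exists_nat_ge (ℓ x)
            exact le_iSup_of_le R (by rw [min_eq_left hR])
          · exact iSup_le fun R => ENNReal.ofReal_le_ofReal (min_le_left _ _)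
        · intro R R' hRR' x
          exact ENNReal.ofReal_le_ofReal (min_le_min_left _ (by exact_mod_cast hRR'))
      rw [hsup, lt_iSup_iff] at h
      obtain ⟨R, hR⟩ := h
      exact ⟨R, Or.inl ((ENNReal.ofReal_lt_iff_lt_toReal h0 (hfin R)).1 hR)⟩
  set K := ∫ x, Real.exp (-w x) ∂μ₀ with hK
  have hexp : Tendsto (fun R : ℕ => Real.exp (-(R : ℝ)) * K) atTop (𝓝 (0 * K)) :=
    (Real.tendsto_exp_neg_atTop_nhds_zero.comp tendsto_natCast_atTop_atTop).mul_const K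
  rw [zero_mul] at hexp
  obtain ⟨R, hRR₁, hRK⟩ := ((eventually_ge_atTop R₁).and
    (hexp.eventually_lt_const (sub_pos.2 hMM'))).exists
  have hR : M' + c < (∫⁻ x, ENNReal.ofReal (min (ℓ x) R) ∂ν).toReal := by
    rcases hR₁ with h | h
    · exact h.trans_le (ENNReal.toReal_mono (hfin R) (hmono hRR₁))
    · exact h.trans_le ENNReal.toReal_nonneg
  classical
  set g : Rn n → ℝ := fun x => if ν.rnDeriv μ₀ x = 0 then -(R : ℝ)
    else max (-(R : ℝ)) (min (ℓ x) R) with hg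
  have hgm : Measurable g :=
    Measurable.ite (Measure.measurable_rnDeriv ν μ₀ (measurableSet_singleton 0))
    measurable_const (measurable_const.max (hℓm.min measurable_const))
  have hR0 : (0 : ℝ) ≤ R := Nat.cast_nonneg R
  have hgR : ∀ x, |g x| ≤ R := fun x => by
    simp only [hg]
    split_ifs
    · rw [abs_neg, abs_of_nonneg hR0]
    · exact abs_le.2 ⟨le_max_left _ _, max_le (by linarith) (min_le_right _ _)⟩
  refine ⟨g, R, hgm, hgR, ?_⟩
  have hgi : Integrable g ν := (integrable_const (R : ℝ)).mono' hgm.aestronglyMeasurable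
    (Eventually.of_forall hgR)
  have hgν : ∀ᵐ x ∂ν, min (ℓ x) R ≤ g x := by
    filter_upwards [Measure.rnDeriv_pos hac] with x hx
    simp only [hg, if_neg hx.ne']
    exact le_max_right _ _
  have h1 : (∫⁻ x, ENNReal.ofReal (min (ℓ x) R) ∂ν).toReal - c ≤ ∫ x, g x ∂ν := by
    rw [integral_eq_lintegral_pos_part_sub_lintegral_neg_part hgi]
    refine sub_le_sub (ENNReal.toReal_mono hgi.lintegral_lt_top.ne (lintegral_mono_ae ?_))
      (ENNReal.toReal_mono hℓneg (lintegral_mono_ae ?_))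
    · filter_upwards [hgν] with x hx using ENNReal.ofReal_le_ofReal hx
    · filter_upwards [hgν] with x hx
      rcases le_total (ℓ x) R with h | h
      · rw [min_eq_left h] at hx
        exact ENNReal.ofReal_le_ofReal (by linarith)
      · rw [min_eq_right h] at hx
        rw [ENNReal.ofReal_of_nonpos (by linarith)]
        exact zero_le
  have hei : Integrable (fun x => Real.exp (g x - w x)) μ₀ :=
    integrable_exp_sub hw hwe hgm fun x => le_of_abs_le (hgR x)
  have h2 : ∫ x, Real.exp (g x - w x) ∂μ₀ ≤ 1 + Real.exp (-(R : ℝ)) * K := by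
    have h3 : ∫ x, (ν.rnDeriv μ₀ x).toReal ∂μ₀ = 1 := by
      rw [Measure.integral_toReal_rnDeriv hac, probReal_univ]
    rw [← h3, hK, ← integral_const_mul, ← integral_add Measure.integrable_toReal_rnDeriv
      (hwe.const_mul _)]
    refine integral_mono_ae hei (Measure.integrable_toReal_rnDeriv.add (hwe.const_mul _)) ?_
    filter_upwards [Measure.rnDeriv_lt_top ν μ₀] with x hx
    have hd : 0 ≤ (ν.rnDeriv μ₀ x).toReal := ENNReal.toReal_nonneg
    simp only [← Real.exp_add]
    by_cases hz : ν.rnDeriv μ₀ x = 0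
    · simp only [hg, if_pos hz, hz, ENNReal.toReal_zero, zero_add]
      exact (congrArg Real.exp (sub_eq_add_neg _ _)).le
    · simp only [hg, if_neg hz]
      have hp : 0 < (ν.rnDeriv μ₀ x).toReal := ENNReal.toReal_pos hz hx.ne
      rcases le_total (-(R : ℝ)) (min (ℓ x) R) with h | h
      · rw [max_eq_right h]
        have : min (ℓ x) R - w x ≤ Real.log (ν.rnDeriv μ₀ x).toReal := by
          have := min_le_left (ℓ x) (R : ℝ)
          simp only [hℓ, llr] at this ⊢
          linarith
        have h5 := Real.exp_le_exp.2 this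
        rw [Real.exp_log hp] at h5
        linarith [Real.exp_pos (-(R : ℝ) + -w x)]
      · rw [max_eq_left h, ← sub_eq_add_neg]
        linarith
  have h4 : Real.log (∫ x, Real.exp (g x - w x) ∂μ₀) ≤ Real.exp (-(R : ℝ)) * K := by
    have := Real.log_le_sub_one_of_pos (integral_exp_pos hei)
    linarith
  linarith

/-- The variational formula with bounded continuous test functions. -/
theorem exists_continuous_lt_integral_sub_log [IsProbabilityMeasure ν] [SigmaFinite μ₀]
    (hμ₀ : μ₀ ≠ 0) (hw : Measurable w) (hwi : Integrable w ν)
    (hwe : Integrable (fun x => Real.exp (-w x)) μ₀)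
    (hM : (M : EReal) < relEntropy μ₀ ν + ((∫ x, w x ∂ν : ℝ) : EReal)) :
    ∃ (g : Rn n → ℝ) (R : ℝ), Continuous g ∧ (∀ x, |g x| ≤ R) ∧
      M < ∫ x, g x ∂ν - Real.log (∫ x, Real.exp (g x - w x) ∂μ₀) := by
  obtain ⟨g, R, hg, hR, hMg⟩ := exists_measurable_lt_integral_sub_log hμ₀ hw hwi hwe hM
  have : NeZero μ₀ := ⟨hμ₀⟩
  set m := ν + μ₀.withDensity fun x => ENNReal.ofReal (Real.exp (-w x)) with hm
  have hfin : IsFiniteMeasure (μ₀.withDensity fun x => ENNReal.ofReal (Real.exp (-w x))) :=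
    isFiniteMeasure_withDensity hwe.lintegral_lt_top.ne
  obtain ⟨u, hu, huR, hlim⟩ := exists_seq_continuous_tendsto_ae (m := m) hg hR
  rw [hm, ae_add_measure_iff, ae_withDensity_iff (by fun_prop)] at hlim
  have h1 : Tendsto (fun j => ∫ x, u j x ∂ν) atTop (𝓝 (∫ x, g x ∂ν)) :=
    tendsto_integral_of_dominated_convergence (fun _ => R)
      (fun j => (hu j).aestronglyMeasurable) (integrable_const R)
      (fun j => Eventually.of_forall (huR j)) hlim.1
  have h2 : Tendsto (fun j => ∫ x, Real.exp (u j x - w x) ∂μ₀) atTop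
      (𝓝 (∫ x, Real.exp (g x - w x) ∂μ₀)) := by
    refine tendsto_integral_of_dominated_convergence (fun x => Real.exp R * Real.exp (-w x))
      (fun j => (((hu j).measurable.sub hw).exp).aestronglyMeasurable) (hwe.const_mul _)
      (fun j => Eventually.of_forall fun x => ?_) ?_
    · rw [Real.norm_eq_abs, abs_of_pos (Real.exp_pos _), ← Real.exp_add, Real.exp_le_exp]
      linarith [le_of_abs_le (huR j x)]
    · filter_upwards [hlim.2] with x hx
      have := hx (by simp [Real.exp_pos])
      exact (Real.continuous_exp.tendsto _).comp (this.sub_const _)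
  have hpos : 0 < ∫ x, Real.exp (g x - w x) ∂μ₀ :=
    integral_exp_pos (integrable_exp_sub hw hwe hg fun x => le_of_abs_le (hR x))
  obtain ⟨j, hj⟩ := ((h1.sub ((Real.continuousAt_log hpos.ne').tendsto.comp
    h2)).eventually_const_lt hMg).exists
  exact ⟨u j, R, hu j, huR j, hj⟩

end DonskerVaradhan

/-! ### Equidistribution of the lattice points -/

section Lattice

lemma mem_latticePoints {k : ℕ} {p : Rn n} :
    p ∈ latticePoints P k ↔ p ∈ (k : ℝ) • (P : Set (Rn n)) ∧ ∀ i, ∃ m : ℤ, p i = m := by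
  simp [latticePoints]

lemma latticePt_mem (k : ℕ) (j : Fin (numPoints P k)) :
    latticePt P k j ∈ latticePoints P k :=
  ((latticePoints P k).equivFin.symm j).2

lemma sum_latticePt (k : ℕ) (f : Rn n → ℝ) :
    ∑ j, f (latticePt P k j) = ∑ p ∈ latticePoints P k, f p := by
  rw [← Finset.sum_coe_sort (latticePoints P k)]
  exact Equiv.sum_comp (latticePoints P k).equivFin.symm fun p => f p

lemma image_latticePoints {k : ℕ} (hk : 0 < k) :
    ((fun p : Rn n => WithLp.ofLp ((k : ℝ)⁻¹ • p)) '' (latticePoints P k : Set (Rn n))) =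
      (WithLp.toLp 2 ⁻¹' (P : Set (Rn n))) ∩
        (k : ℝ)⁻¹ • (Submodule.span ℤ (Set.range (Pi.basisFun ℝ (Fin n))) : Set (Fin n → ℝ)) := by
  have hk0 : (k : ℝ) ≠ 0 := by exact_mod_cast hk.ne'
  ext x
  simp only [mem_image, mem_latticePoints, mem_inter_iff, mem_preimage,
    mem_smul_set_iff_inv_smul_mem₀ hk0, mem_smul_set_iff_inv_smul_mem₀ (inv_ne_zero hk0), inv_inv,
    SetLike.mem_coe, Module.Basis.mem_span_iff_repr_mem]
  constructor
  · rintro ⟨p, ⟨hp, hm⟩, rfl⟩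
    refine ⟨hp, fun i => ?_⟩
    obtain ⟨m, hm⟩ := hm i
    exact ⟨m, by simp [hk0, hm]⟩
  · rintro ⟨hx, hm⟩
    refine ⟨(k : ℝ) • WithLp.toLp 2 x, ⟨?_, fun i => ?_⟩, ?_⟩
    · rwa [smul_smul, inv_mul_cancel₀ hk0, one_smul]
    · obtain ⟨m, hm⟩ := hm i
      refine ⟨m, ?_⟩
      simpa using hm.symm
    · rw [smul_smul, inv_mul_cancel₀ hk0, one_smul]

/-- Riemann sums over the lattice points converge. -/
theorem tendsto_sum_latticePt {F : Rn n → ℝ} (hF : Continuous F) :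
    Tendsto (fun k : ℕ => (∑ j, F ((k : ℝ)⁻¹ • latticePt P k j)) / (k : ℝ) ^ n) atTop
      (𝓝 (∫ p, F p ∂unif P)) := by
  set s : Set (Fin n → ℝ) := WithLp.toLp 2 ⁻¹' (P : Set (Rn n)) with hs
  have hcont : Continuous (WithLp.toLp 2 : (Fin n → ℝ) → Rn n) := PiLp.continuous_toLp 2 _
  have hsc : IsCompact s := by
    have : s = WithLp.ofLp '' (P : Set (Rn n)) := by
      ext x
      exact ⟨fun h => ⟨_, h, rfl⟩, by rintro ⟨p, hp, rfl⟩; exact hp⟩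
    rw [this]
    exact P.isCompact.image (PiLp.continuous_ofLp 2 _)
  have hconv : Convex ℝ s :=
    P.convex.is_linear_preimage ⟨fun _ _ => rfl, fun _ _ => rfl⟩
  have h := tendsto_tsum_div_pow_atTop_integral s (fun x => F (WithLp.toLp 2 x))
    (hF.comp hcont) hsc.isBounded hsc.measurableSet (hconv.addHaar_frontier volume)
  have hint : ∫ x in s, F (WithLp.toLp 2 x) = ∫ p, F p ∂unif P :=
    (PiLp.volume_preserving_toLp (Fin n)).setIntegral_preimage_emb
      (MeasurableEquiv.toLp 2 (Fin n → ℝ)).measurableEmbedding F P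
  rw [hint] at h
  refine h.congr' ?_
  filter_upwards [eventually_gt_atTop 0] with k hk
  have hk0 : (k : ℝ) ≠ 0 := by exact_mod_cast hk.ne'
  rw [Fintype.card_fin, ← image_latticePoints hk, tsum_image (fun x => F (WithLp.toLp 2 x)),
    sum_latticePt k fun p => F ((k : ℝ)⁻¹ • p)]
  · congr 1
    exact Finset.tsum_subtype' (latticePoints P k) fun p => F ((k : ℝ)⁻¹ • p)
  · intro p _ q _ hpq
    have h1 : (k : ℝ)⁻¹ • p = (k : ℝ)⁻¹ • q := WithLp.ofLp_injective 2 hpq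
    exact smul_right_injective _ (inv_ne_zero hk0) h1

lemma tendsto_numPoints_div (hP : volume (P : Set (Rn n)) = 1) :
    Tendsto (fun k : ℕ => (numPoints P k : ℝ) / (k : ℝ) ^ n) atTop (𝓝 1) := by
  have := tendsto_sum_latticePt (P := P) (F := fun _ => 1) continuous_const
  have h1 := isProbabilityMeasure_unif hP
  simpa using this

lemma tendsto_numPoints (hP : volume (P : Set (Rn n)) = 1) (hn : 0 < n) :
    Tendsto (fun k => (numPoints P k : ℝ)) atTop atTop := by
  have h1 : Tendsto (fun k : ℕ => (k : ℝ) ^ n) atTop atTop :=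
    (tendsto_pow_atTop hn.ne').comp tendsto_natCast_atTop_atTop
  refine ((tendsto_numPoints_div hP).pos_mul_atTop one_pos h1).congr' ?_
  filter_upwards [eventually_gt_atTop 0] with k hk
  have : (k : ℝ) ≠ 0 := by exact_mod_cast hk.ne'
  field_simp

lemma eventually_numPoints_pos (hP : volume (P : Set (Rn n)) = 1) :
    ∀ᶠ k in atTop, 0 < numPoints P k := by
  filter_upwards [(tendsto_numPoints_div hP).eventually_const_lt one_half_lt_one,
    eventually_gt_atTop 0] with k hk _
  rcases Nat.eq_zero_or_pos (numPoints P k) with h | h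
  · rw [h] at hk; norm_num at hk
  · exact h

lemma tendsto_average_latticePt (hP : volume (P : Set (Rn n)) = 1) {F : Rn n → ℝ}
    (hF : Continuous F) :
    Tendsto (fun k : ℕ => (∑ j, F ((k : ℝ)⁻¹ • latticePt P k j)) / numPoints P k) atTop
      (𝓝 (∫ p, F p ∂unif P)) := by
  have := (tendsto_sum_latticePt (P := P) hF).div (tendsto_numPoints_div hP) one_ne_zero
  rw [div_one] at this
  refine this.congr' ?_
  filter_upwards [eventually_gt_atTop 0] with k hk
  have hk0 : (k : ℝ) ^ n ≠ 0 := pow_ne_zero _ (by exact_mod_cast hk.ne')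
  rw [Pi.div_apply, div_div_div_cancel_right₀ hk0]

/-- `log (N!) / (k N)` tends to `0`, since `N` grows like a power of `k`. -/
lemma tendsto_log_factorial (hP : volume (P : Set (Rn n)) = 1) :
    Tendsto (fun k : ℕ => Real.log ((numPoints P k).factorial) / (k * numPoints P k)) atTop
      (𝓝 0) := by
  have h1 : Tendsto (fun k : ℕ => (Real.log 2 + n * Real.log k) / k) atTop (𝓝 0) := by
    have h2 : Tendsto (fun x : ℝ => Real.log x / x) atTop (𝓝 0) :=
      Real.isLittleO_log_id_atTop.tendsto_div_nhds_zero
    have h3 := (h2.comp tendsto_natCast_atTop_atTop).const_mul (n : ℝ)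
    have h4 := (tendsto_const_div_atTop_nhds_zero_nat (Real.log 2)).add h3
    rw [mul_zero, add_zero] at h4
    refine h4.congr fun k => ?_
    simp only [Function.comp]
    ring
  refine tendsto_of_tendsto_of_tendsto_of_le_of_le' tendsto_const_nhds h1
    (Eventually.of_forall fun k => div_nonneg (Real.log_natCast_nonneg _) (by positivity)) ?_
  filter_upwards [(tendsto_numPoints_div hP).eventually_lt_const one_lt_two,
    eventually_gt_atTop 0, eventually_numPoints_pos hP] with k hk hk0 hN
  have hk' : (0 : ℝ) < k := by exact_mod_cast hk0
  have hN' : (0 : ℝ) < numPoints P k := by exact_mod_cast hN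
  rw [div_lt_iff₀ (by positivity)] at hk
  have h2 : Real.log ((numPoints P k).factorial) ≤ numPoints P k * Real.log (numPoints P k) := by
    rw [← Real.log_pow]
    refine Real.log_le_log (by exact_mod_cast Nat.factorial_pos _) ?_
    exact_mod_cast Nat.factorial_le_pow _
  have h3 : Real.log (numPoints P k) ≤ Real.log 2 + n * Real.log k := by
    rw [← Real.log_pow, ← Real.log_mul two_ne_zero (by positivity)]
    exact Real.log_le_log hN' hk.le
  rw [div_le_div_iff₀ (by positivity) hk']
  calc Real.log ((numPoints P k).factorial) * k
      ≤ (numPoints P k * (Real.log 2 + n * Real.log k)) * k := by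
        refine mul_le_mul_of_nonneg_right (h2.trans ?_) hk'.le
        exact mul_le_mul_of_nonneg_left h3 hN'.le
    _ = _ := by ring

lemma inv_smul_latticePt_mem {k : ℕ} (hk : 0 < k) (j : Fin (numPoints P k)) :
    (k : ℝ)⁻¹ • latticePt P k j ∈ P := by
  have hk0 : (k : ℝ) ≠ 0 := by exact_mod_cast hk.ne'
  exact (mem_smul_set_iff_inv_smul_mem₀ hk0 _ _).1 (mem_latticePoints.1 (latticePt_mem k j)).1

end Lattice

/-! ### Empirical measures -/

section Empirical

variable {α : Type*} [MeasurableSpace α] {N : ℕ}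

/-- The empirical measure of `N` points of an arbitrary space. -/
noncomputable def empiricalMeasure (x : Fin N → α) : Measure α :=
  (N : ℝ≥0∞)⁻¹ • ∑ i, Measure.dirac (x i)

lemma isProbabilityMeasure_empiricalMeasure (hN : 0 < N) (x : Fin N → α) :
    IsProbabilityMeasure (empiricalMeasure x) := by
  refine ⟨?_⟩
  simp [empiricalMeasure, ENNReal.inv_mul_cancel (Nat.cast_ne_zero.2 hN.ne')]

lemma integrable_empiricalMeasure (hN : 0 < N) (x : Fin N → α) {f : α → ℝ} (hf : Measurable f) :
    Integrable f (empiricalMeasure x) := by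
  refine Integrable.smul_measure ?_ (ENNReal.inv_ne_top.2 (Nat.cast_ne_zero.2 hN.ne'))
  refine integrable_finsetSum_measure.2 fun i _ => ?_
  exact (integrable_dirac' hf.stronglyMeasurable (by simp))

lemma integral_empiricalMeasure (x : Fin N → α) {f : α → ℝ} (hf : Measurable f) :
    ∫ a, f a ∂empiricalMeasure x = (∑ i, f (x i)) / N := by
  rw [empiricalMeasure, integral_smul_measure, integral_finsetSum_measure fun i _ =>
    integrable_dirac' hf.stronglyMeasurable (by simp)]
  simp_rw [integral_dirac' _ _ hf.stronglyMeasurable]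
  rw [ENNReal.toReal_inv, ENNReal.toReal_natCast, smul_eq_mul, div_eq_inv_mul]

lemma map_empiricalMeasure {β : Type*} [MeasurableSpace β] (x : Fin N → α) {f : α → β}
    (hf : Measurable f) : (empiricalMeasure x).map f = empiricalMeasure (f ∘ x) := by
  rw [empiricalMeasure, empiricalMeasure, Measure.map_smul, ← Measure.mapₗ_apply_of_measurable hf,
    map_sum]
  congr 1
  refine Finset.sum_congr rfl fun i _ => ?_
  rw [Measure.mapₗ_apply_of_measurable hf, Measure.map_dirac' hf]
  rfl

lemma empiricalMeasure_apply_eq_zero {x : Fin N → α} {s : Set α} (hs : MeasurableSet s)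
    (h : ∀ i, x i ∉ s) : empiricalMeasure x s = 0 := by
  simp [empiricalMeasure, hs, h]

/-- The empirical measure of a nonempty configuration as a probability measure. -/
noncomputable def empiricalProb (hN : 0 < N) (x : Fin N → α) : ProbabilityMeasure α :=
  ⟨empiricalMeasure x, isProbabilityMeasure_empiricalMeasure hN x⟩

end Empirical

/-! ### The energy of a configuration -/

section Energy

variable {k : ℕ}

/-- The rescaled lattice points `p_j / k ∈ P`. -/
noncomputable def scaledPt (P : ConvexBody (Rn n)) (k : ℕ) (j : Fin (numPoints P k)) : Rn n :=
  (k : ℝ)⁻¹ • latticePt P k j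

/-- The energy `∑ φ₀(x_i) - k⁻¹ log Per(x)`, so that the unnormalized density of the point process
at inverse temperature `b` is `e^{-b H}`. -/
noncomputable def energy (P : ConvexBody (Rn n)) (φ₀ : Rn n → ℝ) (k : ℕ)
    (x : Fin (numPoints P k) → Rn n) : ℝ :=
  ∑ i, φ₀ (x i) - Real.log (per P k x) / k

lemma scaledPt_mem (hk : 0 < k) (j : Fin (numPoints P k)) : scaledPt P k j ∈ P :=
  inv_smul_latticePt_mem hk j

lemma smul_scaledPt (hk : 0 < k) (j : Fin (numPoints P k)) :
    latticePt P k j = (k : ℝ) • scaledPt P k j := by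
  have hk0 : (k : ℝ) ≠ 0 := by exact_mod_cast hk.ne'
  rw [scaledPt, smul_smul, mul_inv_cancel₀ hk0, one_smul]

lemma per_eq (x : Fin (numPoints P k) → Rn n) :
    per P k x = ∑ σ : Equiv.Perm (Fin (numPoints P k)),
      Real.exp (∑ i, ⟪x (σ i), latticePt P k i⟫) := by
  simp only [per, Matrix.permanent, Matrix.of_apply, Real.exp_sum]

lemma per_pos (x : Fin (numPoints P k) → Rn n) : 0 < per P k x := by
  rw [per_eq]
  exact Finset.sum_pos (fun σ _ => Real.exp_pos _) ⟨1, Finset.mem_univ _⟩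

lemma continuous_per : Continuous (per P k) := by
  have : per P k = fun x => ∑ σ : Equiv.Perm (Fin (numPoints P k)),
      Real.exp (∑ i, ⟪x (σ i), latticePt P k i⟫) := funext per_eq
  rw [this]
  fun_prop

lemma continuous_energy (hφ₀ : Continuous φ₀) : Continuous (energy P φ₀ k) := by
  unfold energy
  have h1 := (continuous_per (P := P) (k := k)).log fun x => (per_pos x).ne'
  fun_prop

lemma gibbsWeight_eq (hk : 0 < k) (b : ℝ) :
    gibbsWeight P μ₀ φ₀ k b = (Measure.pi fun _ => μ₀).withDensity fun x =>
      ENNReal.ofReal (Real.exp (-b * energy P φ₀ k x)) := by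
  have hk0 : (k : ℝ) ≠ 0 := by exact_mod_cast hk.ne'
  rw [gibbsWeight]
  congr 1; ext x
  rw [Real.rpow_def_of_pos (mul_pos (per_pos x) (Real.exp_pos _)),
    Real.log_mul (per_pos x).ne' (Real.exp_pos _).ne', Real.log_exp, energy]
  congr 2
  field_simp
  ring

lemma sum_cost_scaledPt (hk : 0 < k) (x : Fin (numPoints P k) → Rn n)
    (σ : Equiv.Perm (Fin (numPoints P k))) :
    ∑ i, cost φ₀ (x (σ i), scaledPt P k i) =
      ∑ i, φ₀ (x i) - (∑ i, ⟪x (σ i), latticePt P k i⟫) / k := by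
  have hk0 : (k : ℝ) ≠ 0 := by exact_mod_cast hk.ne'
  simp only [cost, Finset.sum_add_distrib, Finset.sum_neg_distrib, Finset.sum_div]
  rw [Equiv.sum_comp σ fun i => φ₀ (x i), neg_add_eq_sub]
  congr 1
  refine Finset.sum_congr rfl fun i _ => ?_
  rw [smul_scaledPt hk, real_inner_smul_right]
  field_simp

/-- Each term of the permanent gives an upper bound of the energy by the cost of an assignment of
the points to the lattice points. -/
lemma energy_le (hk : 0 < k) (x : Fin (numPoints P k) → Rn n)
    (σ : Equiv.Perm (Fin (numPoints P k))) :
    energy P φ₀ k x ≤ ∑ i, cost φ₀ (x (σ i), scaledPt P k i) := by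
  have hk0 : (0 : ℝ) < k := by exact_mod_cast hk
  rw [sum_cost_scaledPt hk, energy]
  have h1 : ∑ i, ⟪x (σ i), latticePt P k i⟫ ≤ Real.log (per P k x) := by
    rw [Real.le_log_iff_exp_le (per_pos x), per_eq]
    exact Finset.single_le_sum (f := fun σ : Equiv.Perm (Fin (numPoints P k)) =>
      Real.exp (∑ i, ⟪x (σ i), latticePt P k i⟫)) (fun _ _ => (Real.exp_pos _).le)
      (Finset.mem_univ σ)
  have h2 := div_le_div_of_nonneg_right h1 hk0.le
  linarith

/-- Conversely, the permanent is at most `N!` times its largest term. -/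
lemma exists_sum_cost_le_energy (hk : 0 < k) (x : Fin (numPoints P k) → Rn n) :
    ∃ σ : Equiv.Perm (Fin (numPoints P k)), ∑ i, cost φ₀ (x (σ i), scaledPt P k i) -
      Real.log (numPoints P k).factorial / k ≤ energy P φ₀ k x := by
  have hk0 : (0 : ℝ) < k := by exact_mod_cast hk
  obtain ⟨σ, -, hσ⟩ := Finset.exists_max_image Finset.univ
    (fun σ : Equiv.Perm (Fin (numPoints P k)) => ∑ i, ⟪x (σ i), latticePt P k i⟫)
    ⟨1, Finset.mem_univ _⟩
  refine ⟨σ, ?_⟩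
  have hfac : (0 : ℝ) < (numPoints P k).factorial := by exact_mod_cast Nat.factorial_pos _
  rw [sum_cost_scaledPt hk, energy]
  have h1 : Real.log (per P k x) ≤
      Real.log (numPoints P k).factorial + ∑ i, ⟪x (σ i), latticePt P k i⟫ := by
    rw [Real.log_le_iff_le_exp (per_pos x), Real.exp_add, Real.exp_log hfac, per_eq]
    refine (Finset.sum_le_card_nsmul _ _ _ fun τ hτ => Real.exp_le_exp.2 (hσ τ hτ)).trans_eq ?_
    rw [Finset.card_univ, Fintype.card_perm, Fintype.card_fin, nsmul_eq_mul]
  have h2 := div_le_div_of_nonneg_right h1 hk0.le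
  rw [add_div] at h2
  linarith

lemma sum_sub_supportFun_le_energy (hk : 0 < k) (x : Fin (numPoints P k) → Rn n) :
    ∑ i, (φ₀ (x i) - supportFun P (x i)) - Real.log (numPoints P k).factorial / k ≤
      energy P φ₀ k x := by
  obtain ⟨σ, hσ⟩ := exists_sum_cost_le_energy (φ₀ := φ₀) hk x
  refine le_trans (sub_le_sub_right ?_ _) hσ
  rw [← Equiv.sum_comp σ fun i => φ₀ (x i) - supportFun P (x i)]
  exact Finset.sum_le_sum fun i _ => sub_supportFun_le_cost (z := (x (σ i), scaledPt P k i))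
    (scaledPt_mem hk i)

/-- The basic upper bound for the unnormalized measure of a set on which the energy and the
averages of `g` are bounded below. A part `t` of the inverse temperature `b` is used to make
`e^{g - tV}` integrable, where `V = φ₀ - φ_P`. -/
lemma gibbsWeight_le (hw : IsCoerciveWeight P μ₀ φ₀) (hμ₀ : μ₀ ≠ 0) (hk : 0 < k) {b t : ℝ}
    (ht : 0 ≤ t) (htb : t ≤ b) {T : Set (Fin (numPoints P k) → Rn n)} {g : Rn n → ℝ}
    (hg : Measurable g)
    (hgi : Integrable (fun x => Real.exp (g x - t * (φ₀ x - supportFun P x))) μ₀) {M₁ M₂ : ℝ}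
    (hT₁ : ∀ x ∈ T, numPoints P k * M₁ ≤ energy P φ₀ k x)
    (hT₂ : ∀ x ∈ T, numPoints P k * M₂ ≤ ∑ i, g (x i)) :
    gibbsWeight P μ₀ φ₀ k b T ≤ ENNReal.ofReal (Real.exp (-(b - t) * (numPoints P k * M₁) +
      t * (Real.log (numPoints P k).factorial / k) - numPoints P k * M₂ + numPoints P k *
        Real.log (∫ x, Real.exp (g x - t * (φ₀ x - supportFun P x)) ∂μ₀))) := by
  have := hw.sigmaFinite
  have : NeZero μ₀ := ⟨hμ₀⟩
  set s := Real.log (numPoints P k).factorial / k with hs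
  set V : Rn n → ℝ := fun x => φ₀ x - supportFun P x with hV
  have hVm : Measurable V := hw.continuous_sub.measurable
  rw [gibbsWeight_eq hk, withDensity_apply' _ T]
  set A := Real.exp (-(b - t) * (numPoints P k * M₁) + t * s - numPoints P k * M₂) with hA
  have h1 : ∀ x ∈ T, ENNReal.ofReal (Real.exp (-b * energy P φ₀ k x)) ≤
      ENNReal.ofReal (A * ∏ i, Real.exp (g (x i) - t * V (x i))) := by
    intro x hx
    refine ENNReal.ofReal_le_ofReal ?_
    rw [← Real.exp_sum, hA, ← Real.exp_add, Real.exp_le_exp, Finset.sum_sub_distrib,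
      ← Finset.mul_sum]
    have h2 := hT₁ x hx
    have h3 := hT₂ x hx
    have h4 := sum_sub_supportFun_le_energy (φ₀ := φ₀) hk x
    have h5 := mul_le_mul_of_nonneg_left h2 (sub_nonneg.2 htb)
    have h6 := mul_le_mul_of_nonneg_left h4 ht
    simp only [← hs] at h6
    rw [mul_sub] at h6
    nlinarith
  have hm : Measurable fun x : Fin (numPoints P k) → Rn n =>
      ENNReal.ofReal (A * ∏ i, Real.exp (g (x i) - t * V (x i))) := by fun_prop
  refine (setLIntegral_mono hm h1).trans ((setLIntegral_le_lintegral _ _).trans_eq ?_)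
  have hint : Integrable
      (fun x : Fin (numPoints P k) → Rn n => ∏ i, Real.exp (g (x i) - t * V (x i)))
      (Measure.pi fun _ => μ₀) := Integrable.fintype_prod fun _ => hgi
  rw [← ofReal_integral_eq_lintegral_ofReal (hint.const_mul A) (Eventually.of_forall fun x =>
    mul_nonneg (Real.exp_pos _).le (Finset.prod_nonneg fun i _ => (Real.exp_pos _).le)),
    integral_const_mul, integral_fintype_prod_eq_pow fun x => Real.exp (g x - t * V x),
    Fintype.card_fin, Real.exp_add, mul_comm (numPoints P k : ℝ) (Real.log _),
    mul_comm (Real.log _),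
    Real.exp_nat_mul, Real.exp_log (integral_exp_pos hgi)]

lemma gibbsWeight_univ_ne_top (hw : IsCoerciveWeight P μ₀ φ₀) (hμ₀ : μ₀ ≠ 0) (hk : 0 < k) {b : ℝ}
    (hb : 0 < b) : gibbsWeight P μ₀ φ₀ k b univ ≠ ∞ := by
  obtain ⟨m, hm⟩ := hw.exists_le
  have hgi : Integrable (fun x => Real.exp (0 - b * (φ₀ x - supportFun P x))) μ₀ := by
    simp_rw [zero_sub, ← mul_neg, neg_sub]
    exact hw.integrable_exp hb
  set N := numPoints P k
  -- with `t = b` the lower bound of the energy does not matter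
  have h1 : ∀ x ∈ (univ : Set (Fin N → Rn n)),
      N * ((N * m - Real.log N.factorial / k) / N) ≤ energy P φ₀ k x := by
    intro x _
    have h2 := sum_sub_supportFun_le_energy (φ₀ := φ₀) hk x
    have h3 : N * m ≤ ∑ i, (φ₀ (x i) - supportFun P (x i)) := by
      have := Finset.card_nsmul_le_sum Finset.univ (fun i => φ₀ (x i) - supportFun P (x i)) m
        fun i _ => hm _
      rwa [Finset.card_univ, Fintype.card_fin, nsmul_eq_mul] at this
    rcases Nat.eq_zero_or_pos N with h0 | h0
    · simp only [h0, Nat.cast_zero, zero_mul] at h2 h3 ⊢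
      have : Real.log (Nat.factorial (numPoints P k)) = 0 := by
        rw [show numPoints P k = 0 from h0]; simp
      rw [this, zero_div, sub_zero] at h2
      exact h3.trans h2
    · have : (N : ℝ) ≠ 0 := by exact_mod_cast h0.ne'
      rw [mul_div_cancel₀ _ this]
      linarith
  exact ne_top_of_le_ne_top ENNReal.ofReal_ne_top
    (gibbsWeight_le hw hμ₀ hk hb.le le_rfl (g := fun _ => 0) measurable_const hgi h1
      (M₂ := 0) (by simp))

lemma gibbsWeight_univ_ne_zero (hw : IsCoerciveWeight P μ₀ φ₀) (hμ₀ : μ₀ ≠ 0) (hk : 0 < k) (b : ℝ) :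
    gibbsWeight P μ₀ φ₀ k b univ ≠ 0 := by
  have := hw.sigmaFinite
  rw [gibbsWeight_eq hk, Ne, Measure.measure_univ_eq_zero, withDensity_eq_zero_iff]
  · intro h
    have h0 : (Measure.pi fun _ : Fin (numPoints P k) => μ₀) ≠ 0 := by
      rw [Ne, ← Measure.measure_univ_eq_zero, Measure.pi_univ, Finset.prod_eq_zero_iff]
      simpa using fun _ => hμ₀
    have : NeZero (Measure.pi fun _ : Fin (numPoints P k) => μ₀) := ⟨h0⟩
    obtain ⟨x, hx⟩ := h.exists
    simp only [Pi.zero_apply, ENNReal.ofReal_eq_zero, not_le.2 (Real.exp_pos _)] at hx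
  · exact ((Real.continuous_exp.comp
      ((continuous_energy hw.continuous).const_mul (-b))).measurable.ennreal_ofReal).aemeasurable

/-- The permanental point processes are well defined. -/
theorem isProbabilityMeasure_gibbs (hw : IsCoerciveWeight P μ₀ φ₀) (hμ₀ : μ₀ ≠ 0) (hk : 0 < k)
    {b : ℝ} (hb : 0 < b) : IsProbabilityMeasure (gibbs P μ₀ φ₀ k b) :=
  ⟨by
    rw [gibbs, Measure.smul_apply, smul_eq_mul]
    exact ENNReal.inv_mul_cancel (gibbsWeight_univ_ne_zero hw hμ₀ hk b)
      (gibbsWeight_univ_ne_top hw hμ₀ hk hb)⟩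

end Energy

/-! ### The energy is asymptotically bounded below by the optimal cost -/

section EnergyLowerBound

/-- The empirical measure of the rescaled lattice points, with the junk value `λ_P` for the finitely
many `k` for which there are none. -/
noncomputable def latticeProb (hP : volume (P : Set (Rn n)) = 1) (k : ℕ) :
    ProbabilityMeasure (Rn n) :=
  if h : 0 < numPoints P k then empiricalProb h (scaledPt P k) else unifProb hP

lemma tendsto_latticeProb (hP : volume (P : Set (Rn n)) = 1) :
    Tendsto (latticeProb hP) atTop (𝓝 (unifProb hP)) := by
  rw [ProbabilityMeasure.tendsto_iff_forall_integral_tendsto]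
  intro f
  refine (tendsto_average_latticePt hP f.continuous).congr' ?_
  filter_upwards [eventually_numPoints_pos hP] with k hk
  rw [latticeProb, dif_pos hk]
  exact (integral_empiricalMeasure (scaledPt P k) f.continuous.measurable).symm

/-- Near a probability measure `ν` the energy per particle exceeds every number below the optimal
cost of `ν`. -/
theorem eventually_lt_energy (hP : volume (P : Set (Rn n)) = 1) (hw : IsCoerciveWeight P μ₀ φ₀)
    {ν : ProbabilityMeasure (Rn n)} {a : ℝ}
    (h : (a : EReal) < transportCost P φ₀ (ν : Measure (Rn n))) :
    ∃ U, IsOpen U ∧ ν ∈ U ∧ ∀ᶠ k in atTop, ∀ x : Fin (numPoints P k) → Rn n,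
      (∃ ν' : ProbabilityMeasure (Rn n), ν' ∈ U ∧ (ν' : Measure (Rn n)) = empirical x) →
      numPoints P k * a ≤ energy P φ₀ k x := by
  obtain ⟨a', haa', ha'⟩ := EReal.lt_iff_exists_real_btwn.1 h
  rw [EReal.coe_lt_coe_iff] at haa'
  obtain ⟨U, hU, hνU, hev⟩ := eventually_lt_cost hP hw ha' (tendsto_latticeProb hP)
  refine ⟨U, hU, hνU, ?_⟩
  filter_upwards [hev, eventually_numPoints_pos hP, eventually_gt_atTop 0,
    (tendsto_log_factorial hP).eventually_lt_const (sub_pos.2 haa')] with k hk hN hk0 hs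
  rintro x ⟨ν', hν'U, hν'⟩
  obtain ⟨σ, hσ⟩ := exists_sum_cost_le_energy (φ₀ := φ₀) hk0 x
  have hN' : (0 : ℝ) < numPoints P k := by exact_mod_cast hN
  have hcm : Measurable (cost φ₀) := (continuous_cost hw.continuous).measurable
  set z : Fin (numPoints P k) → Rn n × Rn n := fun i => (x (σ i), scaledPt P k i) with hz
  have h1 := hk (empiricalProb hN z) ?_ ?_ ?_ (integrable_empiricalMeasure hN z hcm)
  · rw [show ((empiricalProb hN z : ProbabilityMeasure _) : Measure (Rn n × Rn n)) =
      empiricalMeasure z from rfl, integral_empiricalMeasure z hcm, lt_div_iff₀ hN'] at h1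
    rw [← div_div, div_lt_iff₀ hN'] at hs
    simp only [hz] at h1
    nlinarith
  · exact empiricalMeasure_apply_eq_zero
      (MeasurableSet.univ.prod P.isCompact.measurableSet).compl
      fun i => by simpa [hz] using scaledPt_mem hk0 i
  · convert hν'U using 1
    refine Subtype.ext ?_
    have h2 : (empiricalMeasure z).map Prod.fst = empiricalMeasure (x ∘ σ) :=
      map_empiricalMeasure z measurable_fst
    have h3 : empiricalMeasure (x ∘ σ) = empiricalMeasure x := by
      simp only [empiricalMeasure, Function.comp]
      rw [Equiv.sum_comp σ fun i => Measure.dirac (x i)]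
    exact (h2.trans h3).trans hν'.symm
  · rw [latticeProb, dif_pos hN]
    exact Subtype.ext (map_empiricalMeasure z measurable_snd)

end EnergyLowerBound

/-! ### The large deviation upper bound -/

section UpperBound

/-- The unnormalized mass of the configurations whose empirical measure belongs to `A`. -/
noncomputable def empiricalWeight (P : ConvexBody (Rn n)) (μ₀ : Measure (Rn n)) (φ₀ : Rn n → ℝ)
    (k : ℕ) (b : ℝ) (A : Set (ProbOn μ₀.support)) : ℝ≥0∞ :=
  gibbsWeight P μ₀ φ₀ k b {x | ∃ ν ∈ A, ν.meas = empirical x}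

variable {b : ℕ → ℝ}

/-- The upper bound of the weight in the form that enters the large deviation principle. -/
lemma gibbsWeight_le_exp (hw : IsCoerciveWeight P μ₀ φ₀) (hμ₀ : μ₀ ≠ 0) {k : ℕ} (hk : 0 < k)
    (hN : 0 < numPoints P k) {b t : ℝ} (ht : 0 ≤ t) (htb : t ≤ b)
    {T : Set (Fin (numPoints P k) → Rn n)} {g : Rn n → ℝ} (hg : Measurable g)
    (hgi : Integrable (fun x => Real.exp (g x - t * (φ₀ x - supportFun P x))) μ₀) {M₁ M₂ a : ℝ}
    (hT₁ : ∀ x ∈ T, numPoints P k * M₁ ≤ energy P φ₀ k x)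
    (hT₂ : ∀ x ∈ T, numPoints P k * M₂ ≤ ∑ i, g (x i))
    (ha : b * a ≤ (b - t) * M₁ - t * (Real.log (numPoints P k).factorial / (k * numPoints P k)) +
      M₂ - Real.log (∫ x, Real.exp (g x - t * (φ₀ x - supportFun P x)) ∂μ₀)) :
    gibbsWeight P μ₀ φ₀ k b T ≤ ENNReal.ofReal (Real.exp (-(numPoints P k * b) * a)) := by
  refine (gibbsWeight_le hw hμ₀ hk ht htb hg hgi hT₁ hT₂).trans
    (ENNReal.ofReal_le_ofReal (Real.exp_le_exp.2 ?_))
  have hN' : (0 : ℝ) < numPoints P k := by exact_mod_cast hN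
  have h1 : Real.log (numPoints P k).factorial / k =
      numPoints P k * (Real.log (numPoints P k).factorial / (k * numPoints P k)) := by
    rw [← div_div, mul_div_cancel₀ _ hN'.ne']
  rw [h1]
  have := mul_le_mul_of_nonneg_left ha hN'.le
  linarith

lemma integrable_exp_neg_mul (hw : IsCoerciveWeight P μ₀ φ₀) {t : ℝ} (ht : 0 < t) :
    Integrable (fun x => Real.exp (-(t * (φ₀ x - supportFun P x)))) μ₀ := by
  simp_rw [← mul_neg, neg_sub]
  exact hw.integrable_exp ht

lemma integrable_exp_zero_sub (hw : IsCoerciveWeight P μ₀ φ₀) {t : ℝ} (ht : 0 < t) :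
    Integrable (fun x => Real.exp (0 - t * (φ₀ x - supportFun P x))) μ₀ := by
  simp_rw [zero_sub]
  exact integrable_exp_neg_mul hw ht

/-- A neighbourhood of `ν` on which both the energy and the average of a test function `g` are
bounded below. -/
lemma exists_isOpen_empiricalWeight_le (hP : volume (P : Set (Rn n)) = 1)
    (hw : IsCoerciveWeight P μ₀ φ₀) (hμ₀ : μ₀ ≠ 0) {t : ℝ} (ht : 0 < t)
    (htb : ∀ᶠ k in atTop, t ≤ b k) {ν : ProbOn μ₀.support} {M₁ M₂ a R : ℝ} {g : Rn n → ℝ}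
    (hg : Continuous g) (hR : ∀ x, |g x| ≤ R)
    (hM₁ : (M₁ : EReal) < transportCost P φ₀ ν.meas) (hM₂ : M₂ < ∫ x, g x ∂ν.meas)
    (ha : ∀ᶠ k in atTop, b k * a ≤ (b k - t) * M₁ -
      t * (Real.log (numPoints P k).factorial / (k * numPoints P k)) +
      M₂ - Real.log (∫ x, Real.exp (g x - t * (φ₀ x - supportFun P x)) ∂μ₀)) :
    ∃ U, IsOpen U ∧ ν ∈ U ∧ ∀ᶠ k in atTop, empiricalWeight P μ₀ φ₀ k (b k) U ≤
      ENNReal.ofReal (Real.exp (-(numPoints P k * b k) * a)) := by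
  obtain ⟨U, hU, hνU, hev⟩ := eventually_lt_energy hP hw (ν := ν.1) hM₁
  let G : BoundedContinuousFunction (Rn n) ℝ :=
    BoundedContinuousFunction.ofNormedAddCommGroup g hg R fun x => hR x
  have hcont : Continuous fun κ : ProbabilityMeasure (Rn n) => ∫ x, g x ∂(κ : Measure (Rn n)) := by
    refine continuous_iff_continuousAt.2 fun κ => ?_
    exact ProbabilityMeasure.tendsto_iff_forall_integral_tendsto.1 tendsto_id G
  refine ⟨Subtype.val ⁻¹' (U ∩ {κ | M₂ < ∫ x, g x ∂(κ : Measure (Rn n))}),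
    (hU.inter (isOpen_lt continuous_const hcont)).preimage continuous_subtype_val, ⟨hνU, hM₂⟩, ?_⟩
  have hgi := integrable_exp_sub (hw.continuous_sub.measurable.const_mul t)
    (integrable_exp_neg_mul hw ht) hg.measurable fun x => le_of_abs_le (hR x)
  filter_upwards [hev, htb, ha, eventually_gt_atTop 0, eventually_numPoints_pos hP] with
    k h1 h2 h3 hk hN
  refine gibbsWeight_le_exp hw hμ₀ hk hN ht.le h2 hg.measurable hgi ?_ ?_ h3
  · rintro x ⟨κ, hκ, hκx⟩
    exact h1 x ⟨κ.1, hκ.1, hκx⟩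
  · rintro x ⟨κ, hκ, hκx⟩
    have h4 : M₂ < ∫ y, g y ∂κ.meas := hκ.2
    rw [hκx, show (empirical x : Measure (Rn n)) = empiricalMeasure x from rfl,
      integral_empiricalMeasure x hg.measurable, lt_div_iff₀ (by exact_mod_cast hN)] at h4
    linarith

/-- The local upper bound at infinite inverse temperature: the entropy is negligible, so that the
zero test function suffices. -/
lemma exists_isOpen_empiricalWeight_le_top (hP : volume (P : Set (Rn n)) = 1)
    (hw : IsCoerciveWeight P μ₀ φ₀) (hμ₀ : μ₀ ≠ 0) (hb : Tendsto b atTop atTop)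
    {ν : ProbOn μ₀.support} {a : ℝ} (ha : (a : EReal) < freeEnergy P μ₀ φ₀ ⊤ ν) :
    ∃ U, IsOpen U ∧ ν ∈ U ∧ ∃ a' > a, ∀ᶠ k in atTop, empiricalWeight P μ₀ φ₀ k (b k) U ≤
      ENNReal.ofReal (Real.exp (-(numPoints P k * b k) * a')) := by
  rw [freeEnergy_top] at ha
  obtain ⟨M₁, haM, hM₁⟩ := EReal.lt_iff_exists_real_btwn.1 ha
  rw [EReal.coe_lt_coe_iff] at haM
  have hgap : 0 < M₁ - (a + M₁) / 2 := by linarith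
  set L := Real.log (∫ x, Real.exp (0 - 1 * (φ₀ x - supportFun P x)) ∂μ₀) with hL
  obtain ⟨U, hU, hνU, hev⟩ := exists_isOpen_empiricalWeight_le (a := (a + M₁) / 2) hP hw hμ₀
    one_pos (hb.eventually_ge_atTop 1) (g := fun _ => 0) (R := 0) continuous_const (by simp) hM₁
    (M₂ := -1) (by simp) (by
      filter_upwards [hb.eventually_ge_atTop ((M₁ + 2 + L) / (M₁ - (a + M₁) / 2)),
        (tendsto_log_factorial hP).eventually_lt_const one_pos] with k h1 h2
      rw [div_le_iff₀ hgap] at h1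
      nlinarith)
  exact ⟨U, hU, hνU, _, by linarith, hev⟩

/-- The local upper bound at finite inverse temperature. Infinite cost and infinite entropy need
only crude parameters; otherwise `t` tends to zero, which recovers the whole free energy. -/
lemma exists_isOpen_empiricalWeight_le_coe (hP : volume (P : Set (Rn n)) = 1)
    (hw : IsCoerciveWeight P μ₀ φ₀) (hμ₀ : μ₀ ≠ 0) {β : ℝ} (hβ : 0 < β)
    (hb : Tendsto b atTop (𝓝 β)) {ν : ProbOn μ₀.support} {a : ℝ}
    (ha : (a : EReal) < freeEnergy P μ₀ φ₀ β ν) :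
    ∃ U, IsOpen U ∧ ν ∈ U ∧ ∃ a' > a, ∀ᶠ k in atTop, empiricalWeight P μ₀ φ₀ k (b k) U ≤
      ENNReal.ofReal (Real.exp (-(numPoints P k * b k) * a')) := by
  have := hw.sigmaFinite
  -- it suffices to find parameters that work in the limit
  suffices h : ∃ (t M₁ M₂ R : ℝ) (g : Rn n → ℝ), 0 < t ∧ t < β ∧ Continuous g ∧
      (∀ x, |g x| ≤ R) ∧ (M₁ : EReal) < transportCost P φ₀ ν.meas ∧ M₂ < ∫ x, g x ∂ν.meas ∧
      β * a < (β - t) * M₁ + M₂ -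
        Real.log (∫ x, Real.exp (g x - t * (φ₀ x - supportFun P x)) ∂μ₀) by
    obtain ⟨t, M₁, M₂, R, g, ht, htβ, hg, hR, hM₁, hM₂, hlt⟩ := h
    set L := Real.log (∫ x, Real.exp (g x - t * (φ₀ x - supportFun P x)) ∂μ₀) with hL
    obtain ⟨a', haa', ha'⟩ := exists_between (show a < ((β - t) * M₁ + M₂ - L) / β by
      rwa [lt_div_iff₀ hβ, mul_comm])
    rw [lt_div_iff₀ hβ, mul_comm] at ha'
    obtain ⟨U, hU, hνU, hev⟩ := exists_isOpen_empiricalWeight_le (a := a') (b := b) hP hw hμ₀ ht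
      ((hb.eventually_const_lt htβ).mono fun _ h => h.le) hg hR hM₁ hM₂ (by
        have h1 : Tendsto (fun k => b k * a') atTop (𝓝 (β * a')) := hb.mul_const a'
        have h2 : Tendsto (fun k : ℕ => (b k - t) * M₁ -
            t * (Real.log (numPoints P k).factorial / (k * numPoints P k)) + M₂ - L) atTop
            (𝓝 ((β - t) * M₁ - t * 0 + M₂ - L)) :=
          ((((hb.sub_const t).mul_const M₁).sub
            ((tendsto_log_factorial hP).const_mul t)).add_const M₂).sub_const L
        exact (h1.eventually_lt h2 (by linarith)).mono fun k hk => hk.le)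
    exact ⟨U, hU, hνU, a', haa', hev⟩
  by_cases hC : transportCost P φ₀ ν.meas = ⊤
  · set L := Real.log (∫ x, Real.exp (0 - β / 2 * (φ₀ x - supportFun P x)) ∂μ₀) with hL
    refine ⟨β / 2, (β * a + 2 + L) / (β / 2), -1, 0, fun _ => 0, half_pos hβ, half_lt_self hβ,
      continuous_const, by simp, by rw [hC]; exact EReal.coe_lt_top _, by simp, ?_⟩
    rw [show β - β / 2 = β / 2 by ring, mul_div_cancel₀ _ (half_pos hβ).ne']
    linarith
  obtain ⟨c, hc, hV⟩ := exists_transportCost_eq hw hC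
  set v := ∫ x, φ₀ x - supportFun P x ∂ν.meas with hv
  -- the test function comes from the Donsker–Varadhan formula for the reference measure with
  -- density `exp (-t (φ₀ - φ_P))`, whose entropy exceeds that of `μ₀` by `t * v`
  suffices h : ∃ t M₁ M : ℝ, 0 < t ∧ t < β ∧ M₁ < c ∧
      (M : EReal) < relEntropy μ₀ ν.meas + ((t * v : ℝ) : EReal) ∧ β * a < (β - t) * M₁ + M by
    obtain ⟨t, M₁, M, ht, htβ, hM₁, hM, hlt⟩ := h
    rw [hv, ← integral_const_mul] at hM
    obtain ⟨g, R, hg, hR, hMg⟩ := exists_continuous_lt_integral_sub_log hμ₀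
      (hw.continuous_sub.measurable.const_mul t) (hV.const_mul t) (integrable_exp_neg_mul hw ht) hM
    set L := Real.log (∫ x, Real.exp (g x - t * (φ₀ x - supportFun P x)) ∂μ₀) with hL
    obtain ⟨M₂, h1, h2⟩ := exists_between (show M + L < ∫ x, g x ∂ν.meas by linarith)
    exact ⟨t, M₁, M₂, R, g, ht, htβ, hg, hR, by rw [hc]; exact_mod_cast hM₁, h2, by linarith⟩
  by_cases hD : relEntropy μ₀ ν.meas = ⊤
  · refine ⟨β / 2, c - 1, β * a - β / 2 * (c - 1) + 1, half_pos hβ, half_lt_self hβ, by linarith,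
      ?_, by linarith⟩
    rw [hD, EReal.top_add_coe]
    exact EReal.coe_lt_top _
  have he : Integrable (fun x => Real.exp (-(φ₀ x - supportFun P x))) μ₀ := by
    simpa using hw.integrable_exp one_pos
  obtain ⟨hac, hi, heq⟩ := relEntropy_ne_top hw.continuous_sub.measurable hV he hD
  set d := ∫ x, llr ν.meas μ₀ x ∂ν.meas with hd
  rw [freeEnergy, if_neg hC, hc, heq, ← EReal.coe_div, ← EReal.coe_add,
    EReal.coe_lt_coe_iff] at ha
  have h0 : 0 < β * c + d - β * a := by
    have h1 := mul_lt_mul_of_pos_left ha hβ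
    rw [mul_add, mul_div_cancel₀ _ hβ.ne'] at h1
    linarith
  have hlim : Tendsto (fun t : ℝ => β * c + d - β * a - t * (c - v)) (𝓝[>] 0)
      (𝓝 (β * c + d - β * a - 0 * (c - v))) := by
    refine Tendsto.mono_left ?_ nhdsWithin_le_nhds
    exact (by fun_prop : Continuous fun t : ℝ => β * c + d - β * a - t * (c - v)).tendsto 0
  rw [zero_mul, sub_zero] at hlim
  obtain ⟨t, htG, ht0, htβ⟩ := ((hlim.eventually_const_lt h0).and (Ioo_mem_nhdsGT hβ)).exists
  set γ := β * c + d - β * a - t * (c - v) with hγ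
  refine ⟨t, c - γ / (4 * β), d + t * v - γ / 4, ht0, htβ, ?_, ?_, ?_⟩
  · have : 0 < γ / (4 * β) := by positivity
    linarith
  · rw [heq, ← EReal.coe_add, EReal.coe_lt_coe_iff]
    linarith
  · have h1 : (β - t) * (γ / (4 * β)) ≤ γ / 4 := by
      rw [show γ / 4 = β * (γ / (4 * β)) by field_simp]
      exact mul_le_mul_of_nonneg_right (by linarith) (by positivity)
    nlinarith

/-- Exponential tightness: the energy dominates the average of the proper function
`V = φ₀ - φ_P`. -/
lemma exists_isCompact_empiricalWeight_compl_le (hP : volume (P : Set (Rn n)) = 1)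
    (hw : IsCoerciveWeight P μ₀ φ₀) (hμ₀ : μ₀ ≠ 0) {t : ℝ} (ht : 0 < t)
    (htb : ∀ᶠ k in atTop, 2 * t ≤ b k) (a : ℝ) :
    ∃ K, IsCompact K ∧ ∀ᶠ k in atTop, empiricalWeight P μ₀ φ₀ k (b k) Kᶜ ≤
      ENNReal.ofReal (Real.exp (-(numPoints P k * b k) * a)) := by
  obtain ⟨m, hm⟩ := hw.exists_le
  set L := Real.log (∫ x, Real.exp (0 - t * (φ₀ x - supportFun P x)) ∂μ₀) with hL
  set M₁ := 2 * |a| + (|L| + t) / t with hM₁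
  have hVm : Continuous fun x => φ₀ x - supportFun P x - m :=
    hw.continuous_sub.sub continuous_const
  have hcoer : ∀ R : ℝ, IsCompact {x | x ∈ μ₀.support ∧ φ₀ x - supportFun P x - m ≤ R} := by
    intro R
    obtain ⟨K, hK, hsub⟩ := mem_cocompact.1 (hw.coercive.eventually_gt_atTop (R + m))
    refine hK.of_isClosed_subset (Measure.isClosed_support.inter
      (isClosed_le hVm continuous_const)) fun x hx => ?_
    by_contra hxK
    have h2 : R + m < φ₀ x - supportFun P x := hsub hxK
    have h3 : φ₀ x - supportFun P x - m ≤ R := hx.2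
    linarith
  have hcomp := isCompact_setOf_lintegral_ofReal_le hVm (Measure.isClosed_support (μ := μ₀)) hcoer
    (c := ENNReal.ofReal (M₁ + 1 - m)) ENNReal.ofReal_ne_top
  have hemb : IsClosedEmbedding (Subtype.val : ProbOn μ₀.support → ProbabilityMeasure (Rn n)) :=
    (isClosed_setOf_measure_compl_eq_zero
      (Measure.isClosed_support (μ := μ₀))).isClosedEmbedding_subtypeVal
  refine ⟨_, hemb.isCompact_preimage hcomp, ?_⟩
  filter_upwards [htb, eventually_gt_atTop 0, eventually_numPoints_pos hP,
    (tendsto_log_factorial hP).eventually_lt_const one_pos] with k hb hk hN hs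
  have hN' : (0 : ℝ) < numPoints P k := by exact_mod_cast hN
  have hpos : 0 ≤ M₁ := by positivity
  refine gibbsWeight_le_exp hw hμ₀ hk hN ht.le (by linarith) (g := fun _ => 0) measurable_const
    (integrable_exp_zero_sub hw ht) (M₁ := M₁) (M₂ := 0) ?_ (by simp) ?_
  · rintro x ⟨κ, hκ, hκx⟩
    have h1 := sum_sub_supportFun_le_energy (φ₀ := φ₀) hk x
    have h2 : M₁ + 1 - m < (∑ i, (φ₀ (x i) - supportFun P (x i) - m)) / numPoints P k := by
      by_contra! hle
      refine hκ ⟨κ.2, ?_⟩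
      have hi := integrable_empiricalMeasure hN x hVm.measurable
      have : ∫⁻ y, ENNReal.ofReal (φ₀ y - supportFun P y - m) ∂κ.meas =
          ENNReal.ofReal ((∑ i, (φ₀ (x i) - supportFun P (x i) - m)) / numPoints P k) := by
        rw [hκx, show (empirical x : Measure (Rn n)) = empiricalMeasure x from rfl,
          ← integral_empiricalMeasure x hVm.measurable,
          ofReal_integral_eq_lintegral_ofReal hi (Eventually.of_forall fun y => by
            simpa using hm y)]
      exact this.trans_le (ENNReal.ofReal_le_ofReal hle)
    rw [lt_div_iff₀ hN', Finset.sum_sub_distrib, Finset.sum_const, Finset.card_univ,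
      Fintype.card_fin, nsmul_eq_mul] at h2
    rw [← div_div, div_lt_iff₀ hN'] at hs
    linarith
  · have h1 : b k * a ≤ b k * |a| := mul_le_mul_of_nonneg_left (le_abs_self a) (by linarith)
    have h2 : b k / 2 * M₁ ≤ (b k - t) * M₁ := mul_le_mul_of_nonneg_right (by linarith) hpos
    have h3 : t * ((|L| + t) / t) ≤ b k / 2 * ((|L| + t) / t) :=
      mul_le_mul_of_nonneg_right (by linarith) (by positivity)
    rw [mul_div_cancel₀ _ ht.ne'] at h3
    have h4 : b k / 2 * M₁ = b k * |a| + b k / 2 * ((|L| + t) / t) := by rw [hM₁]; ring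
    have h5 := mul_lt_mul_of_pos_left hs ht
    linarith [le_abs_self L]

end UpperBound

/-! ### Matching points with labels -/

section Matching

/-- Two labelled families can be matched so that the number of pairs with different labels is
controlled by the differences of the label counts: in a matching with the most agreements, no
label can be missed on both sides, since a transposition would then create an agreement. -/
lemma exists_perm_card_ne_le {α κ : Type*} [Fintype α] [DecidableEq α] [DecidableEq κ]
    (f g : α → κ) (I : Finset κ) (hf : ∀ a, f a ∈ I) :
    ∃ σ : Equiv.Perm α, ((Finset.univ.filter fun a => f a ≠ g (σ a)).card : ℝ) ≤
      ∑ l ∈ I, |((Finset.univ.filter fun a => f a = l).card : ℝ) -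
        (Finset.univ.filter fun a => g a = l).card| := by
  obtain ⟨σ, -, hσ⟩ := Finset.exists_max_image Finset.univ
    (fun σ : Equiv.Perm α => (Finset.univ.filter fun a => f a = g (σ a)).card)
    ⟨1, Finset.mem_univ _⟩
  refine ⟨σ, ?_⟩
  rw [Finset.card_eq_sum_card_fiberwise (f := f) (t := I) fun a _ => hf a, Nat.cast_sum]
  refine Finset.sum_le_sum fun l _ => ?_
  rw [Finset.filter_filter]
  by_cases hU : ∃ i, f i ≠ g (σ i) ∧ f i = l
  swap
  · rw [Finset.filter_eq_empty_iff.2 fun i _ h => hU ⟨i, h⟩, Finset.card_empty, Nat.cast_zero]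
    exact abs_nonneg _
  obtain ⟨i, hi, hil⟩ := hU
  -- otherwise exchanging the partners of `i` and `j` gains the agreement `i` and loses none
  have hV : ∀ j, g (σ j) = l → f j = l := by
    intro j hj
    by_contra hjl
    have hij : i ≠ j := fun h => hjl (h ▸ hil)
    refine absurd (hσ (σ * Equiv.swap i j) (Finset.mem_univ _)) (not_le.2 ?_)
    refine Finset.card_lt_card ⟨fun a ha => ?_, fun hsub => ?_⟩
    · simp only [Finset.mem_filter, Finset.mem_univ, true_and] at ha ⊢
      have hai : a ≠ i := fun h => hi (h ▸ ha)
      have haj : a ≠ j := fun h => hjl (by rw [h] at ha; rw [ha, hj])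
      rw [Equiv.Perm.mul_apply, Equiv.swap_apply_of_ne_of_ne hai haj]
      exact ha
    · have h1 : i ∈ Finset.univ.filter fun a => f a = g ((σ * Equiv.swap i j) a) := by
        rw [Finset.mem_filter]
        exact ⟨Finset.mem_univ _, by rw [Equiv.Perm.mul_apply, Equiv.swap_apply_left, hj, hil]⟩
      have h2 := hsub h1
      simp only [Finset.mem_filter, Finset.mem_univ, true_and] at h2
      exact hi h2
  have h1 : (Finset.univ.filter fun a => g a = l).card =
      (Finset.univ.filter fun a => g (σ a) = l).card := by
    refine (Finset.card_bij (fun a _ => σ a) (fun a ha => ?_) (fun a _ b _ h => σ.injective h)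
      fun b hb => ⟨σ.symm b, ?_, by simp⟩).symm
    · simpa using ha
    · simpa using hb
  have h2 : (Finset.univ.filter fun a => f a = l).card =
      (Finset.univ.filter fun a => f a ≠ g (σ a) ∧ f a = l).card +
        (Finset.univ.filter fun a => g (σ a) = l).card := by
    rw [← Finset.card_union_of_disjoint]
    · congr 1
      ext a
      simp only [Finset.mem_filter, Finset.mem_univ, true_and, Finset.mem_union]
      constructor
      · intro h
        by_cases h' : g (σ a) = l
        · exact Or.inr h'
        · exact Or.inl ⟨fun h'' => h' (h'' ▸ h), h⟩
      · rintro (h | h)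
        · exact h.2
        · exact hV a h
    · rw [Finset.disjoint_left]
      intro a ha hb
      simp only [Finset.mem_filter, Finset.mem_univ, true_and] at ha hb
      exact ha.1 (ha.2.trans hb.symm)
  rw [h1, h2, Nat.cast_add, add_sub_cancel_right]
  exact le_abs_self _

end Matching

/-! ### The law of large numbers for independent samples -/

section LawOfLargeNumbers

variable {α : Type*} [MeasurableSpace α] {N : ℕ → ℕ} {G : Measure α}

/-- Finite samples of length `N k`, for varying `k`. -/
abbrev Sample (N : ℕ → ℕ) (α : Type*) : Type _ := Σ k : ℕ, (Fin (N k) → α)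

/-- The filter of the events that hold with probability tending to `1` for samples of `N k`
independent points with law `G`. -/
def sampleFilter (N : ℕ → ℕ) (G : Measure α) : Filter (Sample N α) where
  sets := {B | Tendsto
    (fun k => Measure.pi (fun _ : Fin (N k) => G) {z | (⟨k, z⟩ : Sample N α) ∉ B})
    atTop (𝓝 0)}
  univ_sets := by simp
  sets_of_superset := by
    intro A B hA hAB
    refine tendsto_of_tendsto_of_tendsto_of_le_of_le tendsto_const_nhds hA (fun _ => zero_le)
      fun k => measure_mono fun z hz hzA => hz (hAB hzA)
  inter_sets := by
    intro A B hA hB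
    have h := Tendsto.add hA hB
    rw [add_zero] at h
    refine tendsto_of_tendsto_of_tendsto_of_le_of_le tendsto_const_nhds h (fun _ => zero_le)
      fun k => (measure_mono fun z hz => ?_).trans (measure_union_le _ _)
    by_cases hzA : (⟨k, z⟩ : Sample N α) ∈ A
    · exact Or.inr fun hzB => hz ⟨hzA, hzB⟩
    · exact Or.inl hzA

lemma mem_sampleFilter {B : Set (Sample N α)} : B ∈ sampleFilter N G ↔
    Tendsto (fun k => Measure.pi (fun _ : Fin (N k) => G) {z | (⟨k, z⟩ : Sample N α) ∉ B})
      atTop (𝓝 0) := Iff.rfl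

lemma tendsto_fst_sampleFilter : Tendsto Sigma.fst (sampleFilter N G) atTop := by
  intro s hs
  rw [Filter.mem_map, mem_sampleFilter]
  refine tendsto_const_nhds.congr' ?_
  filter_upwards [hs] with k hk
  have : {z : Fin (N k) → α | (⟨k, z⟩ : Sample N α) ∉ Sigma.fst ⁻¹' s} = ∅ := by
    ext z
    simp [hk]
  rw [this, measure_empty]

variable [IsProbabilityMeasure G]

lemma eventually_sampleFilter_forall {p : α → Prop} (hp : ∀ᵐ a ∂G, p a) :
    ∀ᶠ z in sampleFilter N G, ∀ i, p (z.2 i) := by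
  refine mem_sampleFilter.2 (tendsto_const_nhds.congr fun k => Eq.symm ?_)
  have h : ∀ᵐ z ∂Measure.pi (fun _ : Fin (N k) => G), ∀ i, p (z i) := by
    refine ae_all_iff.2 fun i => ?_
    exact (measurePreserving_eval (fun _ : Fin (N k) => G) i).quasiMeasurePreserving.ae hp
  exact h

/-- The weak law of large numbers, from Chebyshev's inequality. -/
lemma tendsto_average_sampleFilter (hN : Tendsto (fun k => (N k : ℝ)) atTop atTop) {h : α → ℝ}
    (hh : MemLp h 2 G) :
    Tendsto (fun z : Sample N α => (∑ i, h (z.2 i)) / N z.1) (sampleFilter N G)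
      (𝓝 (∫ a, h a ∂G)) := by
  rw [Metric.tendsto_nhds]
  intro ε hε
  refine mem_sampleFilter.2 ?_
  have hlim : Tendsto (fun k => ENNReal.ofReal
      (ProbabilityTheory.variance h G / ε ^ 2 / N k)) atTop (𝓝 (ENNReal.ofReal 0)) :=
    ENNReal.tendsto_ofReal (hN.const_div_atTop _)
  rw [ENNReal.ofReal_zero] at hlim
  refine tendsto_of_tendsto_of_tendsto_of_le_of_le' tendsto_const_nhds hlim
    (Eventually.of_forall fun _ => zero_le) ?_
  filter_upwards [hN.eventually_gt_atTop 0] with k hk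
  set X : (Fin (N k) → α) → ℝ := ∑ i, fun z => h (z i) with hX
  have hXL : MemLp X 2 (Measure.pi fun _ : Fin (N k) => G) :=
    memLp_finsetSum' _ fun i _ => hh.comp_measurePreserving
      (measurePreserving_eval (fun _ : Fin (N k) => G) i)
  have hmean : ∫ z, X z ∂(Measure.pi fun _ : Fin (N k) => G) = N k * ∫ a, h a ∂G := by
    simp only [hX, Finset.sum_apply]
    rw [integral_finsetSum _ fun i _ => (integrable_comp_eval (hh.integrable one_le_two))]
    simp_rw [integral_comp_eval (μ := fun _ : Fin (N k) => G) hh.1]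
    simp
  have hvar : ProbabilityTheory.variance X (Measure.pi fun _ : Fin (N k) => G) =
      N k * ProbabilityTheory.variance h G := by
    rw [hX, ProbabilityTheory.variance_sum_pi fun _ => hh]
    simp
  have hch := ProbabilityTheory.meas_ge_le_variance_div_sq hXL (mul_pos hk hε)
  rw [hmean, hvar] at hch
  refine (measure_mono fun z hz => ?_).trans (hch.trans_eq ?_)
  · simp only [mem_ofPred_eq, not_lt, Real.dist_eq] at hz ⊢
    have h1 : X z - N k * ∫ a, h a ∂G = N k * ((∑ i, h (z i)) / N k - ∫ a, h a ∂G) := by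
      simp only [hX, Finset.sum_apply]
      field_simp
    rw [h1, abs_mul, abs_of_pos hk]
    exact mul_le_mul_of_nonneg_left hz hk.le
  · congr 1
    field_simp

end LawOfLargeNumbers

/-! ### Matching independent samples with the lattice points -/

section Cells

/-- The index of the half-open cube of side `ε` that contains `p`. -/
noncomputable def cell (ε : ℝ) (p : Rn n) : Fin n → ℤ := fun i => ⌊p i / ε⌋

lemma measurable_cell (ε : ℝ) : Measurable (cell (n := n) ε) := by
  refine measurable_pi_lambda _ fun i => Int.measurable_floor.comp ?_
  exact ((EuclideanSpace.proj i).continuous.measurable).div_const ε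

lemma convex_preimage_cell {ε : ℝ} (hε : 0 < ε) (l : Fin n → ℤ) :
    Convex ℝ {p : Rn n | cell ε p = l} := by
  have : {p : Rn n | cell ε p = l} = ⋂ i, {p : Rn n | p i ∈ Ico (ε * l i) (ε * (l i + 1))} := by
    ext p
    simp only [mem_ofPred_eq, mem_iInter, funext_iff, cell, Int.floor_eq_iff, mem_Ico,
      le_div_iff₀ hε, div_lt_iff₀ hε, mul_comm]
  rw [this]
  refine convex_iInter fun i => ?_
  exact (convex_Ico _ _).is_linear_preimage (f := fun p : Rn n => p i)
    ⟨fun _ _ => rfl, fun _ _ => rfl⟩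

lemma norm_sub_le_of_cell_eq {ε : ℝ} (hε : 0 < ε) {p q : Rn n} (h : cell ε p = cell ε q) :
    ‖p - q‖ ≤ n * ε := by
  have h1 : ∀ i, |p i - q i| ≤ ε := by
    intro i
    have h2 := Int.abs_sub_lt_one_of_floor_eq_floor (congrFun h i)
    rw [← sub_div, abs_div, abs_of_pos hε, div_lt_one hε] at h2
    exact h2.le
  have h3 : p - q = ∑ i, EuclideanSpace.single i (p i - q i) := by
    ext j
    simp [Finset.sum_apply, Pi.single_apply]
  rw [h3]
  refine (norm_sum_le _ _).trans ?_
  simp_rw [EuclideanSpace.single, PiLp.norm_single, Real.norm_eq_abs]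
  refine (Finset.sum_le_card_nsmul _ _ ε fun i _ => h1 i).trans_eq ?_
  simp

lemma exists_finset_cell_mem {ε : ℝ} (P : ConvexBody (Rn n)) :
    ∃ I : Finset (Fin n → ℤ), ∀ p ∈ P, cell ε p ∈ I := by
  obtain ⟨R, hR0, hR⟩ := exists_norm_le_of_mem P
  refine ⟨Fintype.piFinset fun _ => Finset.Icc ⌊-(R / |ε|)⌋ ⌊R / |ε|⌋, fun p hp => ?_⟩
  rw [Fintype.mem_piFinset]
  intro i
  have h1 : |p i / ε| ≤ R / |ε| := by
    rw [abs_div]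
    gcongr
    rw [← Real.norm_eq_abs]
    exact (PiLp.norm_apply_le p i).trans (hR p hp)
  rw [Finset.mem_Icc]
  exact ⟨Int.floor_le_floor (abs_le.1 h1).1, Int.floor_le_floor (abs_le.1 h1).2⟩

/-- The proportion of lattice points in a cube converges to the measure of the cube. -/
lemma tendsto_card_scaledPt_cell (hP : volume (P : Set (Rn n)) = 1) {ε : ℝ} (hε : 0 < ε)
    (l : Fin n → ℤ) :
    Tendsto (fun k => ((Finset.univ.filter fun i => cell ε (scaledPt P k i) = l).card : ℝ) /
      numPoints P k) atTop (𝓝 ((unif P).real {p | cell ε p = l})) := by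
  have hm : MeasurableSet {p : Rn n | cell ε p = l} :=
    measurable_cell ε (measurableSet_singleton l)
  have h1 : (unif P) (frontier {p : Rn n | cell ε p = l}) = 0 :=
    le_antisymm ((Measure.restrict_apply_le _ _).trans
      ((convex_preimage_cell hε l).addHaar_frontier volume).le) zero_le
  have h2 := ProbabilityMeasure.tendsto_measure_of_null_frontier_of_tendsto'
    (tendsto_latticeProb hP) h1
  have h3 := (ENNReal.tendsto_toReal (measure_ne_top _ _)).comp h2
  refine h3.congr' ?_
  filter_upwards [eventually_numPoints_pos hP] with k hk
  have h4 : ((latticeProb hP k : ProbabilityMeasure (Rn n)) : Measure (Rn n)) =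
      empiricalMeasure (scaledPt P k) := by
    rw [latticeProb, dif_pos hk]; rfl
  have h5 := integral_empiricalMeasure (scaledPt P k)
    (f := {p : Rn n | cell ε p = l}.indicator fun _ => (1 : ℝ))
    (measurable_const.indicator hm)
  rw [integral_indicator_const _ hm, smul_eq_mul, mul_one] at h5
  simp only [Function.comp]
  rw [h4, ← measureReal_def, h5]
  congr 1
  simp [indicator_apply, Finset.sum_boole]

/-- Independent samples of `λ_P` can be matched with the rescaled lattice points at an average
distance that tends to zero in probability. -/
lemma eventually_exists_perm_sum_norm_le (hP : volume (P : Set (Rn n)) = 1) (hn : 0 < n)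
    {G : Measure (Rn n × Rn n)} [IsProbabilityMeasure G] (hG : G.map Prod.snd = unif P) {δ : ℝ}
    (hδ : 0 < δ) :
    ∀ᶠ z : Sample (numPoints P) (Rn n × Rn n) in sampleFilter (numPoints P) G,
      ∃ σ : Equiv.Perm (Fin (numPoints P z.1)), ∑ i : Fin (numPoints P z.1),
        ‖(z.2 i).2 - scaledPt P z.1 (σ i)‖ ≤ numPoints P z.1 * δ := by
  obtain ⟨R, hR0, hR⟩ := exists_norm_le_of_mem P
  set ε := δ / (2 * n) with hεdef
  have hn' : (0 : ℝ) < n := by exact_mod_cast hn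
  have hε : 0 < ε := by positivity
  obtain ⟨I, hI⟩ := exists_finset_cell_mem (ε := ε) P
  have hmem : ∀ᵐ a ∂G, a.2 ∈ P := by
    have := ae_unif_mem P
    rw [← hG] at this
    exact ae_of_ae_map measurable_snd.aemeasurable this
  set F : Sample (numPoints P) (Rn n × Rn n) → ℝ := fun z => ∑ l ∈ I,
    |((Finset.univ.filter fun i => cell ε (z.2 i).2 = l).card : ℝ) / numPoints P z.1 -
      ((Finset.univ.filter fun i => cell ε (scaledPt P z.1 i) = l).card : ℝ) / numPoints P z.1|
    with hF
  have hlim : Tendsto F (sampleFilter (numPoints P) G) (𝓝 0) := by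
    have h0 : (0 : ℝ) = ∑ l ∈ I, |(unif P).real {p | cell ε p = l} -
        (unif P).real {p | cell ε p = l}| := by simp
    rw [h0]
    refine tendsto_finsetSum _ fun l _ => (Tendsto.sub ?_ ?_).abs
    · have hm : MeasurableSet {p : Rn n | cell ε p = l} :=
        measurable_cell ε (measurableSet_singleton l)
      have hm' : MeasurableSet {a : Rn n × Rn n | cell ε a.2 = l} := measurable_snd hm
      have hL : MemLp ({a : Rn n × Rn n | cell ε a.2 = l}.indicator fun _ => (1 : ℝ)) 2 G :=
        memLp_indicator_const 2 hm' 1 (Or.inr (measure_ne_top _ _))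
      have h1 := tendsto_average_sampleFilter (tendsto_numPoints hP hn) hL
      have h2 : ∫ a, {a : Rn n × Rn n | cell ε a.2 = l}.indicator (fun _ => (1 : ℝ)) a ∂G =
          (unif P).real {p | cell ε p = l} := by
        rw [integral_indicator_const _ hm', smul_eq_mul, mul_one, ← hG, measureReal_def,
          measureReal_def, Measure.map_apply measurable_snd hm]
        rfl
      rw [h2] at h1
      refine h1.congr fun z => ?_
      congr 1
      simp [indicator_apply, Finset.sum_boole]
    · exact (tendsto_card_scaledPt_cell hP hε l).comp tendsto_fst_sampleFilter
  filter_upwards [hlim.eventually_lt_const (show 0 < δ / (4 * R) by positivity),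
    eventually_sampleFilter_forall hmem, tendsto_fst_sampleFilter.eventually_gt_atTop 0,
    tendsto_fst_sampleFilter.eventually (eventually_numPoints_pos hP)] with z hz hzP hk hN
  have hN' : (0 : ℝ) < numPoints P z.1 := by exact_mod_cast hN
  obtain ⟨σ, hσ⟩ := exists_perm_card_ne_le (fun i => cell ε (z.2 i).2)
    (fun i => cell ε (scaledPt P z.1 i)) I fun i => hI _ (hzP i)
  refine ⟨σ, ?_⟩
  -- two points of a cell are within `n * ε = δ / 2`, and any two points of `P` within `2 * R`
  have h1 : ∀ i, ‖(z.2 i).2 - scaledPt P z.1 (σ i)‖ ≤ n * ε +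
      if cell ε (z.2 i).2 ≠ cell ε (scaledPt P z.1 (σ i)) then 2 * R else 0 := by
    intro i
    split_ifs with h
    · have h2 := (norm_sub_le (z.2 i).2 (scaledPt P z.1 (σ i))).trans
        (add_le_add (hR _ (hzP i)) (hR _ (scaledPt_mem hk _)))
      have : 0 ≤ n * ε := by positivity
      linarith
    · rw [add_zero]
      exact norm_sub_le_of_cell_eq hε (not_not.1 h)
  refine (Finset.sum_le_sum fun i _ => h1 i).trans ?_
  rw [Finset.sum_add_distrib, Finset.sum_const, Finset.card_univ, Fintype.card_fin, nsmul_eq_mul,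
    ← Finset.sum_filter, Finset.sum_const, nsmul_eq_mul]
  have h3 : F z = (∑ l ∈ I, |((Finset.univ.filter fun i => cell ε (z.2 i).2 = l).card : ℝ) -
      (Finset.univ.filter fun i => cell ε (scaledPt P z.1 i) = l).card|) / numPoints P z.1 := by
    rw [hF, Finset.sum_div]
    refine Finset.sum_congr rfl fun l _ => ?_
    rw [← sub_div, abs_div, abs_of_pos hN']
  rw [h3, div_lt_iff₀ hN'] at hz
  have h4 := mul_le_mul_of_nonneg_right (hσ.trans hz.le) (show 0 ≤ 2 * R by positivity)
  have h5 : δ / (4 * R) * numPoints P z.1 * (2 * R) = numPoints P z.1 * (δ / 2) := by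
    field_simp; ring
  have h6 : (n : ℝ) * ε = δ / 2 := by rw [hεdef]; field_simp
  rw [h6]
  linarith

end Cells

/-! ### The large deviation lower bound at regular measures -/

section LowerBound

lemma pi_withDensity {N : ℕ} [SigmaFinite μ₀] {ν : Measure (Rn n)} [SigmaFinite ν] {f : Rn n → ℝ}
    (hf0 : ∀ x, 0 ≤ f x) (hfi : Integrable f μ₀)
    (hν : ν = μ₀.withDensity fun x => ENNReal.ofReal (f x)) :
    Measure.pi (fun _ : Fin N => ν) = (Measure.pi fun _ : Fin N => μ₀).withDensity fun x =>
      ENNReal.ofReal (∏ i, f (x i)) := by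
  refine Measure.pi_eq fun s hs => ?_
  have h1 : ∀ x : Fin N → Rn n,
      (univ.pi s).indicator (fun x => ENNReal.ofReal (∏ i, f (x i))) x =
        ENNReal.ofReal (∏ i, (s i).indicator f (x i)) := by
    intro x
    by_cases hx : x ∈ univ.pi s
    · rw [indicator_of_mem hx]
      congr 1
      exact Finset.prod_congr rfl fun i _ => (indicator_of_mem (hx i (mem_univ i)) f).symm
    · rw [indicator_of_notMem hx]
      obtain ⟨i, hi⟩ : ∃ i, x i ∉ s i := by simpa using hx
      rw [Finset.prod_eq_zero (Finset.mem_univ i) (indicator_of_notMem hi f), ENNReal.ofReal_zero]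
  have hsm : MeasurableSet (univ.pi s) := MeasurableSet.univ_pi hs
  rw [withDensity_apply _ hsm, ← lintegral_indicator hsm, lintegral_congr h1,
    ← ofReal_integral_eq_lintegral_ofReal (Integrable.fintype_prod fun i =>
      hfi.indicator (hs i)) (Eventually.of_forall fun x => Finset.prod_nonneg fun i _ =>
      indicator_nonneg (fun y _ => hf0 y) _), integral_fintype_prod_eq_prod,
    ENNReal.ofReal_prod_of_nonneg fun i _ => integral_nonneg fun x =>
      indicator_nonneg (fun y _ => hf0 y) _]
  refine Finset.prod_congr rfl fun i _ => ?_
  rw [hν, withDensity_apply _ (hs i), integral_indicator (hs i),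
    ofReal_integral_eq_lintegral_ofReal hfi.integrableOn (Eventually.of_forall hf0)]

/-- The empirical measures of the first components of independent samples converge to the first
marginal. -/
lemma eventually_empirical_mem (hP : volume (P : Set (Rn n)) = 1) (hn : 0 < n)
    {G : Measure (Rn n × Rn n)} [IsProbabilityMeasure G] {ν : ProbOn μ₀.support}
    (hG : G.map Prod.fst = ν.meas) {U : Set (ProbOn μ₀.support)} (hU : IsOpen U) (hνU : ν ∈ U) :
    ∀ᶠ z : Sample (numPoints P) (Rn n × Rn n) in sampleFilter (numPoints P) G,
      ∃ κ ∈ U, κ.meas = empirical fun i => (z.2 i).1 := by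
  obtain ⟨O, hO, rfl⟩ := isOpen_induced_iff.1 hU
  set e : Sample (numPoints P) (Rn n × Rn n) → ProbabilityMeasure (Rn n) := fun z =>
    if h : 0 < numPoints P z.1 then empiricalProb h (fun i => (z.2 i).1) else ν.1 with he
  have hpos : ∀ᶠ z : Sample (numPoints P) (Rn n × Rn n) in sampleFilter (numPoints P) G,
      0 < numPoints P z.1 :=
    tendsto_fst_sampleFilter.eventually (eventually_numPoints_pos hP)
  have hlim : Tendsto e (sampleFilter (numPoints P) G) (𝓝 ν.1) := by
    rw [ProbabilityMeasure.tendsto_iff_forall_integral_tendsto]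
    intro g
    have hgm : Measurable fun a : Rn n × Rn n => g a.1 :=
      g.continuous.measurable.comp measurable_fst
    have h1 := tendsto_average_sampleFilter (G := G) (tendsto_numPoints hP hn)
      (h := fun a => g a.1) (MemLp.of_bound hgm.aestronglyMeasurable ‖g‖
        (Eventually.of_forall fun a => g.norm_coe_le_norm _))
    have h2 : ∫ a, g a.1 ∂G = ∫ x, g x ∂ν.meas := by
      rw [← hG, integral_map measurable_fst.aemeasurable g.continuous.aestronglyMeasurable]
    rw [h2] at h1
    refine h1.congr' ?_
    filter_upwards [hpos] with z hz
    simp only [he, dif_pos hz]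
    exact (integral_empiricalMeasure _ g.continuous.measurable).symm
  have hX : ∀ᵐ a ∂G, a.1 ∈ μ₀.support := by
    have h1 : ∀ᵐ x ∂G.map Prod.fst, x ∈ μ₀.support := by
      rw [hG]; exact mem_ae_iff.2 ν.2
    exact ae_of_ae_map measurable_fst.aemeasurable h1
  filter_upwards [hlim (hO.mem_nhds hνU), hpos, eventually_sampleFilter_forall hX] with z h1 h2 h3
  refine ⟨⟨empiricalProb h2 (fun i => (z.2 i).1), ?_⟩, ?_, rfl⟩
  · exact empiricalMeasure_apply_eq_zero Measure.isClosed_support.measurableSet.compl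
      fun i hi => hi (h3 i)
  · simp only [he, mem_preimage, dif_pos h2] at h1 ⊢
    exact h1

/-- Independent samples of a coupling whose first marginal has a bounded density, with compact
support, give many configurations of low energy near that marginal. Here `e^ℓ` is an upper bound of
the density, so that `-∫ ℓ` bounds its entropy. -/
theorem eventually_le_empiricalWeight (hP : volume (P : Set (Rn n)) = 1) (hn : 0 < n)
    (hw : IsCoerciveWeight P μ₀ φ₀) {G : Measure (Rn n × Rn n)} [IsProbabilityMeasure G]
    (hG₂ : G.map Prod.snd = unif P) {ν : ProbOn μ₀.support} (hG₁ : G.map Prod.fst = ν.meas)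
    {R : ℝ} (hR : ∀ᵐ a ∂G, ‖a.1‖ ≤ R) {f ℓ : Rn n → ℝ} (hf0 : ∀ x, 0 ≤ f x) (hfm : Measurable f)
    (hν : ν.meas = μ₀.withDensity fun x => ENNReal.ofReal (f x)) (hℓm : Measurable ℓ) {B : ℝ}
    (hℓB : ∀ x, |ℓ x| ≤ B) (hfℓ : ∀ x, f x ≤ Real.exp (ℓ x)) {U : Set (ProbOn μ₀.support)}
    (hU : IsOpen U) (hνU : ν ∈ U) {δ : ℝ} (hδ : 0 < δ) :
    ∀ᶠ k in atTop, ∀ c : ℝ, 0 ≤ c →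
      ENNReal.ofReal (Real.exp (-(numPoints P k * (c * (∫ z, cost φ₀ z ∂G + δ) +
        (∫ x, ℓ x ∂ν.meas + δ)) + Real.log 2))) ≤ empiricalWeight P μ₀ φ₀ k c U := by
  have hsf := hw.sigmaFinite
  have hcm : Continuous (cost φ₀) := continuous_cost hw.continuous
  have hmem : ∀ᵐ a ∂G, a.2 ∈ P := by
    have := ae_unif_mem P
    rw [← hG₂] at this
    exact ae_of_ae_map measurable_snd.aemeasurable this
  obtain ⟨C, hC⟩ := ((isCompact_closedBall (0 : Rn n) R).prod
    P.isCompact).exists_bound_of_continuousOn hcm.continuousOn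
  have hcL : MemLp (cost φ₀) 2 G := by
    refine MemLp.of_bound hcm.aestronglyMeasurable C ?_
    filter_upwards [hR, hmem] with a h1 h2
    exact hC a ⟨by simpa using h1, h2⟩
  have hℓL : MemLp (fun a : Rn n × Rn n => ℓ a.1) 2 G :=
    MemLp.of_bound (hℓm.comp measurable_fst).aestronglyMeasurable B
      (Eventually.of_forall fun a => hℓB _)
  have hℓint : ∫ a, ℓ a.1 ∂G = ∫ x, ℓ x ∂ν.meas := by
    rw [← hG₁, integral_map measurable_fst.aemeasurable hℓm.aestronglyMeasurable]
  set c₀ := ∫ z, cost φ₀ z ∂G with hc₀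
  set L := ∫ x, ℓ x ∂ν.meas with hL
  set R' := max R 1 with hR'
  have hR'0 : 0 < R' := lt_max_of_lt_right one_pos
  have hNlim := tendsto_numPoints hP hn
  -- good configurations: empirical measure in `U`, almost optimal energy, controlled density
  let S : (k : ℕ) → Set (Fin (numPoints P k) → Rn n) := fun k =>
    {x | (∃ κ ∈ U, κ.meas = empirical x) ∧ energy P φ₀ k x ≤ numPoints P k * (c₀ + δ) ∧
      ∑ i, ℓ (x i) ≤ numPoints P k * (L + δ)}
  have hS : ∀ᶠ z : Sample (numPoints P) (Rn n × Rn n) in sampleFilter (numPoints P) G,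
      (fun i => (z.2 i).1) ∈ S z.1 := by
    filter_upwards [eventually_empirical_mem hP hn hG₁ hU hνU,
      (tendsto_average_sampleFilter hNlim hcL).eventually_lt_const
        (show c₀ < c₀ + δ / 2 by linarith),
      (tendsto_average_sampleFilter hNlim hℓL).eventually_lt_const
        (show ∫ a, ℓ a.1 ∂G < L + δ by rw [hℓint]; linarith),
      eventually_exists_perm_sum_norm_le hP hn hG₂ (show 0 < δ / (2 * R') by positivity),
      eventually_sampleFilter_forall hR,
      tendsto_fst_sampleFilter.eventually_gt_atTop 0,
      tendsto_fst_sampleFilter.eventually (eventually_numPoints_pos hP)] with z h1 h2 h3 h4 h5 hk hN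
    have hN' : (0 : ℝ) < numPoints P z.1 := by exact_mod_cast hN
    rw [div_lt_iff₀ hN'] at h2 h3
    refine ⟨h1, ?_, by linarith⟩
    -- if `σ` sends the partner of the `i`-th particle to a lattice point, then `σ⁻¹` is the
    -- assignment of particles to lattice points whose cost bounds the energy
    obtain ⟨σ, hσ⟩ := h4
    refine (energy_le hk (fun i => (z.2 i).1) σ⁻¹).trans ?_
    rw [← Equiv.sum_comp σ]
    have h6 : ∀ i, cost φ₀ ((z.2 (σ⁻¹ (σ i))).1, scaledPt P z.1 (σ i)) ≤
        cost φ₀ (z.2 i) + R' * ‖(z.2 i).2 - scaledPt P z.1 (σ i)‖ := by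
      intro i
      have h7 := real_inner_le_norm (z.2 i).1 ((z.2 i).2 - scaledPt P z.1 (σ i))
      have h8 : ‖(z.2 i).1‖ ≤ R' := (h5 i).trans (le_max_left _ _)
      have h9 := mul_le_mul_of_nonneg_right h8 (norm_nonneg ((z.2 i).2 - scaledPt P z.1 (σ i)))
      rw [inner_sub_right] at h7
      have h12 : σ⁻¹ (σ i) = i := σ.symm_apply_apply i
      simp only [cost, h12]
      linarith
    refine (Finset.sum_le_sum fun i _ => h6 i).trans ?_
    rw [Finset.sum_add_distrib, ← Finset.mul_sum]
    have h10 := mul_le_mul_of_nonneg_left hσ hR'0.le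
    have h11 : R' * (numPoints P z.1 * (δ / (2 * R'))) = numPoints P z.1 * (δ / 2) := by
      field_simp
    linarith
  have hhalf : ∀ᶠ k in atTop, (2 : ℝ≥0∞)⁻¹ ≤ Measure.pi (fun _ : Fin (numPoints P k) => ν.meas)
      (S k) := by
    filter_upwards [(mem_sampleFilter.1 hS).eventually_lt_const
      (show (0 : ℝ≥0∞) < 2⁻¹ by simp)] with k hk
    have hmap : (Measure.pi fun _ : Fin (numPoints P k) => G).map (fun z i => (z i).1) =
        Measure.pi fun _ : Fin (numPoints P k) => ν.meas := by
      have := Measure.pi_map_pi (μ := fun _ : Fin (numPoints P k) => G)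
        (f := fun _ : Fin (numPoints P k) => (Prod.fst : Rn n × Rn n → Rn n))
        (hμ := fun _ => by rw [hG₁]; infer_instance) (fun _ => measurable_fst.aemeasurable)
      rw [this]
      simp_rw [hG₁]
    have hpm : Measurable fun (z : Fin (numPoints P k) → Rn n × Rn n) i => (z i).1 := by fun_prop
    rw [← hmap]
    refine le_trans ?_ (Measure.le_map_apply hpm.aemeasurable _)
    set A := (fun (z : Fin (numPoints P k) → Rn n × Rn n) i => (z i).1) ⁻¹' S k with hA
    have h1 : 1 ≤ Measure.pi (fun _ : Fin (numPoints P k) => G) A +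
        Measure.pi (fun _ : Fin (numPoints P k) => G) Aᶜ := by
      rw [← measure_univ (μ := Measure.pi fun _ : Fin (numPoints P k) => G),
        ← union_compl_self A]
      exact measure_union_le _ _
    have h2 : Measure.pi (fun _ : Fin (numPoints P k) => G) Aᶜ ≤ 2⁻¹ := hk.le
    have h3 := h1.trans (add_le_add_right h2 _)
    rw [← ENNReal.inv_two_add_inv_two] at h3
    exact (ENNReal.add_le_add_iff_right (by simp)).1 h3
  have hfi : Integrable f μ₀ := by
    refine ⟨hfm.aestronglyMeasurable, ?_⟩
    rw [hasFiniteIntegral_iff_ofReal (Eventually.of_forall hf0), ← setLIntegral_univ,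
      ← withDensity_apply _ MeasurableSet.univ, ← hν]
    exact measure_lt_top _ _
  filter_upwards [hhalf, eventually_gt_atTop 0] with k hk hk0 c hc
  set N := numPoints P k with hN
  set m := (Measure.pi fun _ : Fin (numPoints P k) => μ₀) (S k) with hm
  -- the density of the product of `ν` is at most `exp (N (L + δ))` on `S k`, so that `S k` has
  -- mass at least `exp (-N (L + δ)) / 2` for the product of `μ₀`
  have h1 : (2 : ℝ≥0∞)⁻¹ ≤ ENNReal.ofReal (Real.exp (N * (L + δ))) * m := by
    rw [pi_withDensity hf0 hfi hν, withDensity_apply' _ (S k)] at hk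
    refine hk.trans ((setLIntegral_mono measurable_const fun x hx => ?_).trans_eq
      (setLIntegral_const _ _))
    refine ENNReal.ofReal_le_ofReal ?_
    refine (Finset.prod_le_prod (fun i _ => hf0 _) fun i _ => hfℓ (x i)).trans ?_
    rw [← Real.exp_sum, Real.exp_le_exp]
    exact hx.2.2
  have h2 : ENNReal.ofReal (Real.exp (-c * (N * (c₀ + δ)))) * m ≤
      empiricalWeight P μ₀ φ₀ k c U := by
    rw [empiricalWeight, gibbsWeight_eq hk0]
    refine le_trans ?_ (measure_mono (show S k ⊆ _ from fun x hx => hx.1))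
    rw [withDensity_apply' _ (S k), hm, ← setLIntegral_const]
    have hme : Measurable fun x : Fin (numPoints P k) → Rn n =>
        ENNReal.ofReal (Real.exp (-c * energy P φ₀ k x)) :=
      (Real.continuous_exp.comp
        ((continuous_energy hw.continuous).const_mul (-c))).measurable.ennreal_ofReal
    refine setLIntegral_mono hme fun x hx => ENNReal.ofReal_le_ofReal (Real.exp_le_exp.2 ?_)
    have := mul_le_mul_of_nonneg_left hx.2.1 hc
    linarith
  refine le_trans ?_ h2
  have h3 : ENNReal.ofReal (Real.exp (-(N * (c * (c₀ + δ) + (L + δ)) + Real.log 2))) =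
      ENNReal.ofReal (Real.exp (-c * (N * (c₀ + δ)))) *
        (ENNReal.ofReal (Real.exp (-(N * (L + δ)))) * 2⁻¹) := by
    have h4 : (2 : ℝ≥0∞)⁻¹ = ENNReal.ofReal (Real.exp (-Real.log 2)) := by
      rw [Real.exp_neg, Real.exp_log two_pos, ENNReal.ofReal_inv_of_pos two_pos]
      simp
    rw [h4, ← ENNReal.ofReal_mul (Real.exp_pos _).le, ← ENNReal.ofReal_mul (Real.exp_pos _).le,
      ← Real.exp_add, ← Real.exp_add]
    congr 2
    ring
  rw [h3]
  gcongr
  calc ENNReal.ofReal (Real.exp (-(N * (L + δ)))) * 2⁻¹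
      ≤ ENNReal.ofReal (Real.exp (-(N * (L + δ)))) *
        (ENNReal.ofReal (Real.exp (N * (L + δ))) * m) := by gcongr
    _ = m := by
        rw [← mul_assoc, ← ENNReal.ofReal_mul (Real.exp_pos _).le, ← Real.exp_add,
          neg_add_cancel, Real.exp_zero, ENNReal.ofReal_one, one_mul]

end LowerBound

/-! ### Approximation of couplings by resampling the first component -/

section Resampling

open ProbabilityTheory

variable {G : Measure (Rn n × Rn n)} [IsProbabilityMeasure G]

/-- The law of `(y, p)`, where `(x, p)` has law `G` and `y` is drawn from `κ x`. -/
noncomputable def resample (G : Measure (Rn n × Rn n)) (κ : Kernel (Rn n) (Rn n)) :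
    Measure (Rn n × Rn n) :=
  (G ⊗ₘ κ.comap Prod.fst measurable_fst).map fun w => (w.2, w.1.2)

lemma measurable_resample_map :
    Measurable fun w : (Rn n × Rn n) × Rn n => (w.2, w.1.2) := by fun_prop

variable {κ : Kernel (Rn n) (Rn n)} [IsMarkovKernel κ]

instance isProbabilityMeasure_resample : IsProbabilityMeasure (resample G κ) :=
  Measure.isProbabilityMeasure_map measurable_resample_map.aemeasurable

lemma resample_map_snd : (resample G κ).map Prod.snd = G.map Prod.snd := by
  rw [resample, Measure.map_map measurable_snd measurable_resample_map,
    show (Prod.snd ∘ fun w : (Rn n × Rn n) × Rn n => (w.2, w.1.2)) = Prod.snd ∘ Prod.fst from rfl,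
    ← Measure.map_map measurable_snd measurable_fst]
  congr 1
  exact Measure.fst_compProd _ _

lemma resample_map_fst_apply {A : Set (Rn n)} (hA : MeasurableSet A) :
    (resample G κ).map Prod.fst A = ∫⁻ x, κ x A ∂G.map Prod.fst := by
  rw [resample, Measure.map_map measurable_fst measurable_resample_map,
    Measure.map_apply (measurable_fst.comp measurable_resample_map) hA,
    Measure.compProd_apply (measurable_fst.comp measurable_resample_map hA),
    lintegral_map (κ.measurable_coe hA) measurable_fst]
  rfl

lemma ae_resample {p : Rn n × Rn n → Prop} (hp : MeasurableSet {w | p w})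
    (h : ∀ᵐ z ∂G, ∀ᵐ y ∂κ z.1, p (y, z.2)) : ∀ᵐ w ∂resample G κ, p w := by
  rw [resample, ae_map_iff measurable_resample_map.aemeasurable hp]
  have hm : MeasurableSet {w : (Rn n × Rn n) × Rn n | p (w.2, w.1.2)} :=
    measurable_resample_map hp
  exact (Measure.ae_compProd_iff hm).2 h

lemma integral_resample {h : Rn n × Rn n → ℝ} (hh : Integrable h (resample G κ)) :
    ∫ w, h w ∂resample G κ = ∫ z, ∫ y, h (y, z.2) ∂κ z.1 ∂G := by
  rw [resample, integral_map measurable_resample_map.aemeasurable hh.1, Measure.integral_compProd]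
  · rfl
  · exact (integrable_map_measure hh.1 measurable_resample_map.aemeasurable).1 hh

/-- Probability measures concentrating at a point integrate continuous functions to the value at
that point. -/
lemma tendsto_integral_of_concentrating {m : ℕ → Measure (Rn n)} [∀ j, IsProbabilityMeasure (m j)]
    {x : Rn n} (hm : ∀ δ > 0, ∀ᶠ j in atTop, ∀ᵐ y ∂m j, dist y x < δ) {h : Rn n → ℝ}
    (hh : Continuous h) : Tendsto (fun j => ∫ y, h y ∂m j) atTop (𝓝 (h x)) := by
  rw [Metric.tendsto_nhds]
  intro ε hε
  obtain ⟨δ, hδ, hδε⟩ := Metric.continuous_iff.1 hh x (ε / 2) (half_pos hε)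
  filter_upwards [hm δ hδ] with j hj
  have h1 : ∀ᵐ y ∂m j, ‖h y - h x‖ ≤ ε / 2 := by
    filter_upwards [hj] with y hy
    rw [← dist_eq_norm]
    exact (hδε y hy).le
  have h2 : Integrable (fun y => h y - h x) (m j) :=
    (integrable_const (ε / 2)).mono' (hh.sub continuous_const).aestronglyMeasurable h1
  have h3 : Integrable h (m j) := by
    refine (h2.add (integrable_const (h x))).congr (Eventually.of_forall fun y => ?_)
    simp
  have h4 := norm_integral_le_of_norm_le_const h1
  rw [integral_sub h3 (integrable_const _), integral_const, probReal_univ, one_smul, mul_one] at h4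
  rw [dist_eq_norm]
  linarith

/-- Kernels `κ j` that approximate the identity for the purposes of the optimal transport problem
with cost `cost φ₀` and first marginal `ν`: the measures `κ j x` are uniformly bounded in `x`, are
carried by `X`, concentrate at `x` as `j` grows, and raise the absolute cost by a bounded amount
at most, which provides the domination for passing to the limit. -/
structure IsApproxKernel (P : ConvexBody (Rn n)) (φ₀ : Rn n → ℝ) (X : Set (Rn n))
    (ν : Measure (Rn n)) (κ : ℕ → Kernel (Rn n) (Rn n)) : Prop where
  markov : ∀ j, IsMarkovKernel (κ j)
  bounded : ∀ j, ∃ R, ∀ x, ∀ᵐ y ∂κ j x, ‖y‖ ≤ R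
  carried : ∀ j, ∀ᵐ x ∂ν, ∀ᵐ y ∂κ j x, y ∈ X
  concentrating : ∀ᵐ x ∂ν, ∀ δ > 0, ∀ᶠ j in atTop, ∀ᵐ y ∂κ j x, dist y x < δ
  cost_le : ∃ C, ∀ j x, ∀ p ∈ P, ∀ᵐ y ∂κ j x, |cost φ₀ (y, p)| ≤ |cost φ₀ (x, p)| + C

variable {ν : ProbOn μ₀.support} {κ : ℕ → Kernel (Rn n) (Rn n)}

/-- Resampling a coupling by approximations of the identity yields couplings with compact support
whose first marginals and costs converge. -/
theorem IsApproxKernel.exists_approx (hw : IsCoerciveWeight P μ₀ φ₀)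
    (hκ : IsApproxKernel P φ₀ μ₀.support ν.meas κ)
    (hG : IsCoupling P ν.meas G) (hi : Integrable (cost φ₀) G) :
    ∃ ξ : ℕ → ProbOn μ₀.support,
      (∀ j, (resample G (κ j)).map Prod.fst = (ξ j).meas) ∧
      (∀ j, (resample G (κ j)).map Prod.snd = unif P) ∧
      (∀ j, ∃ R, ∀ᵐ a ∂resample G (κ j), ‖a.1‖ ≤ R) ∧ Tendsto ξ atTop (𝓝 ν) ∧
      Tendsto (fun j => ∫ z, cost φ₀ z ∂resample G (κ j)) atTop (𝓝 (∫ z, cost φ₀ z ∂G)) := by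
  have := hκ.markov
  have hcm := continuous_cost hw.continuous
  have hXm : MeasurableSet μ₀.support := Measure.isClosed_support.measurableSet
  have hconc : ∀ᵐ z ∂G, ∀ δ > 0, ∀ᶠ j in atTop, ∀ᵐ y ∂κ j z.1, dist y z.1 < δ :=
    hG.ae_fst hκ.concentrating
  have hPG := hG.ae_snd (ae_unif_mem P)
  have hbd : ∀ j, ∃ R, ∀ᵐ a ∂resample G (κ j), ‖a.1‖ ≤ R := by
    intro j
    obtain ⟨R, hR⟩ := hκ.bounded j
    exact ⟨R, ae_resample (measurableSet_le (by fun_prop) measurable_const)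
      (Eventually.of_forall fun z => hR z.1)⟩
  have hcar : ∀ j, (resample G (κ j)).map Prod.fst (μ₀.support)ᶜ = 0 := by
    intro j
    rw [resample_map_fst_apply hXm.compl, hG.1,
      lintegral_eq_zero_iff ((κ j).measurable_coe hXm.compl)]
    filter_upwards [hκ.carried j] with x hx
    exact hx
  let ξ : ℕ → ProbOn μ₀.support := fun j =>
    ⟨⟨(resample G (κ j)).map Prod.fst,
      Measure.isProbabilityMeasure_map measurable_fst.aemeasurable⟩, hcar j⟩
  refine ⟨ξ, fun j => rfl, fun j => resample_map_snd.trans hG.2, hbd, ?_, ?_⟩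
  · rw [tendsto_subtype_rng, ProbabilityMeasure.tendsto_iff_forall_integral_tendsto]
    intro g
    have hgm : Measurable g := g.continuous.measurable
    have h1 : ∀ j, ∫ x, g x ∂((resample G (κ j)).map Prod.fst) =
        ∫ z, ∫ y, g y ∂κ j z.1 ∂G := by
      intro j
      rw [integral_map measurable_fst.aemeasurable g.continuous.aestronglyMeasurable]
      exact integral_resample (h := fun a => g a.1) ((integrable_const ‖g‖).mono'
        (hgm.comp measurable_fst).aestronglyMeasurable
        (Eventually.of_forall fun a => g.norm_coe_le_norm _))
    have h2 : ∫ x, g x ∂ν.meas = ∫ z, g z.1 ∂G := by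
      rw [← hG.1, integral_map measurable_fst.aemeasurable g.continuous.aestronglyMeasurable]
    change Tendsto (fun j => ∫ x, g x ∂((resample G (κ j)).map Prod.fst)) atTop
      (𝓝 (∫ x, g x ∂ν.meas))
    rw [h2]
    simp_rw [h1]
    refine tendsto_integral_of_dominated_convergence (fun _ => ‖g‖) (fun j => ?_)
      (integrable_const _) (fun j => Eventually.of_forall fun z => ?_) ?_
    · exact (g.continuous.stronglyMeasurable.integral_kernel.comp_measurable
        measurable_fst).aestronglyMeasurable
    · have := norm_integral_le_of_norm_le_const (μ := κ j z.1)
        (Eventually.of_forall fun y => g.norm_coe_le_norm y)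
      simpa using this
    · filter_upwards [hconc] with z hz
      exact tendsto_integral_of_concentrating hz g.continuous
  · obtain ⟨C, hC⟩ := hκ.cost_le
    have hint : ∀ j, Integrable (cost φ₀) (resample G (κ j)) := by
      intro j
      obtain ⟨R, hR⟩ := hbd j
      obtain ⟨D, hD⟩ := ((isCompact_closedBall (0 : Rn n) R).prod
        P.isCompact).exists_bound_of_continuousOn hcm.continuousOn
      refine (integrable_const D).mono' hcm.aestronglyMeasurable ?_
      have h1 : ∀ᵐ a ∂resample G (κ j), a.2 ∈ P :=
        ae_resample (P.isCompact.measurableSet.preimage measurable_snd) (by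
          filter_upwards [hPG] with z hz
          exact Eventually.of_forall fun _ => hz)
      filter_upwards [hR, h1] with a h2 h3
      exact hD a ⟨by simpa using h2, h3⟩
    simp_rw [fun j => integral_resample (hint j)]
    refine tendsto_integral_of_dominated_convergence (fun z => |cost φ₀ z| + C) (fun j => ?_)
      (hi.abs.add (integrable_const C)) (fun j => ?_) ?_
    · have h1 : StronglyMeasurable fun q : (Rn n × Rn n) × Rn n => cost φ₀ (q.2, q.1.2) :=
        (hcm.comp (by fun_prop : Continuous fun q : (Rn n × Rn n) × Rn n =>
          (q.2, q.1.2))).stronglyMeasurable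
      exact (h1.integral_kernel_prod_right'
        (κ := (κ j).comap Prod.fst measurable_fst)).aestronglyMeasurable
    · filter_upwards [hPG] with z hz
      have h : ∀ᵐ y ∂κ j z.1, ‖cost φ₀ (y, z.2)‖ ≤ |cost φ₀ z| + C := hC j z.1 z.2 hz
      simpa using norm_integral_le_of_norm_le_const h
    · filter_upwards [hconc] with z hz
      exact tendsto_integral_of_concentrating hz
        (hcm.comp (by fun_prop : Continuous fun y : Rn n => (y, z.2)))

end Resampling

/-! ### The lower bound for open sets -/

section LowerBound

open ProbabilityTheory

/-- The measure `m` has a density `f` with respect to `μ₀` that is dominated by `exp ℓ`, where `ℓ`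
is bounded and `∫ ℓ dm ≤ a`. The bounded function `ℓ` replaces `log f`, which is not defined where
`f` vanishes; thus the entropy of `m` is at most `a`. -/
def HasEntropyBound (μ₀ m : Measure (Rn n)) (a : ℝ) : Prop :=
  ∃ f ℓ : Rn n → ℝ, (∀ x, 0 ≤ f x) ∧ Measurable f ∧
    m = μ₀.withDensity (fun x => ENNReal.ofReal (f x)) ∧ Measurable ℓ ∧
    (∃ B, ∀ x, |ℓ x| ≤ B) ∧ (∀ x, f x ≤ Real.exp (ℓ x)) ∧ ∫ x, ℓ x ∂m ≤ a

lemma HasEntropyBound.eventually_le_empiricalWeight (hP : volume (P : Set (Rn n)) = 1)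
    (hn : 0 < n) (hw : IsCoerciveWeight P μ₀ φ₀) {G : Measure (Rn n × Rn n)}
    [IsProbabilityMeasure G] {ν : ProbOn μ₀.support} (hG₁ : G.map Prod.fst = ν.meas)
    (hG₂ : G.map Prod.snd = unif P) (hR : ∃ R, ∀ᵐ a ∂G, ‖a.1‖ ≤ R) {e : ℝ}
    (he : HasEntropyBound μ₀ ν.meas e) {U : Set (ProbOn μ₀.support)} (hU : IsOpen U)
    (hνU : ν ∈ U) {b : ℕ → ℝ} {a δ η : ℝ} (hδ : 0 < δ) (hη : 0 < η)
    (hb : ∀ᶠ k in atTop, 0 ≤ b k ∧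
      b k * (∫ z, cost φ₀ z ∂G + δ) + (e + δ) + η ≤ b k * a) :
    ∀ᶠ k in atTop, ENNReal.ofReal (Real.exp (-(numPoints P k * b k) * a)) ≤
      empiricalWeight P μ₀ φ₀ k (b k) U := by
  obtain ⟨R, hR⟩ := hR
  obtain ⟨f, ℓ, hf0, hfm, hν, hℓm, ⟨B, hB⟩, hfℓ, hle⟩ := he
  filter_upwards [PermanentalLDP.eventually_le_empiricalWeight hP hn hw hG₂ hG₁ hR hf0 hfm hν hℓm
    hB hfℓ hU hνU hδ, hb, (tendsto_numPoints hP hn).eventually_ge_atTop (Real.log 2 / η)]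
    with k h1 ⟨h2, h3⟩ h4
  refine le_trans (ENNReal.ofReal_le_ofReal (Real.exp_le_exp.2 ?_)) (h1 (b k) h2)
  rw [div_le_iff₀ hη] at h4
  have h5 : (numPoints P k : ℝ) * (b k * (∫ z, cost φ₀ z ∂G + δ) + (∫ x, ℓ x ∂ν.meas + δ) + η) ≤
      numPoints P k * (b k * a) :=
    mul_le_mul_of_nonneg_left (by linarith) (Nat.cast_nonneg _)
  linarith

lemma resample_map_fst {G : Measure (Rn n × Rn n)} [IsProbabilityMeasure G]
    {κ : Kernel (Rn n) (Rn n)} [IsMarkovKernel κ] :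
    (resample G κ).map Prod.fst = (G.map Prod.fst).bind κ := by
  ext A hA
  rw [resample_map_fst_apply hA, Measure.bind_apply hA κ.aemeasurable]

/-- A compact set of positive finite measure. -/
lemma exists_isCompact_pos (hw : IsCoerciveWeight P μ₀ φ₀) (hμ₀ : μ₀ ≠ 0) :
    ∃ S : Set (Rn n), IsCompact S ∧ μ₀ S ≠ 0 ∧ μ₀ S ≠ ∞ := by
  obtain ⟨x, hx⟩ := Measure.nonempty_support hμ₀
  have := hw.isFiniteMeasureOnCompacts
  exact ⟨Metric.closedBall x 1, isCompact_closedBall x 1,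
    ((Measure.mem_support_iff_forall x).1 hx _ (Metric.closedBall_mem_nhds x one_pos)).ne',
    (isCompact_closedBall x 1).measure_lt_top.ne⟩

lemma exists_abs_cost_le (hw : IsCoerciveWeight P μ₀ φ₀) {S : Set (Rn n)} (hS : IsCompact S) :
    ∃ C, 0 ≤ C ∧ ∀ y ∈ S, ∀ p ∈ P, |cost φ₀ (y, p)| ≤ C := by
  obtain ⟨C, hC⟩ := (hS.prod P.isCompact).exists_bound_of_continuousOn
    (continuous_cost hw.continuous).continuousOn
  exact ⟨max C 0, le_max_right _ _, fun y hy p hp => (hC (y, p) ⟨hy, hp⟩).trans (le_max_left _ _)⟩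

lemma ae_cond_mem_support (S : Set (Rn n)) : ∀ᵐ y ∂μ₀[|S], y ∈ μ₀.support :=
  cond_absolutelyContinuous.ae_le Measure.support_mem_ae

end LowerBound

/-! ### Truncation of densities -/

section Truncation

open ProbabilityTheory

/-- The kernel that fixes the points of `S` and draws from `τ` at the other points. -/
noncomputable def truncKernel {S : Set (Rn n)} (hS : MeasurableSet S) (τ : Measure (Rn n)) :
    Kernel (Rn n) (Rn n) :=
  open Classical in Kernel.piecewise hS Kernel.id (Kernel.const _ τ)

variable {S S₀ : Set (Rn n)} {τ ν : Measure (Rn n)}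

lemma truncKernel_of_mem (hS : MeasurableSet S) {x : Rn n} (hx : x ∈ S) :
    truncKernel hS τ x = Measure.dirac x := by
  simp [truncKernel, Kernel.piecewise_apply, hx, Kernel.id_apply]

lemma truncKernel_of_notMem (hS : MeasurableSet S) {x : Rn n} (hx : x ∉ S) :
    truncKernel hS τ x = τ := by
  simp [truncKernel, Kernel.piecewise_apply, hx]

lemma bind_truncKernel (hS : MeasurableSet S) :
    ν.bind (truncKernel hS τ) = ν.restrict S + ν Sᶜ • τ := by
  ext A hA
  rw [Measure.bind_apply hA (Kernel.aemeasurable _), ← lintegral_add_compl _ hS]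
  simp only [Measure.add_apply, Measure.smul_apply, smul_eq_mul]
  congr 1
  · rw [setLIntegral_congr_fun hS (g := A.indicator 1) (fun x hx => by
      simp only [truncKernel_of_mem hS hx, Measure.dirac_apply' x hA]), lintegral_indicator_one hA]
  · rw [setLIntegral_congr_fun hS.compl (g := fun _ => τ A)
      (fun x hx => by simp only [truncKernel_of_notMem hS hx]), setLIntegral_const, mul_comm]

/-- The density of the measure obtained by restricting `f` to `S` and adding mass `c`, uniformly
distributed over `S₀`. -/
noncomputable def truncDensity (μ₀ : Measure (Rn n)) (f : Rn n → ℝ) (S S₀ : Set (Rn n)) (c : ℝ)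
    (x : Rn n) : ℝ :=
  S.indicator f x + S₀.indicator (fun _ => c / μ₀.real S₀) x

variable {f : Rn n → ℝ} {c : ℝ}

lemma truncDensity_nonneg (hf : ∀ x, 0 ≤ f x) (hc : 0 ≤ c) (x : Rn n) :
    0 ≤ truncDensity μ₀ f S S₀ c x :=
  add_nonneg (indicator_nonneg (fun x _ => hf x) x)
    (indicator_nonneg (fun _ _ => div_nonneg hc measureReal_nonneg) x)

lemma measurable_truncDensity (hf : Measurable f) (hS : MeasurableSet S) (hS₀ : MeasurableSet S₀) :
    Measurable (truncDensity μ₀ f S S₀ c) :=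
  (hf.indicator hS).add (measurable_const.indicator hS₀)

lemma bind_truncKernel_eq_withDensity [IsFiniteMeasure ν] (hf : ∀ x, 0 ≤ f x) (hfm : Measurable f)
    (hν : ν = μ₀.withDensity fun x => ENNReal.ofReal (f x)) (hS : MeasurableSet S)
    (hS₀ : MeasurableSet S₀) (h0 : μ₀ S₀ ≠ 0) (htop : μ₀ S₀ ≠ ∞) :
    ν.bind (truncKernel hS μ₀[|S₀]) =
      μ₀.withDensity fun x => ENNReal.ofReal (truncDensity μ₀ f S S₀ (ν.real Sᶜ) x) := by
  have h1 : (fun x => ENNReal.ofReal (truncDensity μ₀ f S S₀ (ν.real Sᶜ) x)) =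
      S.indicator (fun x => ENNReal.ofReal (f x)) +
        S₀.indicator (fun _ => ν Sᶜ * (μ₀ S₀)⁻¹) := by
    funext x
    rw [truncDensity, ENNReal.ofReal_add (indicator_nonneg (fun x _ => hf x) x)
      (indicator_nonneg (fun _ _ => div_nonneg measureReal_nonneg measureReal_nonneg) x),
      Pi.add_apply]
    congr 1
    · by_cases hx : x ∈ S <;> simp [hx]
    · by_cases hx : x ∈ S₀
      · simp only [hx, indicator_of_mem]
        rw [ENNReal.ofReal_div_of_pos (y := μ₀.real S₀) (ENNReal.toReal_pos h0 htop),
          ofReal_measureReal, ofReal_measureReal htop, div_eq_mul_inv]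
      · simp [hx]
  rw [bind_truncKernel, h1, withDensity_add_left (hfm.ennreal_ofReal.indicator hS),
    withDensity_indicator hS, withDensity_indicator hS₀, withDensity_const,
    ← restrict_withDensity hS, ← hν, ProbabilityTheory.cond, smul_smul]

/-- Adding a small constant to a density changes its logarithm little. -/
lemma abs_log_add_le {u e : ℝ} (hu : 0 < u) (he : 0 ≤ e) :
    |Real.log (u + e)| ≤ |Real.log u| + e := by
  have h1 : Real.log u ≤ Real.log (u + e) := Real.log_le_log hu (by linarith)
  rcases le_total 1 u with h | h
  · have h2 : Real.log (u + e) ≤ Real.log u + e := by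
      rw [← Real.log_exp e, ← Real.log_mul hu.ne' (Real.exp_pos e).ne', Real.log_exp]
      refine Real.log_le_log (by linarith) ?_
      nlinarith [Real.add_one_le_exp e]
    have h3 := Real.log_nonneg h
    rw [abs_of_nonneg h3, abs_of_nonneg (h3.trans h1)]
    exact h2
  · have h2 : Real.log (u + e) ≤ e :=
      (Real.log_le_sub_one_of_pos (by linarith)).trans (by linarith)
    rw [abs_le]
    constructor
    · linarith [neg_abs_le (Real.log u)]
    · linarith [abs_nonneg (Real.log u)]

/-- A bounded density that is bounded below on the set where it does not vanish has a bounded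
logarithm. -/
lemma exists_abs_log_truncDensity_le (hc : 0 ≤ c) {l u : ℝ} (hl : 0 < l)
    (hSl : ∀ x ∈ S, l ≤ f x) (hSu : ∀ x ∈ S, f x ≤ u) :
    ∃ B, ∀ x, |Real.log (truncDensity μ₀ f S S₀ c x)| ≤ B := by
  set e := c / μ₀.real S₀ with he
  have he0 : 0 ≤ e := div_nonneg hc measureReal_nonneg
  refine ⟨max |Real.log l| |Real.log u| + e + |Real.log e|, fun x => ?_⟩
  have h0 := abs_nonneg (Real.log e)
  have h1 := (abs_nonneg (Real.log l)).trans (le_max_left |Real.log l| |Real.log u|)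
  have hlog : x ∈ S → |Real.log (f x)| ≤ max |Real.log l| |Real.log u| := fun hx =>
    abs_le_max_abs_abs (Real.log_le_log hl (hSl x hx))
      (Real.log_le_log (hl.trans_le (hSl x hx)) (hSu x hx))
  rw [truncDensity, ← he]
  by_cases hx : x ∈ S <;> by_cases hx0 : x ∈ S₀ <;> simp only [hx, hx0, indicator_of_mem,
    indicator_of_notMem, not_false_eq_true, add_zero, zero_add, Real.log_zero, abs_zero]
  · linarith [abs_log_add_le (hl.trans_le (hSl x hx)) he0, hlog hx]
  · linarith [hlog hx]
  · linarith
  · linarith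

/-- The entropy of a truncated density, up to an error that vanishes with the removed mass. -/
lemma hasEntropyBound_bind_truncKernel [IsProbabilityMeasure ν] (hf : ∀ x, 0 ≤ f x)
    (hfm : Measurable f) (hν : ν = μ₀.withDensity fun x => ENNReal.ofReal (f x))
    (hS : MeasurableSet S) (hS₀ : MeasurableSet S₀) (h0 : μ₀ S₀ ≠ 0) (htop : μ₀ S₀ ≠ ∞)
    {l u : ℝ} (hl : 0 < l) (hSl : ∀ x ∈ S, l ≤ f x) (hSu : ∀ x ∈ S, f x ≤ u) :
    HasEntropyBound μ₀ (ν.bind (truncKernel hS μ₀[|S₀]))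
      (∫ x, S.indicator (fun x => Real.log (truncDensity μ₀ f S S₀ (ν.real Sᶜ) x)) x ∂ν +
        ν.real Sᶜ / μ₀.real S₀) := by
  have hdens := bind_truncKernel_eq_withDensity hf hfm hν hS hS₀ h0 htop
  set c := ν.real Sᶜ with hc
  set h := truncDensity μ₀ f S S₀ c with hh
  have hc0 : 0 ≤ c := measureReal_nonneg
  have hh0 : ∀ x, 0 ≤ h x := truncDensity_nonneg hf hc0
  have hhm : Measurable h := measurable_truncDensity hfm hS hS₀
  have hlm : Measurable fun x => Real.log (h x) := hhm.log
  obtain ⟨B, hB⟩ := exists_abs_log_truncDensity_le (μ₀ := μ₀) (S₀ := S₀) hc0 hl hSl hSu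
  have hτ := cond_isProbabilityMeasure_of_finite h0 htop
  refine ⟨h, fun x => Real.log (h x), hh0, hhm, hdens, hlm, ⟨B, hB⟩, fun x => ?_, ?_⟩
  · rcases (hh0 x).eq_or_lt with h1 | h1
    · rw [← h1]; positivity
    · rw [Real.exp_log h1]
  have hi : ∀ m : Measure (Rn n), IsFiniteMeasure m → Integrable (fun x => Real.log (h x)) m :=
    fun m _ => (integrable_const B).mono' hlm.aestronglyMeasurable (Eventually.of_forall hB)
  have hτi : ∫ x, Real.log (h x) ∂μ₀[|S₀] ≤ 1 / μ₀.real S₀ := by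
    have h1 : ∫⁻ x, ENNReal.ofReal (h x) ∂μ₀[|S₀] ≤ (μ₀ S₀)⁻¹ := by
      rw [ProbabilityTheory.cond, lintegral_smul_measure, smul_eq_mul,
        ← withDensity_apply _ hS₀, ← hdens]
      have : IsProbabilityMeasure (ν.bind (truncKernel hS μ₀[|S₀])) := by
        unfold truncKernel; infer_instance
      exact mul_le_of_le_one_right' prob_le_one
    have h2 : Integrable h μ₀[|S₀] :=
      ⟨hhm.aestronglyMeasurable, by
        rw [hasFiniteIntegral_iff_ofReal (Eventually.of_forall hh0)]
        exact h1.trans_lt (ENNReal.inv_lt_top.2 (pos_iff_ne_zero.2 h0))⟩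
    refine (integral_mono (hi _ inferInstance) h2 fun x => Real.log_le_self (hh0 x)).trans ?_
    rw [integral_eq_lintegral_of_nonneg_ae (Eventually.of_forall hh0) hhm.aestronglyMeasurable,
      one_div, Measure.real, ← ENNReal.toReal_inv]
    exact ENNReal.toReal_mono (ENNReal.inv_ne_top.2 h0) h1
  rw [bind_truncKernel, integral_add_measure (hi _ inferInstance)
    ((hi _ inferInstance).smul_measure (measure_ne_top ν _)), integral_smul_measure,
    integral_indicator hS, smul_eq_mul]
  have h3 := mul_le_mul_of_nonneg_left hτi hc0
  rw [mul_one_div] at h3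
  exact add_le_add le_rfl h3

/-- A probability measure of finite entropy is approximated, along kernels, by measures with
compact support, bounded density and almost the same entropy. -/
theorem exists_isApproxKernel_of_integrable_llr (hw : IsCoerciveWeight P μ₀ φ₀) (hμ₀ : μ₀ ≠ 0)
    {ν : ProbOn μ₀.support} (hac : ν.meas ≪ μ₀) (hi : Integrable (llr ν.meas μ₀) ν.meas) :
    ∃ κ : ℕ → Kernel (Rn n) (Rn n), IsApproxKernel P φ₀ μ₀.support ν.meas κ ∧
      ∀ a, ∫ x, llr ν.meas μ₀ x ∂ν.meas < a →
        ∀ᶠ j in atTop, HasEntropyBound μ₀ (ν.meas.bind (κ j)) a := by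
  have := hw.sigmaFinite
  obtain ⟨S₀, hS₀c, h0, htop⟩ := exists_isCompact_pos hw hμ₀
  have hS₀ := hS₀c.measurableSet
  have hτ := cond_isProbabilityMeasure_of_finite h0 htop
  set f : Rn n → ℝ := fun x => (ν.meas.rnDeriv μ₀ x).toReal with hfdef
  have hf : ∀ x, 0 ≤ f x := fun x => ENNReal.toReal_nonneg
  have hfm : Measurable f := (Measure.measurable_rnDeriv _ _).ennreal_toReal
  have hν : ν.meas = μ₀.withDensity fun x => ENNReal.ofReal (f x) := by
    conv_lhs => rw [← Measure.withDensity_rnDeriv_eq _ _ hac]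
    refine withDensity_congr_ae ?_
    filter_upwards [Measure.rnDeriv_lt_top ν.meas μ₀] with x hx
    exact (ENNReal.ofReal_toReal hx.ne).symm
  have hfpos : ∀ᵐ x ∂ν.meas, 0 < f x := by
    filter_upwards [Measure.rnDeriv_pos hac, hac.ae_le (Measure.rnDeriv_lt_top ν.meas μ₀)]
      with x h1 h2
    exact ENNReal.toReal_pos h1.ne' h2.ne
  let S : ℕ → Set (Rn n) := fun j => {x | ‖x‖ ≤ j ∧ 1 / ((j : ℝ) + 1) ≤ f x ∧ f x ≤ j}
  have hS : ∀ j, MeasurableSet (S j) := fun j =>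
    (measurableSet_le measurable_norm measurable_const).inter
      ((measurableSet_le measurable_const hfm).inter (measurableSet_le hfm measurable_const))
  have hev : ∀ᵐ x ∂ν.meas, ∀ᶠ j in atTop, x ∈ S j := by
    filter_upwards [hfpos] with x hx
    filter_upwards [tendsto_natCast_atTop_atTop.eventually_ge_atTop ‖x‖,
      tendsto_natCast_atTop_atTop.eventually_ge_atTop (f x),
      tendsto_one_div_add_atTop_nhds_zero_nat.eventually_le_const hx] with j h1 h2 h3
    exact ⟨h1, h3, h2⟩
  obtain ⟨C, hC0, hC⟩ := exists_abs_cost_le hw hS₀c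
  obtain ⟨R, hR⟩ := hS₀c.isBounded.exists_norm_le
  refine ⟨fun j => truncKernel (hS j) μ₀[|S₀], ⟨fun j => ?_, fun j => ⟨max j R, fun x => ?_⟩,
    fun j => ?_, ?_, C, fun j x p hp => ?_⟩, fun a ha => ?_⟩
  · unfold truncKernel; infer_instance
  · by_cases hx : x ∈ S j
    · rw [truncKernel_of_mem _ hx, ae_dirac_eq, eventually_pure]
      exact hx.1.trans (le_max_left _ _)
    · rw [truncKernel_of_notMem _ hx]
      exact ae_cond_of_forall_mem hS₀ fun y hy => (hR y hy).trans (le_max_right _ _)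
  · filter_upwards [ae_iff.2 ν.2] with x hxX
    by_cases hx : x ∈ S j
    · rw [truncKernel_of_mem _ hx, ae_dirac_eq, eventually_pure]
      exact hxX
    · rw [truncKernel_of_notMem _ hx]
      exact ae_cond_mem_support S₀
  · filter_upwards [hev] with x hx δ hδ
    filter_upwards [hx] with j hj
    rw [truncKernel_of_mem _ hj, ae_dirac_eq, eventually_pure, dist_self]
    exact hδ
  · by_cases hx : x ∈ S j
    · rw [truncKernel_of_mem _ hx, ae_dirac_eq, eventually_pure]
      linarith
    · rw [truncKernel_of_notMem _ hx]
      refine ae_cond_of_forall_mem hS₀ fun y hy => (hC y hy p hp).trans ?_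
      linarith [abs_nonneg (cost φ₀ (x, p))]
  · have hcnn : ∀ j, 0 ≤ ν.meas.real (S j)ᶜ := fun j => measureReal_nonneg
    have hm0 : 0 < μ₀.real S₀ := ENNReal.toReal_pos h0 htop
    have hc : Tendsto (fun j => ν.meas.real (S j)ᶜ) atTop (𝓝 0) := by
      have h1 : ∀ j, ν.meas.real (S j)ᶜ = ∫ x, (S j)ᶜ.indicator (fun _ => (1 : ℝ)) x ∂ν.meas :=
        fun j => by rw [integral_indicator (hS j).compl, setIntegral_const, smul_eq_mul, mul_one]
      simp_rw [h1]
      rw [show (0 : ℝ) = ∫ _, (0 : ℝ) ∂ν.meas by simp]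
      refine tendsto_integral_of_dominated_convergence (fun _ => 1)
        (fun j => (measurable_const.indicator (hS j).compl).aestronglyMeasurable)
        (integrable_const _) (fun j => Eventually.of_forall fun x => ?_) ?_
      · by_cases hx : x ∈ S j <;> simp [hx]
      · filter_upwards [hev] with x hx
        refine tendsto_const_nhds.congr' ?_
        filter_upwards [hx] with j hj
        simp [hj]
    have he : Tendsto (fun j => ν.meas.real (S j)ᶜ / μ₀.real S₀) atTop (𝓝 0) := by
      simpa using hc.div_const (μ₀.real S₀)
    have hlim : Tendsto (fun j => ∫ x, (S j).indicator (fun x => Real.log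
        (truncDensity μ₀ f (S j) S₀ (ν.meas.real (S j)ᶜ) x)) x ∂ν.meas) atTop
        (𝓝 (∫ x, llr ν.meas μ₀ x ∂ν.meas)) := by
      refine tendsto_integral_of_dominated_convergence
        (fun x => |llr ν.meas μ₀ x| + 1 / μ₀.real S₀)
        (fun j => ((measurable_truncDensity hfm (hS j) hS₀).log.indicator
          (hS j)).aestronglyMeasurable) (hi.abs.add (integrable_const _)) (fun j => ?_) ?_
      · filter_upwards [hfpos] with x hx
        by_cases hxS : x ∈ S j
        · rw [indicator_of_mem hxS, truncDensity, indicator_of_mem hxS]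
          have h1 : 0 ≤ S₀.indicator (fun _ => ν.meas.real (S j)ᶜ / μ₀.real S₀) x :=
            indicator_nonneg (fun _ _ => div_nonneg (hcnn j) hm0.le) x
          have h2 : S₀.indicator (fun _ => ν.meas.real (S j)ᶜ / μ₀.real S₀) x ≤
              1 / μ₀.real S₀ := by
            refine (indicator_le_self' (fun _ _ => div_nonneg (hcnn j) hm0.le) x).trans ?_
            exact div_le_div_of_nonneg_right measureReal_le_one hm0.le
          exact (abs_log_add_le hx h1).trans (add_le_add le_rfl h2)
        · rw [indicator_of_notMem hxS, norm_zero]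
          positivity
      · filter_upwards [hfpos, hev] with x hx hxS
        have h1 : Tendsto (fun j => Real.log (f x + S₀.indicator
            (fun _ => ν.meas.real (S j)ᶜ / μ₀.real S₀) x)) atTop (𝓝 (llr ν.meas μ₀ x)) := by
          have h2 : Tendsto (fun j => S₀.indicator
              (fun _ => ν.meas.real (S j)ᶜ / μ₀.real S₀) x) atTop (𝓝 0) := by
            by_cases hx0 : x ∈ S₀
            · simpa [hx0] using he
            · simp [hx0]
          have h3 := (tendsto_const_nhds (x := f x)).add h2
          rw [add_zero] at h3
          exact h3.log hx.ne'
        refine h1.congr' ?_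
        filter_upwards [hxS] with j hj
        rw [indicator_of_mem hj, truncDensity, indicator_of_mem hj]
    have hsum := hlim.add he
    rw [add_zero] at hsum
    filter_upwards [hsum.eventually_le_const ha] with j hj
    obtain ⟨g, ℓ, h1, h2, h3, h4, h5, h6, h7⟩ := hasEntropyBound_bind_truncKernel hf hfm hν (hS j)
      hS₀ h0 htop (l := 1 / ((j : ℝ) + 1)) (u := j) (by positivity) (fun x hx => hx.2.1)
      (fun x hx => hx.2.2)
    exact ⟨g, ℓ, h1, h2, h3, h4, h5, h6, h7.trans hj⟩

end Truncation

/-! ### Smoothing by local averages -/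

section Smoothing

open ProbabilityTheory

lemma measurableSet_ball_prod {A : Set (Rn n)} (hA : MeasurableSet A) (ε : ℝ) :
    MeasurableSet {w : Rn n × Rn n | w.2 ∈ Metric.ball w.1 ε ∩ A} :=
  (measurableSet_lt (by fun_prop) measurable_const).inter (hA.preimage measurable_snd)

/-- The kernel that averages `μ₀` over the balls of radius `ε` centred at points of `K`, and is
constant equal to `τ` off `K`. -/
noncomputable def ballKernel (μ₀ : Measure (Rn n)) [SFinite μ₀] {K : Set (Rn n)}
    (hK : MeasurableSet K) (ε : ℝ) (τ : Measure (Rn n)) : Kernel (Rn n) (Rn n) :=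
  open Classical in Kernel.piecewise hK
    ⟨fun x => μ₀[|Metric.ball x ε], by
      refine Measure.measurable_of_measurable_coe _ fun A hA => ?_
      simp only [cond_apply Metric.isOpen_ball.measurableSet]
      refine Measurable.mul (Measurable.inv ?_) ?_
      · simpa using! measurable_measure_prodMk_left (ν := μ₀)
          (measurableSet_ball_prod MeasurableSet.univ ε)
      · exact measurable_measure_prodMk_left (ν := μ₀) (measurableSet_ball_prod hA ε)⟩
    (Kernel.const _ τ)

variable {K : Set (Rn n)} {ε : ℝ} {τ : Measure (Rn n)}

lemma ballKernel_of_mem [SFinite μ₀] (hK : MeasurableSet K) {x : Rn n} (hx : x ∈ K) :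
    ballKernel μ₀ hK ε τ x = μ₀[|Metric.ball x ε] := by
  simp [ballKernel, Kernel.piecewise_apply, hx]

lemma ballKernel_of_notMem [SFinite μ₀] (hK : MeasurableSet K) {x : Rn n} (hx : x ∉ K) :
    ballKernel μ₀ hK ε τ x = τ := by
  simp [ballKernel, Kernel.piecewise_apply, hx]

/-- Balls of a fixed radius centred in a compact part of the support have mass bounded below. -/
lemma exists_le_measure_ball (hK : IsCompact K) (hKX : K ⊆ μ₀.support)
    (hε : 0 < ε) : ∃ η : ℝ≥0∞, η ≠ 0 ∧ ∀ x ∈ K, η ≤ μ₀ (Metric.ball x ε) := by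
  refine hK.induction_on (p := fun s => ∃ η : ℝ≥0∞, η ≠ 0 ∧ ∀ x ∈ s, η ≤ μ₀ (Metric.ball x ε))
    ⟨1, one_ne_zero, by simp⟩ (fun s t hst ⟨η, h1, h2⟩ => ⟨η, h1, fun x hx => h2 x (hst hx)⟩)
    (fun s t ⟨η, h1, h2⟩ ⟨η', h1', h2'⟩ => ⟨min η η', ?_, ?_⟩) (fun x hx => ?_)
  · rcases min_choice η η' with h | h <;> rw [h] <;> assumption
  · rintro x (hx | hx)
    · exact (min_le_left _ _).trans (h2 x hx)
    · exact (min_le_right _ _).trans (h2' x hx)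
  · refine ⟨Metric.ball x (ε / 2),
      mem_nhdsWithin_of_mem_nhds (Metric.ball_mem_nhds x (by linarith)),
      μ₀ (Metric.ball x (ε / 2)), ?_, fun y hy => measure_mono ?_⟩
    · exact ((Measure.mem_support_iff_forall x).1 (hKX hx) _
        (Metric.ball_mem_nhds x (by linarith))).ne'
    · refine Metric.ball_subset_ball' ?_
      rw [Metric.mem_ball, dist_comm] at hy
      linarith

/-- A probability measure with bounded density has finite entropy. -/
lemma hasEntropyBound_of_le_smul [SigmaFinite μ₀] {m : Measure (Rn n)} [IsProbabilityMeasure m]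
    {B : ℝ≥0∞} (hB : B ≠ ∞) (h : m ≤ B • μ₀) : ∃ a, HasEntropyBound μ₀ m a := by
  have hac : m ≪ μ₀ := (Measure.absolutelyContinuous_of_le h).trans
    Measure.smul_absolutelyContinuous
  set f : Rn n → ℝ := fun x => min (m.rnDeriv μ₀ x).toReal (B.toReal + 1) with hf
  have hBn : 0 ≤ B.toReal := ENNReal.toReal_nonneg
  have hle : ∀ᵐ x ∂μ₀, m.rnDeriv μ₀ x ≤ B := by
    refine ae_le_of_forall_setLIntegral_le_of_sigmaFinite (m.measurable_rnDeriv μ₀) fun s hs _ => ?_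
    rw [setLIntegral_const]
    exact (Measure.setLIntegral_rnDeriv_le s).trans (h s)
  refine ⟨_, f, fun _ => Real.log (B.toReal + 1), fun x => le_min ENNReal.toReal_nonneg
    (by linarith), (Measure.measurable_rnDeriv _ _).ennreal_toReal.min measurable_const, ?_,
    measurable_const, ⟨_, fun _ => le_rfl⟩, fun x => ?_, le_rfl⟩
  · conv_lhs => rw [← Measure.withDensity_rnDeriv_eq _ _ hac]
    refine withDensity_congr_ae ?_
    filter_upwards [hle] with x hx
    rw [hf]
    simp only
    rw [min_eq_left ((ENNReal.toReal_mono hB hx).trans (by linarith)),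
      ENNReal.ofReal_toReal (ne_top_of_le_ne_top hB hx)]
  · rw [Real.exp_log (by linarith)]
    exact min_le_right _ _

/-- Radii for which the cost varies by at most one over the balls centred in a compact set. -/
lemma exists_radius (hw : IsCoerciveWeight P μ₀ φ₀) (hK : IsCompact K) {r : ℝ} (hr : 0 < r) :
    ∃ ε, 0 < ε ∧ ε ≤ r ∧ ∀ x ∈ K, ∀ y, dist y x < ε → ∀ p ∈ P,
      |cost φ₀ (y, p)| ≤ |cost φ₀ (x, p)| + 1 := by
  have hu := (hK.cthickening (r := 1)).prod P.isCompact |>.uniformContinuousOn_of_continuous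
    (continuous_cost hw.continuous).continuousOn
  obtain ⟨δ, hδ, h⟩ := Metric.uniformContinuousOn_iff.1 hu 1 one_pos
  refine ⟨min (min δ 1) r, lt_min (lt_min hδ one_pos) hr, min_le_right _ _,
    fun x hx y hy p hp => ?_⟩
  have h1 : dist y x < δ := hy.trans_le ((min_le_left _ _).trans (min_le_left _ _))
  have h2 : dist y x ≤ 1 := (hy.trans_le ((min_le_left _ _).trans (min_le_right _ _))).le
  have h3 := h (y, p) ⟨Metric.mem_cthickening_of_dist_le y x 1 K hx h2, hp⟩ (x, p)
    ⟨Metric.self_subset_cthickening K hx, hp⟩ (by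
      rw [Prod.dist_eq, dist_self, max_eq_left dist_nonneg]; exact h1)
  rw [Real.dist_eq] at h3
  linarith [abs_sub_abs_le_abs_sub (cost φ₀ (y, p)) (cost φ₀ (x, p))]

/-- Any probability measure on the support is approximated, along kernels, by measures with
compact support and bounded density. -/
theorem exists_isApproxKernel (hw : IsCoerciveWeight P μ₀ φ₀) (hμ₀ : μ₀ ≠ 0)
    (ν : ProbOn μ₀.support) :
    ∃ κ : ℕ → Kernel (Rn n) (Rn n), IsApproxKernel P φ₀ μ₀.support ν.meas κ ∧
      ∀ j, ∃ a, HasEntropyBound μ₀ (ν.meas.bind (κ j)) a := by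
  have := hw.sigmaFinite
  have := hw.isFiniteMeasureOnCompacts
  obtain ⟨S₀, hS₀c, h0, htop⟩ := exists_isCompact_pos hw hμ₀
  have hS₀ := hS₀c.measurableSet
  have hτ := cond_isProbabilityMeasure_of_finite h0 htop
  let K : ℕ → Set (Rn n) := fun j => Metric.closedBall 0 j ∩ μ₀.support
  have hKc : ∀ j, IsCompact (K j) := fun j =>
    (isCompact_closedBall _ _).inter_right Measure.isClosed_support
  have hK : ∀ j, MeasurableSet (K j) := fun j => (hKc j).measurableSet
  have hrad : ∀ j : ℕ, _ := fun j => exists_radius hw (hKc j)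
    (r := 1 / ((j : ℝ) + 1)) (by positivity)
  choose ε hε hεr hεc using hrad
  have hball0 : ∀ j, ∀ x ∈ K j, μ₀ (Metric.ball x (ε j)) ≠ 0 := fun j x hx =>
    ((Measure.mem_support_iff_forall x).1 hx.2 _ (Metric.ball_mem_nhds x (hε j))).ne'
  have hballt : ∀ (x : Rn n) r, μ₀ (Metric.ball x r) ≠ ∞ := fun x r =>
    ((measure_mono Metric.ball_subset_closedBall).trans_lt
      (isCompact_closedBall x r).measure_lt_top).ne
  have hmarkov : ∀ j, IsMarkovKernel (ballKernel μ₀ (hK j) (ε j) μ₀[|S₀]) := by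
    refine fun j => ⟨fun x => ?_⟩
    by_cases hx : x ∈ K j
    · rw [ballKernel_of_mem _ hx]
      exact cond_isProbabilityMeasure_of_finite (hball0 j x hx) (hballt x _)
    · rwa [ballKernel_of_notMem _ hx]
  have hev : ∀ᵐ x ∂ν.meas, ∀ᶠ j in atTop, x ∈ K j := by
    filter_upwards [ae_iff.2 ν.2] with x hx
    filter_upwards [tendsto_natCast_atTop_atTop.eventually_ge_atTop ‖x‖] with j hj
    exact ⟨by simpa using hj, hx⟩
  obtain ⟨C, hC0, hC⟩ := exists_abs_cost_le hw hS₀c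
  obtain ⟨R, hR⟩ := hS₀c.isBounded.exists_norm_le
  refine ⟨fun j => ballKernel μ₀ (hK j) (ε j) μ₀[|S₀], ⟨hmarkov, fun j => ⟨max (j + ε j) R,
    fun x => ?_⟩, fun j => Eventually.of_forall fun x => ?_, ?_, C + 1, fun j x p hp => ?_⟩,
    fun j => ?_⟩
  · by_cases hx : x ∈ K j
    · rw [ballKernel_of_mem _ hx]
      refine ae_cond_of_forall_mem Metric.isOpen_ball.measurableSet fun y hy => ?_
      have h1 : ‖x‖ ≤ j := by simpa using hx.1
      have h2 : ‖y - x‖ < ε j := by rwa [← dist_eq_norm]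
      refine le_trans ?_ (le_max_left _ _)
      calc ‖y‖ = ‖x + (y - x)‖ := by rw [add_sub_cancel]
        _ ≤ ‖x‖ + ‖y - x‖ := norm_add_le _ _
        _ ≤ j + ε j := add_le_add h1 h2.le
    · rw [ballKernel_of_notMem _ hx]
      exact ae_cond_of_forall_mem hS₀ fun y hy => (hR y hy).trans (le_max_right _ _)
  · by_cases hx : x ∈ K j
    · rw [ballKernel_of_mem _ hx]
      exact ae_cond_mem_support _
    · rw [ballKernel_of_notMem _ hx]
      exact ae_cond_mem_support _
  · filter_upwards [hev] with x hx δ hδ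
    filter_upwards [hx, tendsto_one_div_add_atTop_nhds_zero_nat.eventually_le_const hδ]
      with j hj hj2
    rw [ballKernel_of_mem _ hj]
    exact ae_cond_of_forall_mem Metric.isOpen_ball.measurableSet fun y hy =>
      (Metric.mem_ball.1 hy).trans_le ((hεr j).trans hj2)
  · by_cases hx : x ∈ K j
    · rw [ballKernel_of_mem _ hx]
      refine ae_cond_of_forall_mem Metric.isOpen_ball.measurableSet fun y hy => ?_
      linarith [hεc j x hx y hy p hp]
    · rw [ballKernel_of_notMem _ hx]
      refine ae_cond_of_forall_mem hS₀ fun y hy => (hC y hy p hp).trans ?_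
      linarith [abs_nonneg (cost φ₀ (x, p))]
  · obtain ⟨η, hη, hηle⟩ := exists_le_measure_ball (hKc j) inter_subset_right (hε j)
    have := hmarkov j
    refine hasEntropyBound_of_le_smul (B := max η⁻¹ (μ₀ S₀)⁻¹)
      (max_lt (ENNReal.inv_lt_top.2 (pos_iff_ne_zero.2 hη))
        (ENNReal.inv_lt_top.2 (pos_iff_ne_zero.2 h0))).ne (Measure.le_iff.2 fun A hA => ?_)
    rw [Measure.bind_apply hA (Kernel.aemeasurable _), Measure.smul_apply, smul_eq_mul]
    have h1 : ∀ x, ballKernel μ₀ (hK j) (ε j) μ₀[|S₀] x A ≤ max η⁻¹ (μ₀ S₀)⁻¹ * μ₀ A := by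
      intro x
      by_cases hx : x ∈ K j
      · rw [ballKernel_of_mem _ hx, cond_apply' hA]
        exact mul_le_mul' ((ENNReal.inv_le_inv.2 (hηle x hx)).trans (le_max_left _ _))
          (measure_mono inter_subset_right)
      · rw [ballKernel_of_notMem _ hx, cond_apply' hA]
        exact mul_le_mul' (le_max_right _ _) (measure_mono inter_subset_right)
    refine (lintegral_mono h1).trans ?_
    rw [lintegral_const, measure_univ, mul_one]

end Smoothing

section LowerBound

/-- The lower bound at infinite inverse temperature: smoothing makes the entropy finite, and any
finite entropy is negligible at the speed `N b`. -/
theorem eventually_le_empiricalWeight_top (hP : volume (P : Set (Rn n)) = 1) (hn : 0 < n)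
    (hw : IsCoerciveWeight P μ₀ φ₀) (hμ₀ : μ₀ ≠ 0) {b : ℕ → ℝ} (hb : Tendsto b atTop atTop)
    {U : Set (ProbOn μ₀.support)} (hU : IsOpen U) {ν : ProbOn μ₀.support} (hν : ν ∈ U) {a : ℝ}
    (ha : freeEnergy P μ₀ φ₀ ⊤ ν < a) :
    ∀ᶠ k in atTop, ENNReal.ofReal (Real.exp (-(numPoints P k * b k) * a)) ≤
      empiricalWeight P μ₀ φ₀ k (b k) U := by
  rw [freeEnergy_top] at ha
  obtain ⟨G, hG, hi, hGa⟩ := exists_coupling_of_transportCost_lt hw ha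
  have hGa' : ∫ z, cost φ₀ z ∂G < a := by exact_mod_cast hGa
  have := hG.isProbabilityMeasure
  obtain ⟨κ, hκ, hent⟩ := exists_isApproxKernel hw hμ₀ ν
  have := hκ.markov
  obtain ⟨ξ, h1, h2, h3, h4, h5⟩ := hκ.exists_approx hw hG hi
  obtain ⟨j, hj1, hj2⟩ := ((h5.eventually_lt_const hGa').and
    (h4.eventually (hU.mem_nhds hν))).exists
  obtain ⟨e, he⟩ := hent j
  rw [← hG.1, ← resample_map_fst, h1 j] at he
  set c := ∫ z, cost φ₀ z ∂resample G (κ j) with hc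
  refine he.eventually_le_empiricalWeight hP hn hw (h1 j) (h2 j) (h3 j) hU hj2
    (δ := (a - c) / 2) (η := 1) (by linarith) one_pos ?_
  filter_upwards [hb.eventually_ge_atTop 0,
    (hb.atTop_mul_const (by linarith : 0 < (a - c) / 2)).eventually_ge_atTop
      (e + (a - c) / 2 + 1)] with k hk1 hk2
  exact ⟨hk1, by linarith⟩

/-- The lower bound at finite inverse temperature. -/
theorem eventually_le_empiricalWeight_coe (hP : volume (P : Set (Rn n)) = 1) (hn : 0 < n)
    (hw : IsCoerciveWeight P μ₀ φ₀) (hμ₀ : μ₀ ≠ 0) {β : ℝ} (hβ : 0 < β) {b : ℕ → ℝ}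
    (hb : Tendsto b atTop (𝓝 β)) {U : Set (ProbOn μ₀.support)} (hU : IsOpen U)
    {ν : ProbOn μ₀.support} (hν : ν ∈ U) {a : ℝ} (ha : freeEnergy P μ₀ φ₀ β ν < a) :
    ∀ᶠ k in atTop, ENNReal.ofReal (Real.exp (-(numPoints P k * b k) * a)) ≤
      empiricalWeight P μ₀ φ₀ k (b k) U := by
  obtain ⟨t, ht, -, hac, hll, heq⟩ := freeEnergy_coe_of_ne_top hw hβ (ha.trans_le le_top).ne
  rw [heq, EReal.coe_lt_coe_iff] at ha
  set D := ∫ x, llr ν.meas μ₀ x ∂ν.meas with hD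
  -- the gap is split between the optimal cost, the costs and entropies of the approximations,
  -- and the tolerances of the bound for compactly supported couplings
  set g := a - (t + D / β) with hg
  have hg0 : 0 < g := by linarith
  obtain ⟨G, hG, hi, hGa⟩ := exists_coupling_of_transportCost_lt hw
    (a := ((t + g / 8 : ℝ) : EReal)) (ν := ν.meas)
    (by rw [ht, EReal.coe_lt_coe_iff]; linarith)
  have hGa' : ∫ z, cost φ₀ z ∂G < t + g / 8 := by exact_mod_cast hGa
  have := hG.isProbabilityMeasure
  obtain ⟨κ, hκ, hent⟩ := exists_isApproxKernel_of_integrable_llr hw hμ₀ hac hll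
  have := hκ.markov
  obtain ⟨ξ, h1, h2, h3, h4, h5⟩ := hκ.exists_approx hw hG hi
  obtain ⟨j, ⟨hj1, hj2⟩, he⟩ := (((h5.eventually_lt_const hGa').and
    (h4.eventually (hU.mem_nhds hν))).and (hent (D + β * (g / 8))
      (by linarith [mul_pos hβ hg0]))).exists
  rw [← hG.1, ← resample_map_fst, h1 j] at he
  set c := ∫ z, cost φ₀ z ∂resample G (κ j) with hc
  set δ := min (g / 8) (β * (g / 8)) with hδ
  have hβg : 0 < β * (g / 8) := by positivity
  have hδ0 : 0 < δ := lt_min (by linarith) hβg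
  refine he.eventually_le_empiricalWeight hP hn hw (h1 j) (h2 j) (h3 j) hU hj2
    (δ := δ) (η := β * (g / 8)) hδ0 hβg ?_
  have hlim : Tendsto (fun k => b k * (a - (c + δ))) atTop (𝓝 (β * (a - (c + δ)))) :=
    hb.mul_const _
  have hlt : D + β * (g / 8) + δ + β * (g / 8) < β * (a - (c + δ)) := by
    have h6 : δ ≤ g / 8 := min_le_left _ _
    have h7 : δ ≤ β * (g / 8) := min_le_right _ _
    have h8 : β * (D / β) = D := mul_div_cancel₀ _ hβ.ne'
    have h9 : β * (D / β + 6 * (g / 8)) ≤ β * (a - (c + δ)) :=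
      mul_le_mul_of_nonneg_left (by linarith) hβ.le
    rw [mul_add, h8] at h9
    linarith
  filter_upwards [hb.eventually_const_lt hβ, hlim.eventually_const_lt hlt] with k hk1 hk2
  exact ⟨hk1.le, by linarith⟩

end LowerBound

/-! ### The large deviation principle for coercive weights -/

section CoerciveWeights

lemma ae_pi_forall_mem_support [SigmaFinite μ₀] (N : ℕ) :
    ∀ᵐ x ∂Measure.pi fun _ : Fin N => μ₀, ∀ i, x i ∈ μ₀.support :=
  ae_all_iff.2 fun i => (Measure.tendsto_eval_ae_ae (μ := fun _ : Fin N => μ₀) (i := i)).eventually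
    Measure.support_mem_ae

/-- Almost every configuration lies in the support, so that its empirical measure is an element
of `M₁(X)`. -/
lemma empiricalWeight_univ (hw : IsCoerciveWeight P μ₀ φ₀) {k : ℕ} (hN : 0 < numPoints P k)
    (b : ℝ) : empiricalWeight P μ₀ φ₀ k b univ = gibbsWeight P μ₀ φ₀ k b univ := by
  have := hw.sigmaFinite
  refine measure_congr (eventuallyEq_univ.2 ?_)
  refine (withDensity_absolutelyContinuous _ _).ae_le ?_
  filter_upwards [ae_pi_forall_mem_support (μ₀ := μ₀) (numPoints P k)] with x hx
  exact ⟨⟨empiricalProb hN x, empiricalMeasure_apply_eq_zero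
    Measure.isClosed_support.measurableSet.compl fun i hi => hi (hx i)⟩, mem_univ _, rfl⟩

lemma empiricalLaw_eq (hw : IsCoerciveWeight P μ₀ φ₀) (k : ℕ) (b : ℝ)
    (A : Set (ProbOn μ₀.support)) :
    empiricalLaw P μ₀ φ₀ k b A =
      (empiricalWeight P μ₀ φ₀ k b univ)⁻¹ * empiricalWeight P μ₀ φ₀ k b A := by
  rw [empiricalLaw, gibbs, Measure.smul_apply, smul_eq_mul, ← empiricalWeight]
  rcases Nat.eq_zero_or_pos (numPoints P k) with hN | hN
  · have h : empiricalWeight P μ₀ φ₀ k b A = 0 := by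
      -- without lattice points the empirical measure is zero
      have hempty : {x : Fin (numPoints P k) → Rn n | ∃ ν ∈ A, ν.meas = empirical x} = ∅ := by
        refine eq_empty_of_forall_notMem fun x hx => ?_
        obtain ⟨ν, -, hν⟩ := hx
        have h1 : ν.meas univ = 1 := measure_univ
        have : IsEmpty (Fin (numPoints P k)) := by rw [hN]; infer_instance
        rw [hν, empirical, Measure.smul_apply, Finset.univ_eq_empty, Finset.sum_empty] at h1
        simp at h1
      rw [empiricalWeight, hempty, measure_empty]
    rw [h, mul_zero, mul_zero]
  · rw [empiricalWeight_univ hw hN]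

variable {β : EReal} {b : ℕ → ℝ}

/-- The weights of the Gibbs measures satisfy the hypotheses of the abstract large deviation
principle with speed `N β_N` and the free energy as unnormalized rate. -/
theorem hasExpBounds_empiricalWeight (hP : volume (P : Set (Rn n)) = 1) (hn : 0 < n)
    (hw : IsCoerciveWeight P μ₀ φ₀) (hμ₀ : μ₀ ≠ 0) (hβ : 0 < β)
    (hb : Tendsto (fun k => (b k : EReal)) atTop (𝓝 β)) :
    HasExpBounds (fun k => empiricalWeight P μ₀ φ₀ k (b k)) (fun k => numPoints P k * b k)
      (freeEnergy P μ₀ φ₀ β) := by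
  obtain ⟨t, ht, htβ⟩ := EReal.lt_iff_exists_real_btwn.1 hβ
  have ht' : 0 < t := by exact_mod_cast ht
  have hbt : ∀ᶠ k in atTop, t ≤ b k :=
    (hb.eventually_const_lt htβ).mono fun k hk => by exact_mod_cast hk.le
  refine ⟨?_, fun k => by simp [empiricalWeight], fun k A B hAB => measure_mono ?_,
    fun k A B => ?_, fun ν a ha => ?_, fun a => ?_, fun A hA ν hν a ha => ?_⟩
  · refine tendsto_atTop_mono' atTop ?_ ((tendsto_numPoints hP hn).atTop_mul_const ht')
    filter_upwards [hbt] with k hk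
    exact mul_le_mul_of_nonneg_left hk (Nat.cast_nonneg _)
  · rintro x ⟨ν, hν, h⟩
    exact ⟨ν, hAB hν, h⟩
  · refine (measure_mono ?_).trans (measure_union_le _ _)
    rintro x ⟨ν, hν | hν, h⟩
    · exact Or.inl ⟨ν, hν, h⟩
    · exact Or.inr ⟨ν, hν, h⟩
  · induction β with
    | bot => exact absurd hβ not_lt_bot
    | top =>
      exact exists_isOpen_empiricalWeight_le_top hP hw hμ₀
        (EReal.tendsto_coe_nhds_top_iff.1 hb) ha
    | coe β =>
      exact exists_isOpen_empiricalWeight_le_coe hP hw hμ₀ (by exact_mod_cast hβ)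
        (EReal.tendsto_coe.1 hb) ha
  · exact exists_isCompact_empiricalWeight_compl_le hP hw hμ₀ (t := t / 2) (by linarith)
      (by filter_upwards [hbt] with k hk; linarith) a
  · induction β with
    | bot => exact absurd hβ not_lt_bot
    | top =>
      exact eventually_le_empiricalWeight_top hP hn hw hμ₀
        (EReal.tendsto_coe_nhds_top_iff.1 hb) hA hν ha
    | coe β =>
      exact eventually_le_empiricalWeight_coe hP hn hw hμ₀ (by exact_mod_cast hβ)
        (EReal.tendsto_coe.1 hb) hA hν ha

/-- The large deviation principle, and convergence to the unique minimizer of the free energy. -/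
theorem satisfiesLDP_and_empiricalConvergesTo (hP : volume (P : Set (Rn n)) = 1) (hn : 0 < n)
    (hw : IsCoerciveWeight P μ₀ φ₀) (hμ₀ : μ₀ ≠ 0) (hβ : 0 < β)
    (hb : Tendsto (fun k => (b k : EReal)) atTop (𝓝 β)) {μ : ProbOn μ₀.support} {C : ℝ}
    (hμ : freeEnergy P μ₀ φ₀ β μ = C)
    (hC : ∀ ν, ν ≠ μ → (C : EReal) < freeEnergy P μ₀ φ₀ β ν) :
    ((⨅ ν, (freeEnergy P μ₀ φ₀ β ν - (C : EReal))) = 0 ∧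
      SatisfiesLDP (fun k => empiricalLaw P μ₀ φ₀ k (b k)) (fun k => numPoints P k * b k)
        (fun ν => freeEnergy P μ₀ φ₀ β ν - (C : EReal))) ∧
    EmpiricalConvergesTo P μ₀ φ₀ b μ := by
  have h := hasExpBounds_empiricalWeight hP hn hw hμ₀ hβ hb
  have hle : ∀ ν, (C : EReal) ≤ freeEnergy P μ₀ φ₀ β ν := fun ν => by
    by_cases hν : ν = μ
    · rw [hν, hμ]
    · exact (hC ν hν).le
  have hldp : SatisfiesLDP (fun k => empiricalLaw P μ₀ φ₀ k (b k)) (fun k => numPoints P k * b k)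
      (fun ν => freeEnergy P μ₀ φ₀ β ν - (C : EReal)) := by
    have h1 : (fun k => empiricalLaw P μ₀ φ₀ k (b k)) = fun k A =>
        (empiricalWeight P μ₀ φ₀ k (b k) univ)⁻¹ * empiricalWeight P μ₀ φ₀ k (b k) A := by
      funext k A
      exact empiricalLaw_eq hw k (b k) A
    rw [h1]
    exact h.satisfiesLDP hμ hle
  refine ⟨⟨le_antisymm ?_ (le_iInf hldp.nonneg), hldp⟩, fun U hU hμU => ?_⟩
  · refine (iInf_le _ μ).trans ?_
    rw [hμ, EReal.sub_self (EReal.coe_ne_top C) (EReal.coe_ne_bot C)]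
  have h0 := h.tendsto_zero hμ hC hU.isClosed_compl (fun h => h hμU)
  simp only [← empiricalLaw_eq hw] at h0
  have h1 : Tendsto (fun k => 1 - empiricalLaw P μ₀ φ₀ k (b k) Uᶜ) atTop (𝓝 1) := by
    simpa using ENNReal.Tendsto.sub (tendsto_const_nhds (x := (1 : ℝ≥0∞))) h0
      (Or.inl ENNReal.one_ne_top)
  have hbpos : ∀ᶠ k in atTop, 0 < b k :=
    (hb.eventually_const_lt hβ).mono fun k hk => by exact_mod_cast hk
  refine tendsto_of_tendsto_of_tendsto_of_le_of_le' h1 tendsto_const_nhds ?_ ?_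
  · filter_upwards [hbpos, eventually_gt_atTop 0, eventually_numPoints_pos hP] with k hbk hk hN
    rw [tsub_le_iff_right]
    have h2 : empiricalLaw P μ₀ φ₀ k (b k) univ = 1 := by
      rw [empiricalLaw_eq hw]
      exact ENNReal.inv_mul_cancel
        (by rw [empiricalWeight_univ hw hN]; exact gibbsWeight_univ_ne_zero hw hμ₀ hk _)
        (by rw [empiricalWeight_univ hw hN]; exact gibbsWeight_univ_ne_top hw hμ₀ hk hbk)
    rw [← h2]
    refine (measure_mono ?_).trans (measure_union_le _ _)
    rintro x ⟨ν, -, hν⟩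
    by_cases hνU : ν ∈ U
    · exact Or.inl ⟨ν, hνU, hν⟩
    · exact Or.inr ⟨ν, hνU, hν⟩
  · filter_upwards [hbpos, eventually_gt_atTop 0] with k hbk hk
    have := isProbabilityMeasure_gibbs hw hμ₀ hk hbk
    exact prob_le_one

/-- The assertions for a weight that is continuous and coercive on the whole space. -/
theorem IsCoerciveWeight.main (hP : volume (P : Set (Rn n)) = 1) (hn : 0 < n)
    (hw : IsCoerciveWeight P μ₀ φ₀) (hμ₀ : μ₀ ≠ 0) (hβ : 0 < β)
    (hb : Tendsto (fun k => (b k : EReal)) atTop (𝓝 β)) :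
    (∀ k, 0 < k → 0 < b k → IsProbabilityMeasure (gibbs P μ₀ φ₀ k (b k))) ∧
    (∃ C : ℝ, (⨅ ν, (freeEnergy P μ₀ φ₀ β ν - (C : EReal))) = 0 ∧
      SatisfiesLDP (fun k => empiricalLaw P μ₀ φ₀ k (b k)) (fun k => numPoints P k * b k)
        (fun ν => freeEnergy P μ₀ φ₀ β ν - (C : EReal))) ∧
    (β ≠ ⊤ → ∃ φ, (IsMASolution P μ₀ φ₀ β.toReal φ ∧
        ∀ ψ, IsMASolution P μ₀ φ₀ β.toReal ψ → ψ = φ) ∧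
      ∃ μ : ProbOn μ₀.support, IsMongeAmpere φ μ.meas ∧ EmpiricalConvergesTo P μ₀ φ₀ b μ) ∧
    (β = ⊤ → ∃ μ : ProbOn μ₀.support,
      IsMongeAmpere (convexEnvelope P μ₀.support φ₀) μ.meas ∧
      EmpiricalConvergesTo P μ₀ φ₀ b μ) := by
  refine ⟨fun k hk hbk => isProbabilityMeasure_gibbs hw hμ₀ hk hbk, ?_⟩
  induction β with
  | bot => exact absurd hβ not_lt_bot
  | top =>
    obtain ⟨μ, hMA, C, hμ, hC⟩ := exists_minimizer_transportCost hP hw hμ₀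
    obtain ⟨h1, h2⟩ := satisfiesLDP_and_empiricalConvergesTo hP hn hw hμ₀ hβ hb hμ hC
    exact ⟨⟨C, h1⟩, fun h => absurd rfl h, fun _ => ⟨μ, hMA, h2⟩⟩
  | coe β =>
    have hβ' : 0 < β := by exact_mod_cast hβ
    obtain ⟨φ, hφ⟩ := exists_isMASolution hP hw hμ₀ hβ'
    obtain ⟨μ, hμ, hF, hmin⟩ := hφ.exists_minimizer hP hw hμ₀ hβ'
    obtain ⟨h1, h2⟩ := satisfiesLDP_and_empiricalConvergesTo hP hn hw hμ₀ hβ hb hF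
      (fun ν hν => hF ▸ hmin ν hν)
    rw [EReal.toReal_coe]
    refine ⟨⟨_, h1⟩, fun _ => ⟨φ, ⟨hφ, fun ψ hψ => hψ.unique hP hw hμ₀ hβ' hφ⟩, μ, ?_, h2⟩,
      fun h => absurd h (EReal.coe_ne_top β)⟩
    rw [hμ]
    exact hφ.2.2

end CoerciveWeights

/-! ### Reduction to coercive weights -/

section Reduction

lemma IsWeightedMeasure.exists_radius (hw : IsWeightedMeasure P μ₀ φ₀) (M : ℝ) :
    ∃ R, ∀ x ∈ μ₀.support, R ≤ ‖x‖ → M ≤ φ₀ x - supportFun P x := by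
  have h := eventually_inf_principal.1 (hw.growth.eventually_ge_atTop M)
  obtain ⟨K, hK, hKs⟩ := mem_cocompact.1 h
  obtain ⟨R, hR⟩ := hK.isBounded.exists_norm_le
  refine ⟨R + 1, fun x hx hRx => hKs (fun hxK => ?_) hx⟩
  linarith [hR x hxK]

lemma IsWeightedMeasure.exists_le (hw : IsWeightedMeasure P μ₀ φ₀) :
    ∃ m, ∀ x ∈ μ₀.support, m ≤ φ₀ x - supportFun P x := by
  obtain ⟨R, hR⟩ := hw.exists_radius 0
  obtain ⟨m, hm⟩ := ((isCompact_closedBall (0 : Rn n) R).inter_right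
    (Measure.isClosed_support (μ := μ₀))).bddBelow_image
    ((hw.continuousOn.sub continuous_supportFun.continuousOn).mono inter_subset_right)
  refine ⟨min m 0, fun x hx => ?_⟩
  rcases le_total R ‖x‖ with h | h
  · exact (min_le_right _ _).trans (hR x hx h)
  · exact (min_le_left _ _).trans (hm ⟨x, ⟨by simpa using h, hx⟩, rfl⟩)

/-- A weight on the support extends to a coercive weight: the maximum of a continuous extension of
`φ₀ - φ_P` and of its inf-convolution with the norm extends `φ₀ - φ_P` and is proper. -/
lemma IsWeightedMeasure.exists_isCoerciveWeight (hw : IsWeightedMeasure P μ₀ φ₀) (hμ₀ : μ₀ ≠ 0) :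
    ∃ φ₁, IsCoerciveWeight P μ₀ φ₁ ∧ EqOn φ₀ φ₁ μ₀.support := by
  obtain ⟨m, hm⟩ := hw.exists_le
  have hcl : IsClosed μ₀.support := Measure.isClosed_support
  obtain ⟨x₀, hx₀⟩ := Measure.nonempty_support hμ₀
  have : Nonempty μ₀.support := ⟨⟨x₀, hx₀⟩⟩
  have hVc : ContinuousOn (fun x => φ₀ x - supportFun P x) μ₀.support :=
    hw.continuousOn.sub continuous_supportFun.continuousOn
  obtain ⟨g, hg⟩ := ContinuousMap.exists_restrict_eq hcl
    (⟨_, continuousOn_iff_continuous_domRestrict.1 hVc⟩ : C(μ₀.support, ℝ))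
  have hgX : ∀ x ∈ μ₀.support, g x = φ₀ x - supportFun P x := fun x hx =>
    congrArg (fun f => f ⟨x, hx⟩) hg
  set w : Rn n → ℝ := fun x => ⨅ y : μ₀.support, (φ₀ y - supportFun P y + dist x y) with hwdef
  have hbdd : ∀ x : Rn n,
      BddBelow (range fun y : μ₀.support => φ₀ y - supportFun P y + dist x y) := by
    refine fun x => ⟨m, ?_⟩
    rintro _ ⟨y, rfl⟩
    exact (hm y y.2).trans (le_add_of_nonneg_right dist_nonneg)
  have hwle : ∀ x : Rn n, ∀ y ∈ μ₀.support, w x ≤ φ₀ y - supportFun P y + dist x y := fun x y hy =>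
    ciInf_le (hbdd x) (⟨y, hy⟩ : μ₀.support)
  have hwc : Continuous w := by
    refine (LipschitzWith.of_le_add fun x x' => ?_).continuous
    rw [← sub_le_iff_le_add]
    refine le_ciInf fun y => ?_
    linarith [hwle x y y.2, dist_triangle x x' y]
  have hwt : Tendsto w (cocompact (Rn n)) atTop := by
    refine tendsto_atTop.2 fun M => ?_
    obtain ⟨R, hR⟩ := hw.exists_radius M
    filter_upwards [tendsto_norm_cocompact_atTop.eventually_ge_atTop (R + (M - m))] with x hx
    refine le_ciInf fun y => ?_
    rcases le_total R ‖(y : Rn n)‖ with h | h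
    · linarith [hR y y.2 h, dist_nonneg (x := x) (y := (y : Rn n))]
    · have h1 : ‖x‖ - ‖(y : Rn n)‖ ≤ dist x y := by
        rw [dist_eq_norm]; exact norm_sub_norm_le _ _
      linarith [hm y y.2]
  have heq : EqOn φ₀ (fun x => max (g x) (w x) + supportFun P x) μ₀.support := fun x hx => by
    have h1 := hwle x x hx
    rw [dist_self, add_zero] at h1
    simp only
    rw [hgX x hx, max_eq_left h1, sub_add_cancel]
  refine ⟨fun x => max (g x) (w x) + supportFun P x,
    ⟨(g.continuous.max hwc).add continuous_supportFun, ?_, fun t ht => ?_⟩, heq⟩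
  · simp only [add_sub_cancel_right]
    exact tendsto_atTop_mono (fun x => le_max_right _ _) hwt
  · refine lt_of_eq_of_lt (lintegral_congr_ae ?_) (hw.finite_mass t ht)
    filter_upwards [Measure.support_mem_ae (μ := μ₀)] with x hx
    rw [heq hx]

variable {φ₁ : Rn n → ℝ}

lemma gibbsWeight_congr [SigmaFinite μ₀] (h : EqOn φ₀ φ₁ μ₀.support) :
    gibbsWeight P μ₀ φ₀ = gibbsWeight P μ₀ φ₁ := by
  funext k b
  refine withDensity_congr_ae ?_
  filter_upwards [ae_pi_forall_mem_support (μ₀ := μ₀) (numPoints P k)] with x hx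
  rw [Finset.sum_congr rfl fun i _ => h (hx i)]

lemma gibbs_congr [SigmaFinite μ₀] (h : EqOn φ₀ φ₁ μ₀.support) :
    gibbs P μ₀ φ₀ = gibbs P μ₀ φ₁ := by
  funext k b
  rw [gibbs, gibbs, gibbsWeight_congr h]

lemma empiricalLaw_congr [SigmaFinite μ₀] (h : EqOn φ₀ φ₁ μ₀.support) :
    empiricalLaw P μ₀ φ₀ = empiricalLaw P μ₀ φ₁ := by
  funext k b A
  rw [empiricalLaw, empiricalLaw, gibbs_congr h]

lemma empiricalConvergesTo_congr [SigmaFinite μ₀] (h : EqOn φ₀ φ₁ μ₀.support) :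
    EmpiricalConvergesTo P μ₀ φ₀ = EmpiricalConvergesTo P μ₀ φ₁ := by
  funext b μ
  rw [EmpiricalConvergesTo, EmpiricalConvergesTo, empiricalLaw_congr h]

lemma transportCost_congr {X : Set (Rn n)} (h : EqOn φ₀ φ₁ X) (ν : ProbOn X) :
    transportCost P φ₀ ν.meas = transportCost P φ₁ ν.meas := by
  refine iInf_congr fun G => iInf_congr fun hG => ?_
  have hae : ∀ᵐ z ∂G, φ₀ z.1 = φ₁ z.1 := by
    have h1 : ∀ᵐ x ∂G.map Prod.fst, φ₀ x = φ₁ x := by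
      rw [hG.1]
      filter_upwards [ae_iff.2 ν.2] with x hx
      exact h hx
    exact ae_of_ae_map measurable_fst.aemeasurable h1
  rw [eintegral, eintegral]
  congr 2 <;> refine lintegral_congr_ae ?_ <;> filter_upwards [hae] with z hz <;> rw [hz]

lemma freeEnergy_congr (h : EqOn φ₀ φ₁ μ₀.support) :
    freeEnergy P μ₀ φ₀ = freeEnergy P μ₀ φ₁ := by
  funext β ν
  rw [freeEnergy, freeEnergy, transportCost_congr h]

lemma isMASolution_congr (h : EqOn φ₀ φ₁ μ₀.support) :
    IsMASolution P μ₀ φ₀ = IsMASolution P μ₀ φ₁ := by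
  funext β φ
  rw [IsMASolution, IsMASolution, withDensity_congr_ae]
  filter_upwards [Measure.support_mem_ae (μ := μ₀)] with x hx
  rw [h hx]

lemma convexEnvelope_congr {X : Set (Rn n)} (h : EqOn φ₀ φ₁ X) :
    convexEnvelope P X φ₀ = convexEnvelope P X φ₁ := by
  funext x
  rw [convexEnvelope, convexEnvelope]
  congr 1
  ext t
  refine exists_congr fun φ => and_congr_right fun _ => and_congr_left fun _ =>
    forall₂_congr fun y hy => ?_
  rw [h hy]

end Reduction

end PermanentalLDP

open PermanentalLDP in
theorem mainTheorem1 (n : ℕ) (hn : 0 < n)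
    (P : ConvexBody (Rn n)) (hP : volume (P : Set (Rn n)) = 1)
    (μ₀ : Measure (Rn n)) (hμ₀ : μ₀ ≠ 0) (φ₀ : Rn n → ℝ) (hw : IsWeightedMeasure P μ₀ φ₀)
    (β : EReal) (hβ : 0 < β) (b : ℕ → ℝ)
    (hb : Tendsto (fun k => (b k : EReal)) atTop (𝓝 β)) :
    -- the point processes are well defined
    (∀ k, 0 < k → 0 < b k → IsProbabilityMeasure (gibbs P μ₀ φ₀ k (b k))) ∧
    -- the large deviation principle
    (∃ C : ℝ, (⨅ ν, (freeEnergy P μ₀ φ₀ β ν - (C : EReal))) = 0 ∧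
      SatisfiesLDP (fun k => empiricalLaw P μ₀ φ₀ k (b k)) (fun k => numPoints P k * b k)
        (fun ν => freeEnergy P μ₀ φ₀ β ν - (C : EReal))) ∧
    -- the limit for finite inverse temperature
    (β ≠ ⊤ → ∃ φ, (IsMASolution P μ₀ φ₀ β.toReal φ ∧
        ∀ ψ, IsMASolution P μ₀ φ₀ β.toReal ψ → ψ = φ) ∧
      ∃ μ : ProbOn μ₀.support, IsMongeAmpere φ μ.meas ∧ EmpiricalConvergesTo P μ₀ φ₀ b μ) ∧
    -- the limit for infinite inverse temperature
    (β = ⊤ → ∃ μ : ProbOn μ₀.support,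
      IsMongeAmpere (convexEnvelope P μ₀.support φ₀) μ.meas ∧
      EmpiricalConvergesTo P μ₀ φ₀ b μ) := by
  obtain ⟨φ₁, hw₁, h⟩ := hw.exists_isCoerciveWeight hμ₀
  have := hw₁.sigmaFinite
  rw [gibbs_congr h, freeEnergy_congr h, empiricalLaw_congr h, isMASolution_congr h,
    empiricalConvergesTo_congr h, convexEnvelope_congr h]
  exact hw₁.main hP hn hμ₀ hβ hb
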